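/- Let $N\ge 3$, $\alpha\in(0,2)$, $\beta>0$, $b\in\mathbb R$ and $c\ge 0$. All function spaces consist of complex-valued functions on $\mathbb R^N$ with Lebesgue measure. Put $\mathcal D_0=C_c^\infty(\mathbb R^N\setminus\{0\})$ and, for $u\in\mathcal D_0$, $$A_{b,c}u=(1+|x|^\alpha)\Delta u+b|x|^{\alpha-2}x\cdot\nabla u-c|x|^{\alpha-2}u-|x|^\beta u .$$ Let $\lambda>0$ be such that, for all $x\in\mathbb R^N\setminus\{0\}$, $$\frac{1}{2|x|^2}\Big(\frac{N-2}{2}\Big)^2+\Big(c-1-\frac{\alpha-b}{2}(\alpha-2+N)\Big)|x|^{\alpha-2}+\lambda>0 .$$ Define the form $$\mathfrak a(u,v)=\int_{\mathbb R^N}\Big((1+|x|^\alpha)\nabla u\cdot\nabla\overline v+(\alpha-b)|x|^{\alpha-2}(x\cdot\nabla u)\,\overline v+c|x|^{\alpha-2}u\overline v+|x|^\beta u\overline v+\lambda u\overline v\Big)\,dx$$ on the domain $$D(\mathfrak a)=\{u\in H^1(\mathbb R^N):(1+|x|^\alpha)^{1/2}\nabla u,\ |x|^{(\alpha-2)/2}u,\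 |x|^{\beta/2}u\in L^2(\mathbb R^N)\},$$ and let $\widetilde A_{b,c}$ be the associated operator on $L^2(\mathbb R^N)$: $u\in D(\widetilde A_{b,c})$ with $-\widetilde A_{b,c}u=v\in L^2(\mathbb R^N)$ if and only if $u\in D(\mathfrak a)$ and $\mathfrak a(u,h)=\int_{\mathbb R^N} v\overline h\,dx$ for all $h\in D(\mathfrak a)$. Then $\widetilde A_{b,c}$ generates a $C_0$-semigroup $(e^{t\widetilde A_{b,c}})_{t\ge0}$ on $L^2(\mathbb R^N)$. This semigroup is sub-Markovian: each $e^{t\widetilde A_{b,c}}$ maps non-negative functions to non-negative functions and satisfies $\|e^{t\widetilde A_{b,c}}f\|_\infty\le\|f\|_\infty$ for $f\in L^2(\mathbb R^N)\cap L^\infty(\mathbb R^N)$. It extrapolates to a family $(T_p(t))_{t\ge0}$, $2\le p<\infty$, of analytic contraction $C_0$-semigroups on $L^p(\mathbb R^N)$. That is, $T_2(t)=e^{t\widetilde A_{b,c}}$; the family is consistent, meaning that $T_p(t)f=T_q(t)f$ for $f\in L^p\cap L^q$, $p,q\in[2,\infty)$ and $t\ge0$; and for each $p\in[2,\infty)$,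 $T_p$ is a $C_0$-semigroup of contractions that extends, for some $\theta\in(0,\pi/2]$ (which may depend on $p$), to a holomorphic semigroup of contractions on the sector $\{z\ne0:|\arg z|<\theta\}$ that is strongly continuous at $0$. For each $p\in[2,\infty)$ the generator of $T_p$ is an extension of $(A_{b,c}-\lambda,\mathcal D_0)$. -/

import Mathlib

open MeasureTheory Filter Topology
open scoped ENNReal NNReal ContDiff ComplexConjugate

noncomputable section

namespace PolyGrowth

/-- Euclidean space `ℝ^N`. -/
abbrev RN (N : ℕ) : Type := EuclideanSpace ℝ (Fin N)

/-- The complex Banach space `L^p(ℝ^N)` with respect to Lebesgue measure. -/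
abbrev LpRN (N : ℕ) (p : ℝ≥0∞) : Type := Lp (α := RN N) ℂ p volume

/-! ### The differential operator on test functions -/

/-- `u ∈ 𝒟₀ = C_c^∞(ℝ^N ∖ {0})`, complex valued, extended by zero to `ℝ^N`. -/
structure IsTestAwayFromZero {N : ℕ} (u : RN N → ℂ) : Prop where
  smooth : ContDiff ℝ ∞ u
  compact : HasCompactSupport u
  away : (0 : RN N) ∉ tsupport u

/-- `A_{b,c} u = (1+|x|^α) Δu + b |x|^{α-2} x·∇u - c |x|^{α-2} u - |x|^β u`;
here `x·∇u(x)` is the derivative of `u` at `x` in the direction `x`. -/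
def diffOp {N : ℕ} (α β b c : ℝ) (u : RN N → ℂ) (x : RN N) : ℂ :=
  ((1 + ‖x‖ ^ α : ℝ) : ℂ) * Laplacian.laplacian u x
    + ((b * ‖x‖ ^ (α - 2) : ℝ) : ℂ) * fderiv ℝ u x x
    - ((c * ‖x‖ ^ (α - 2) : ℝ) : ℂ) * u x
    - ((‖x‖ ^ β : ℝ) : ℂ) * u x

/-! ### Weak gradients and the form -/

/-- `G` is a weak gradient of `u` on `ℝ^N`. -/
structure HasWeakGradient {N : ℕ} (u : RN N → ℂ) (G : RN N → EuclideanSpace ℂ (Fin N)) :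
    Prop where
  locInt : LocallyIntegrable u volume
  locInt_grad : LocallyIntegrable G volume
  integral_eq : ∀ φ : RN N → ℝ, ContDiff ℝ ∞ φ → HasCompactSupport φ → ∀ i : Fin N,
    ∫ x, u x * ((fderiv ℝ φ x (EuclideanSpace.single i 1) : ℝ) : ℂ)
      = - ∫ x, G x i * ((φ x : ℝ) : ℂ)

open Classical in
/-- The weak gradient `∇u` (unique almost everywhere when it exists; `0` if there is none). -/
def weakGrad {N : ℕ} (u : RN N → ℂ) : RN N → EuclideanSpace ℂ (Fin N) :=
  if h : ∃ G, HasWeakGradient u G then h.choose else 0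

/-- `u ∈ H¹(ℝ^N)`. -/
def MemH1 {N : ℕ} (u : RN N → ℂ) : Prop :=
  MemLp u 2 volume ∧ (∃ G, HasWeakGradient u G) ∧ MemLp (weakGrad u) 2 volume

/-- The form domain `D(𝔞)`. -/
def formDomain (N : ℕ) (α β : ℝ) : Set (LpRN N 2) :=
  {u | MemH1 u ∧
    MemLp (fun x => Real.sqrt (1 + ‖x‖ ^ α) • weakGrad u x) 2 volume ∧
    MemLp (fun x => Real.sqrt (‖x‖ ^ (α - 2)) • u x) 2 volume ∧
    MemLp (fun x => Real.sqrt (‖x‖ ^ β) • u x) 2 volume}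

/-- The sesquilinear form `𝔞(u,v)`, linear in `u` and conjugate linear in `v`. -/
def form {N : ℕ} (α β b c lam : ℝ) (u v : LpRN N 2) : ℂ :=
  ∫ x : RN N,
    ( ((1 + ‖x‖ ^ α : ℝ) : ℂ) * ∑ i, weakGrad u x i * conj (weakGrad v x i)
      + (((α - b) * ‖x‖ ^ (α - 2) : ℝ) : ℂ)
          * (∑ i, ((x i : ℝ) : ℂ) * weakGrad u x i) * conj (v x)
      + ((c * ‖x‖ ^ (α - 2) : ℝ) : ℂ) * u x * conj (v x)
      + ((‖x‖ ^ β : ℝ) : ℂ) * u x * conj (v x)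
      + (lam : ℂ) * u x * conj (v x) )

/-- The graph of the operator `Ã_{b,c}` on `L²` associated with the form: `(u, g)` belongs to it
iff `u ∈ D(𝔞)` and `𝔞(u,h) = ⟨-g, h⟩` for all `h ∈ D(𝔞)`.
(`inner ℂ h v` is `∫ v h̄`, conjugate linear in `h`.) -/
def formOperatorGraph (N : ℕ) (α β b c lam : ℝ) : Set (LpRN N 2 × LpRN N 2) :=
  {w | w.1 ∈ formDomain N α β ∧
    ∀ h ∈ formDomain N α β, form α β b c lam w.1 h = inner ℂ h (-w.2)}

/-- The shift `lam` is admissible: `lam > 0` and, with the Hardy constant `c₀ = ((N-2)/2)²`,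
`c₀/(2|x|²) + (c - 1 - (α-b)/2 (α-2+N)) |x|^{α-2} + lam > 0` for all `x ≠ 0`. -/
def AdmissibleShift (N : ℕ) (α b c lam : ℝ) : Prop :=
  0 < lam ∧ ∀ x : RN N, x ≠ 0 →
    0 < (((N : ℝ) - 2) / 2) ^ 2 / (2 * ‖x‖ ^ 2)
      + (c - 1 - (α - b) / 2 * (α - 2 + N)) * ‖x‖ ^ (α - 2) + lam

/-! ### Semigroups -/

section Semigroup

variable {E : Type*} [NormedAddCommGroup E] [NormedSpace ℂ E]

/-- `T` is a `C₀`-semigroup. -/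
structure IsC0Semigroup (T : ℝ≥0 → E →L[ℂ] E) : Prop where
  map_zero : T 0 = ContinuousLinearMap.id ℂ E
  map_add : ∀ s t, T (s + t) = (T s).comp (T t)
  tendsto_zero : ∀ f, Tendsto (fun t => T t f) (𝓝 0) (𝓝 f)

/-- The graph of the generator: `(f, g)` belongs to it iff `(T(h)f - f)/h → g` as `h → 0⁺`. -/
def generatorGraph (T : ℝ≥0 → E →L[ℂ] E) : Set (E × E) :=
  {w | Tendsto (fun h : ℝ≥0 => (((h : ℝ) : ℂ)⁻¹) • (T h w.1 - w.1)) (𝓝[>] 0) (𝓝 w.2)}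

/-- The open sector `{z ≠ 0 : |arg z| < θ}`. -/
def sector (θ : ℝ) : Set ℂ := {z | z ≠ 0 ∧ |z.arg| < θ}

/-- `T` is an analytic contraction `C₀`-semigroup: it is a `C₀`-semigroup of contractions that
extends to a holomorphic, contractive, strongly continuous semigroup on some sector around
`(0, ∞)`. -/
structure IsAnalyticContractionSemigroup (T : ℝ≥0 → E →L[ℂ] E) : Prop where
  c0 : IsC0Semigroup T
  contraction : ∀ t, ‖T t‖ ≤ 1
  analytic : ∃ θ : ℝ, 0 < θ ∧ θ ≤ Real.pi / 2 ∧ ∃ S : ℂ → E →L[ℂ] E,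
    (∀ t : ℝ≥0, 0 < t → S ((t : ℝ) : ℂ) = T t) ∧
    DifferentiableOn ℂ S (sector θ) ∧
    (∀ z ∈ sector θ, ∀ w ∈ sector θ, S (z + w) = (S z).comp (S w)) ∧
    (∀ z ∈ sector θ, ‖S z‖ ≤ 1) ∧
    ∀ f, Tendsto (fun z => S z f) (𝓝[sector θ] 0) (𝓝 f)

end Semigroup

/-- A family of operators on `L²(ℝ^N)` is sub-Markovian: positive and `L^∞`-contractive. -/
structure IsSubMarkovian {N : ℕ} (T : ℝ≥0 → LpRN N 2 →L[ℂ] LpRN N 2) : Prop where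
  positive : ∀ (t : ℝ≥0) (f : LpRN N 2),
    (∀ᵐ x, 0 ≤ (f x).re ∧ (f x).im = 0) → ∀ᵐ x, 0 ≤ (T t f x).re ∧ (T t f x).im = 0
  linfty_contractive : ∀ (t : ℝ≥0) (f : LpRN N 2),
    eLpNorm (T t f) ⊤ volume ≤ eLpNorm f ⊤ volume

end PolyGrowth

end

open MeasureTheory Filter Topology
open scoped ENNReal NNReal ContDiff ComplexConjugate

noncomputable section

namespace PolyGrowth

/-! On `L²` everything rests on two estimates for the quadratic form. Integrating `|u|²` by parts
against the field `|x|^{α-2} x` turns the real part of the drift term into `-(α-b)/2 (α-2+N)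
∫|x|^{α-2}|u|²`. Hardy's inequality, with `c₀ = ((N-2)/2)²`, lets half of `∫|∇u|²` pay for `c₀/2
∫|u|²/|x|²`. The condition on `λ`, multiplied by `|u|²` and integrated, then shows that `Re 𝔞(u,u)`
dominates `½∫|∇u|² + ∫|x|^α|∇u|² + ∫|x|^{α-2}|u|² + ∫|x|^β|u|²` (`IsFormPair.re_form_ge`). Only the
drift has an imaginary part, and Young's inequality bounds it by the second and third of these
integrals (`IsFormPair.abs_im_form_le`). Hence the form is sectorial, with `M = |α-b|/2 + 1`.

The form domain is realised as a closed subspace of an `L²` space of weighted pairs `(√(1+|x|^α) ∇u,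
w u)`, the relation between function and weak gradient being an orthogonality condition. This makes
it a Hilbert space on which the form is a bounded operator, and Lax–Milgram yields the resolvent
(`isSectorialResolvent_of_form`). The Yosida approximations keep the sectorial numerical range, so
their exponentials are contractions on the cone `M|Im z| ≤ Re z`. They converge strongly there to a
holomorphic contraction semigroup whose generator is exactly the operator of the form
(`IsYosidaLimit.generatorGraph_eq`).

For the sub-Markov property, the set `Re f ≤ k`, `k ≥ 0`, is closed and convex. Testing the
resolvent equation with `(Re u - k)⁺` shows that `μ R(μ)` preserves it (`re_le_of_resolvent`). The
exponentials of the Yosida approximations are limits of convex combinations of powers of `μ R(μ)`,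
so the semigroup preserves it too. Rotating `f` by unimodular constants gives positivity and `L^∞`
contractivity.

For `L^r`, `r ≥ 2`, Stein interpolation between `L^∞` contractivity on the half-line and `L²`
contractivity on a sector of angle `θ` gives `L^r` contractivity on the sector of angle `2θ/r`
(`stein_interpolation`). The operators extend by density from `L² ∩ L^r`. Limits pass from `L²` to
`L^r` through `‖h‖_r^r ≤ ‖h‖_2 ‖h‖_{2r-2}^{r-1}`, which handles strong continuity and the generator.
Holomorphy comes from weak holomorphy plus the norm bound.

Functions in `𝒟₀` vanish near the origin, so the singular coefficients are smooth on their support.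
Classical integration by parts puts `(u, (A-λ)u)` into the `L²` graph, and the difference quotients,
being averages of `S(s)(A-λ)u`, also converge in `L^r`. -/

/-! ### Generation of analytic contraction semigroups on a Hilbert space -/

section Dissipative

variable {H : Type*} [NormedAddCommGroup H] [InnerProductSpace ℂ H] [CompleteSpace H]

/-- The exponential of a bounded dissipative operator is a contraction. -/
theorem norm_exp_le_one_of_dissipative (C : H →L[ℂ] H)
    (hC : ∀ f, (inner ℂ f (C f)).re ≤ 0) : ‖NormedSpace.exp C‖ ≤ 1 := by
  refine ContinuousLinearMap.opNorm_le_bound _ zero_le_one fun f => ?_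
  have hd : ∀ t : ℝ, HasDerivAt (fun t : ℝ => NormedSpace.exp (t • C) f)
      (C (NormedSpace.exp (t • C) f)) t := fun t => by
    have h := (hasDerivAt_exp_smul_const' (𝕂 := ℝ) C t)
    exact (((ContinuousLinearMap.apply ℂ H f).restrictScalars ℝ).hasFDerivAt.comp_hasDerivAt t h)
  have hn : ∀ t : ℝ, HasDerivAt (fun t : ℝ => ‖NormedSpace.exp (t • C) f‖ ^ 2)
      (2 * (inner ℂ (NormedSpace.exp (t • C) f) (C (NormedSpace.exp (t • C) f))).re) t := fun t => by
    have h := (hd t).inner ℂ (hd t)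
    have h2 := (Complex.reCLM.hasFDerivAt.comp_hasDerivAt t h)
    have e1 : (fun t : ℝ => ‖NormedSpace.exp (t • C) f‖ ^ 2) = (Complex.reCLM ∘ fun t : ℝ =>
        inner ℂ (NormedSpace.exp (t • C) f) (NormedSpace.exp (t • C) f)) := by
      ext s
      simp [inner_self_eq_norm_sq_to_K, ← Complex.ofReal_pow]
    rw [e1]
    refine h2.congr_deriv ?_
    rw [Complex.reCLM_apply, Complex.add_re,
      ← inner_conj_symm (C ((NormedSpace.exp (t • C)) f)), Complex.conj_re]
    ring
  -- The derivative of `‖exp(tC) f‖²` is twice the real part of the numerical range at `exp(tC) f`.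
  have ha := antitone_of_hasDerivAt_nonpos hn (fun t => by
    have := hC (NormedSpace.exp (t • C) f)
    simp only [Pi.zero_apply]
    linarith)
  have h01 := ha zero_le_one
  simp only [one_smul, zero_smul, NormedSpace.exp_zero] at h01
  have : ‖NormedSpace.exp C f‖ ≤ ‖f‖ := by
    refine le_of_sq_le_sq ?_ (norm_nonneg _)
    simpa using h01
  simpa using this

/-- Exponentials of commuting dissipative operators differ at most by the operators themselves. -/
theorem norm_exp_sub_exp_le_of_dissipative (B C : H →L[ℂ] H) (hBC : Commute B C)
    (hB : ∀ f, (inner ℂ f (B f)).re ≤ 0) (hC : ∀ f, (inner ℂ f (C f)).re ≤ 0) (f : H) :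
    ‖NormedSpace.exp B f - NormedSpace.exp C f‖ ≤ ‖B f - C f‖ := by
  let +nondep : NormedAlgebra ℚ (H →L[ℂ] H) := .restrictScalars ℚ ℂ _
  have hDC : Commute (B - C) C := hBC.sub_left (Commute.refl C)
  have hd : ∀ t : ℝ, HasDerivAt (fun t : ℝ => NormedSpace.exp (t • (B - C)) (NormedSpace.exp C f))
      (NormedSpace.exp (t • (B - C)) ((B - C) (NormedSpace.exp C f))) t := fun t => by
    have h := (hasDerivAt_exp_smul_const (𝕂 := ℝ) (B - C) t)
    exact (((ContinuousLinearMap.apply ℂ H (NormedSpace.exp C f)).restrictScalars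
      ℝ).hasFDerivAt.comp_hasDerivAt t h)
  -- Mean value inequality along `t ↦ exp(t(B-C)) exp(C) f`. By commutation its derivative is
  -- `exp(tB + (1-t)C)` applied to `(B-C) f`, and convex combinations of dissipative operators are
  -- dissipative.
  have key := norm_image_sub_le_of_norm_deriv_le_segment_01' (C := ‖B f - C f‖)
    (fun t _ => (hd t).hasDerivWithinAt) (fun t ht => ?_)
  · have e : NormedSpace.exp (B - C) (NormedSpace.exp C f) = NormedSpace.exp B f := by
      rw [← mul_apply_eq_comp, ← NormedSpace.exp_add_of_commute hDC, sub_add_cancel]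
    simpa [e] using key
  · have e : NormedSpace.exp (t • (B - C)) ((B - C) (NormedSpace.exp C f)) =
        NormedSpace.exp (t • (B - C) + C) ((B - C) f) := by
      have h1 : (B - C) * NormedSpace.exp C = NormedSpace.exp C * (B - C) := (hDC.exp_right).eq
      rw [NormedSpace.exp_add_of_commute (hDC.smul_left t)]
      exact congrArg (fun v => NormedSpace.exp (t • (B - C)) v) (DFunLike.congr_fun h1 f)
    rw [e]
    refine (ContinuousLinearMap.le_of_opNorm_le _ (norm_exp_le_one_of_dissipative _ ?_) _).trans ?_
    · intro g
      have e2 : (t • (B - C) + C) g = (t : ℂ) • B g + ((1 - t : ℝ) : ℂ) • C g := by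
        simp [sub_smul, smul_sub]
        abel
      rw [e2, inner_add_right, inner_smul_right, inner_smul_right, Complex.add_re,
        Complex.re_ofReal_mul, Complex.re_ofReal_mul]
      have := mul_nonneg ht.1 (neg_nonneg.2 (hB g))
      have := mul_nonneg (sub_nonneg.2 ht.2.le) (neg_nonneg.2 (hC g))
      nlinarith
    · simp

end Dissipative

/-! ### Norm holomorphy from weak holomorphy -/

/-- The difference quotients of a bounded holomorphic function are Lipschitz near the centre. -/
theorem norm_slope_sub_slope_le {h : ℂ → ℂ} {z : ℂ} {r C : ℝ} (hr : 0 < r)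
    (hd : DifferentiableOn ℂ h (Metric.ball z r)) (hb : ∀ w ∈ Metric.ball z r, ‖h w‖ ≤ C)
    {v w : ℂ} (hv : ‖v‖ < r / 4) (hw : ‖w‖ < r / 4) (hv0 : v ≠ 0) (hw0 : w ≠ 0) :
    ‖v⁻¹ * (h (z + v) - h z) - w⁻¹ * (h (z + w) - h z)‖ ≤ 8 * C / r ^ 2 * ‖v - w‖ := by
  have hz : z ∈ Metric.ball z r := Metric.mem_ball_self hr
  have hqd : DifferentiableOn ℂ (dslope h z) (Metric.ball z r) :=
    (Complex.differentiableOn_dslope (Metric.isOpen_ball.mem_nhds hz)).2 hd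
  -- Schwarz lemma for `h`, whose values stay within `2C` of `h z`.
  have hqb : ∀ x ∈ Metric.ball z r, ‖dslope h z x‖ ≤ 2 * C / r := fun x hx =>
    Complex.norm_dslope_le_div_of_mapsTo_ball hd (fun y hy => by
      rw [mem_closedBall_iff_norm, two_mul]
      exact (norm_sub_le _ _).trans (add_le_add (hb y hy) (hb z hz))) hx
  have hsub : Metric.ball (z + w) (r / 2) ⊆ Metric.ball z r := by
    refine Metric.ball_subset_ball' ?_
    simp only [dist_self_add_left]
    linarith
  -- Schwarz lemma again, now for the difference quotient on the ball of radius `r/2` about `z + w`,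
  -- which contains `z + v`.
  have key := Complex.dist_le_div_mul_dist_of_mapsTo_ball (f := dslope h z) (c := z + w)
    (z := z + v) (R₁ := r / 2) (R₂ := 4 * C / r) (hqd.mono hsub) (fun y hy => by
      rw [mem_closedBall_iff_norm]
      refine (norm_sub_le _ _).trans ((add_le_add (hqb y (hsub hy))
        (hqb _ (hsub (Metric.mem_ball_self (by linarith))))).trans (le_of_eq ?_))
      ring) (by
      rw [Metric.mem_ball, dist_add_left, dist_eq_norm]
      exact (norm_sub_le _ _).trans_lt (by linarith))
  rw [dist_add_left, dist_eq_norm, dist_eq_norm, dslope_of_ne _ (by simpa using hv0),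
    dslope_of_ne _ (by simpa using hw0), slope_def_module, slope_def_module] at key
  simp only [add_sub_cancel_left, smul_eq_mul] at key
  refine key.trans (le_of_eq ?_)
  field_simp
  ring

/-- A contractive operator family that is holomorphic against a norming set of functionals, on a
dense set of vectors, is holomorphic in operator norm. -/
theorem differentiableOn_of_weak {E F : Type*} [NormedAddCommGroup E] [NormedSpace ℂ E]
    [NormedAddCommGroup F] [NormedSpace ℂ F] [CompleteSpace F] {S : ℂ → E →L[ℂ] F} {U : Set ℂ}
    (hU : IsOpen U) (hS : ∀ z ∈ U, ‖S z‖ ≤ 1) {D : Set E} (hD : Dense D) (𝒩 : Set (F →L[ℂ] ℂ))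
    (h1 : ∀ ℓ ∈ 𝒩, ‖ℓ‖ ≤ 1)
    (hnorm : ∀ (y : F) (C : ℝ), 0 ≤ C → (∀ ℓ ∈ 𝒩, ‖ℓ y‖ ≤ C) → ‖y‖ ≤ C)
    (hdiff : ∀ f ∈ D, ∀ ℓ ∈ 𝒩, DifferentiableOn ℂ (fun z => ℓ (S z f)) U) :
    DifferentiableOn ℂ S U := by
  intro z hz
  obtain ⟨r, hr, hrU⟩ := Metric.isOpen_iff.1 hU z hz
  set Q : ℂ → E →L[ℂ] F := fun v => v⁻¹ • (S (z + v) - S z) with hQ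
  have hlip : ∀ v w : ℂ, ‖v‖ < r / 4 → ‖w‖ < r / 4 → v ≠ 0 → w ≠ 0 →
      ‖Q v - Q w‖ ≤ 8 / r ^ 2 * ‖v - w‖ := by
    intro v w hv hw hv0 hw0
    refine ContinuousLinearMap.opNorm_le_bound _ (by positivity) fun f => ?_
    revert f
    refine fun f => hD.induction (P := fun f => ‖(Q v - Q w) f‖ ≤ 8 / r ^ 2 * ‖v - w‖ * ‖f‖)
      (fun f hf => ?_) (isClosed_le (by fun_prop) (by fun_prop)) f
    refine hnorm _ _ (by positivity) fun ℓ hℓ => ?_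
    have := norm_slope_sub_slope_le (h := fun z => ℓ (S z f)) (C := ‖f‖) hr
      ((hdiff f hf ℓ hℓ).mono hrU) (fun w hw => by
        refine (ContinuousLinearMap.le_of_opNorm_le _ (h1 ℓ hℓ) _).trans ?_
        rw [one_mul]
        simpa using ContinuousLinearMap.le_of_opNorm_le _ (hS w (hrU hw)) f) hv hw hv0 hw0
    simp only [hQ, sub_apply, smul_apply, map_sub,
      map_smul, smul_eq_mul]
    simp only [mul_sub] at this ⊢
    refine this.trans (le_of_eq ?_)
    ring
  -- The Lipschitz bound is uniform over unit vectors and functionals, so the difference quotients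
  -- are Cauchy in operator norm, and completeness supplies the derivative.
  have hcau : Cauchy (map Q (𝓝[≠] 0)) := by
    rw [Metric.cauchy_iff]
    refine ⟨inferInstance, fun ε hε => ?_⟩
    set δ := min (r / 4) (ε * r ^ 2 / 32) with hδ
    have hδ0 : 0 < δ := by positivity
    refine ⟨Q '' (Metric.ball 0 δ ∩ {0}ᶜ), image_mem_map
      (inter_mem (mem_nhdsWithin_of_mem_nhds (Metric.ball_mem_nhds _ hδ0)) self_mem_nhdsWithin), ?_⟩
    rintro _ ⟨v, ⟨hv, hv0⟩, rfl⟩ _ ⟨w, ⟨hw, hw0⟩, rfl⟩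
    rw [mem_ball_zero_iff] at hv hw
    rw [dist_eq_norm]
    refine (hlip v w (hv.trans_le (min_le_left _ _)) (hw.trans_le (min_le_left _ _)) hv0
      hw0).trans_lt ?_
    have h3 : ‖v - w‖ < 2 * (ε * r ^ 2 / 32) :=
      (norm_sub_le _ _).trans_lt (by linarith [min_le_right (r / 4) (ε * r ^ 2 / 32)])
    calc 8 / r ^ 2 * ‖v - w‖ ≤ 8 / r ^ 2 * (2 * (ε * r ^ 2 / 32)) := by gcongr
      _ = ε / 2 := by field_simp; ring
      _ < ε := by linarith
  obtain ⟨L, hL⟩ := CompleteSpace.complete hcau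
  exact (hasDerivAt_iff_tendsto_slope_zero.2 hL).differentiableAt.differentiableWithinAt

section Generation

variable {H : Type*} [NormedAddCommGroup H] [InnerProductSpace ℂ H]

/-- `Γ` is the graph of a densely defined operator whose numerical range lies in the sector
`|Im| ≤ - M Re`, with resolvent `R μ` for every `μ > 0`. -/
structure IsSectorialResolvent (M : ℝ) (Γ : Set (H × H)) (R : ℝ → H →L[ℂ] H) : Prop where
  pos : 0 < M
  mem_iff : ∀ μ, 0 < μ → ∀ u g, (u, g) ∈ Γ ↔ R μ ((μ : ℂ) • u - g) = u
  mem_sector : ∀ u g, (u, g) ∈ Γ → |(inner ℂ u g).im| ≤ -M * (inner ℂ u g).re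
  dense : Dense {u | ∃ g, (u, g) ∈ Γ}

/-- The Yosida approximation `μ (μ R(μ) - 1)`. -/
def yosida (R : ℝ → H →L[ℂ] H) (μ : ℝ) : H →L[ℂ] H :=
  (μ : ℂ) • ((μ : ℂ) • R μ - 1)

/-- The closed cone `M |Im z| ≤ Re z`. -/
def cone (M : ℝ) : Set ℂ := {z | M * |z.im| ≤ z.re}

theorem cone_add {M : ℝ} (hM : 0 < M) {z w : ℂ} (hz : z ∈ cone M) (hw : w ∈ cone M) :
    z + w ∈ cone M := by
  simp only [cone, Set.mem_ofPred_eq, Complex.add_im, Complex.add_re] at *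
  nlinarith [abs_add_le z.im w.im]

theorem ofReal_mem_cone {M t : ℝ} (ht : 0 ≤ t) : (t : ℂ) ∈ cone M := by
  simpa [cone] using ht

/-! ### Resolvent estimates and Yosida approximations. -/

namespace IsSectorialResolvent

variable {M : ℝ} {Γ : Set (H × H)} {R : ℝ → H →L[ℂ] H}

theorem resolvent_mem (h : IsSectorialResolvent M Γ R)
    {μ : ℝ} (hμ : 0 < μ) (f : H) : (R μ f, (μ : ℂ) • R μ f - f) ∈ Γ := by
  rw [h.mem_iff μ hμ, sub_sub_cancel]

theorem re_nonpos (h : IsSectorialResolvent M Γ R)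
    {u g : H} (hu : (u, g) ∈ Γ) : (inner ℂ u g).re ≤ 0 := by
  have := (abs_nonneg _).trans (h.mem_sector u g hu)
  nlinarith [h.pos]

/-- Pairing `u = R μ f` with `μ u - f` and using dissipativity gives `μ ‖u‖² ≤ Re ⟪u, f⟫`. -/
theorem norm_resolvent_le (h : IsSectorialResolvent M Γ R)
    {μ : ℝ} (hμ : 0 < μ) (f : H) : μ * ‖R μ f‖ ≤ ‖f‖ := by
  have h1 := h.re_nonpos (h.resolvent_mem hμ f)
  rw [inner_sub_right, inner_smul_right, inner_self_eq_norm_sq_to_K, Complex.sub_re,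
    Complex.re_ofReal_mul] at h1
  have h2 : (inner ℂ (R μ f) f).re ≤ ‖R μ f‖ * ‖f‖ :=
    (Complex.re_le_norm _).trans (norm_inner_le_norm _ _)
  have h3 : (((‖R μ f‖ : ℂ) ^ 2).re) = ‖R μ f‖ ^ 2 := by
    rw [← Complex.ofReal_pow, Complex.ofReal_re]
  have h4 : μ * ‖R μ f‖ ^ 2 ≤ ‖R μ f‖ * ‖f‖ := by
    simp only [Complex.coe_algebraMap] at h1
    rw [h3] at h1
    linarith
  rcases (norm_nonneg (R μ f)).eq_or_lt with h0 | h0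
  · rw [← h0]
    simp
  · nlinarith

/-- The resolvent identity, written for `(μ, ν)` and for `(ν, μ)`, leaves `(ν - μ)(R μ R ν - R ν R
μ) = 0`. -/
theorem resolvent_commute (h : IsSectorialResolvent M Γ R)
    {μ ν : ℝ} (hμ : 0 < μ) (hν : 0 < ν) : Commute (R μ) (R ν) := by
  rcases eq_or_ne μ ν with rfl | hne
  · exact Commute.refl _
  have key : ∀ {μ ν : ℝ}, 0 < μ → 0 < ν → ∀ f, R μ f = R ν f + ((ν : ℂ) - μ) • R μ (R ν f) := by
    intro μ ν hμ hν f
    have := (h.mem_iff μ hμ _ _).1 (h.resolvent_mem hν f)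
    rw [map_sub, map_sub, map_smul, map_smul] at this
    rw [sub_smul]
    generalize R μ (R ν f) = a at *
    rw [← this]
    abel
  ext f
  have h1 := key hμ hν f
  have h2 := key hν hμ f
  rw [h2] at h1
  have h3 : ((ν : ℂ) - μ) • (R μ (R ν f) - R ν (R μ f)) = 0 := by
    rw [smul_sub]
    rw [add_assoc, left_eq_add] at h1
    rw [← h1, ← h2]
    module
  have h4 : (ν : ℂ) - μ ≠ 0 := sub_ne_zero.2 (by exact_mod_cast hne.symm)
  exact sub_eq_zero.1 ((smul_eq_zero.1 h3).resolve_left h4)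

theorem yosida_commute (h : IsSectorialResolvent M Γ R) {μ ν : ℝ} (hμ : 0 < μ) (hν : 0 < ν) :
    Commute (yosida R μ) (yosida R ν) := by
  unfold yosida
  refine Commute.smul_left (Commute.smul_right ?_ _) _
  refine Commute.sub_left (Commute.sub_right ?_ (Commute.one_right _)) (Commute.one_left _)
  exact Commute.smul_left (Commute.smul_right (h.resolvent_commute hμ hν) _) _

/-- With `u = R μ f` and `g = μ u - f`, the value `⟪f, yosida f⟫` is `μ (μ ⟪u, g⟫ - ‖g‖²)`. The
extra real term is nonpositive, so it moves further into the same sector. -/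
theorem yosida_sector (h : IsSectorialResolvent M Γ R) {μ : ℝ} (hμ : 0 < μ) (f : H) :
    |(inner ℂ f (yosida R μ f)).im| ≤ -M * (inner ℂ f (yosida R μ f)).re := by
  set u := R μ f with hu
  set g := (μ : ℂ) • u - f with hg
  have hf : f = (μ : ℂ) • u - g := by simp [hg]
  have hs := h.mem_sector u g (h.resolvent_mem hμ f)
  have e : yosida R μ f = (μ : ℂ) • g := by simp [yosida, hg, hu]
  have e2 : inner ℂ f (yosida R μ f) = (μ : ℂ) * ((μ : ℂ) * inner ℂ u g - ((‖g‖ ^ 2 : ℝ) : ℂ)) := by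
    rw [e, inner_smul_right]
    nth_rewrite 1 [hf]
    rw [inner_sub_left, inner_smul_left, inner_self_eq_norm_sq_to_K]
    simp
  rw [e2, Complex.re_ofReal_mul, Complex.im_ofReal_mul, Complex.sub_re, Complex.sub_im,
    Complex.re_ofReal_mul, Complex.im_ofReal_mul, Complex.ofReal_re, Complex.ofReal_im, sub_zero,
    abs_mul, abs_mul, abs_of_pos hμ]
  have h1 : μ * (μ * |(inner ℂ u g).im|) ≤ μ * (μ * (-M * (inner ℂ u g).re)) := by gcongr
  have h2 : 0 ≤ M * (μ * ‖g‖ ^ 2) := by have := h.pos; positivity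
  linarith

/-- The cone consists of multipliers that rotate the sector `|Im| ≤ -M Re` only within the left
half-plane. This yields contractivity at complex times. -/
theorem yosida_dissipative (h : IsSectorialResolvent M Γ R)
    {μ : ℝ} (hμ : 0 < μ) {z : ℂ} (hz : z ∈ cone M) (f : H) :
    (inner ℂ f ((z • yosida R μ) f)).re ≤ 0 := by
  have h1 := h.yosida_sector hμ f
  rw [smul_apply, inner_smul_right, Complex.mul_re]
  set q := inner ℂ f (yosida R μ f)
  have hz' : M * |z.im| ≤ z.re := hz
  have h2 : -(z.im * q.im) ≤ |z.im| * |q.im| := by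
    rw [← abs_mul]
    exact neg_le_abs _
  have h3 : |z.im| * |q.im| ≤ |z.im| * (-M * q.re) := by gcongr
  have h4 : q.re ≤ 0 := by nlinarith [abs_nonneg q.im, h.pos]
  nlinarith

theorem yosida_apply_of_mem (h : IsSectorialResolvent M Γ R)
    {μ : ℝ} (hμ : 0 < μ) {u g : H} (hu : (u, g) ∈ Γ) :
    yosida R μ u = (μ : ℂ) • R μ g := by
  have := (h.mem_iff μ hμ u g).1 hu
  rw [map_sub, map_smul, sub_eq_iff_eq_add] at this
  simp only [yosida, smul_apply, sub_apply, one_apply_eq_self]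
  rw [this, add_sub_cancel_left]

/-- For `u` in the domain with image `g`, the error is `R(n+1) g`, of norm at most `‖g‖/(n+1)`.
Density and contractivity do the rest. The parameter `n + 1` keeps the spectral parameter positive.
-/
theorem tendsto_smul_resolvent (h : IsSectorialResolvent M Γ R) (f : H) :
    Tendsto (fun n : ℕ => (((n + 1 : ℝ)) : ℂ) • R (n + 1) f) atTop (𝓝 f) := by
  have hpos : ∀ n : ℕ, (0 : ℝ) < n + 1 := fun n => by positivity
  have hc : ∀ (n : ℕ) (f : H), ‖(((n + 1 : ℝ)) : ℂ) • R (n + 1) f‖ ≤ ‖f‖ := fun n f => by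
    rw [norm_smul, Complex.norm_real, Real.norm_of_nonneg (hpos n).le]
    exact h.norm_resolvent_le (hpos n) f
  have hD : ∀ u g, (u, g) ∈ Γ →
      Tendsto (fun n : ℕ => (((n + 1 : ℝ)) : ℂ) • R (n + 1) u) atTop (𝓝 u) := by
    intro u g hu
    rw [tendsto_iff_norm_sub_tendsto_zero]
    refine squeeze_zero (g := fun n : ℕ => ‖g‖ * (1 / ((n : ℝ) + 1))) (fun _ => norm_nonneg _)
      (fun n => ?_) ?_
    · have := (h.mem_iff _ (hpos n) u g).1 hu
      rw [map_sub, map_smul, sub_eq_iff_eq_add] at this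
      rw [this, add_sub_cancel_left, mul_one_div, le_div_iff₀ (hpos n), mul_comm]
      exact h.norm_resolvent_le (hpos n) g
    · simpa using tendsto_one_div_add_atTop_nhds_zero_nat.const_mul ‖g‖
  rw [Metric.tendsto_atTop]
  intro ε hε
  obtain ⟨u, ⟨g, hu⟩, hfu⟩ := Metric.mem_closure_iff.1 (h.dense f) (ε / 3) (by linarith)
  obtain ⟨n₀, hn₀⟩ := Metric.tendsto_atTop.1 (hD u g hu) (ε / 3) (by linarith)
  refine ⟨n₀, fun n hn => ?_⟩
  have h1 := hn₀ n hn
  have h2 := hc n (f - u)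
  rw [map_sub, smul_sub] at h2
  rw [dist_eq_norm] at *
  calc ‖(((n + 1 : ℝ)) : ℂ) • R (n + 1) f - f‖
      = ‖((((n + 1 : ℝ)) : ℂ) • R (n + 1) f - (((n + 1 : ℝ)) : ℂ) • R (n + 1) u)
        + ((((n + 1 : ℝ)) : ℂ) • R (n + 1) u - u) - (f - u)‖ := by congr 1; abel
    _ ≤ _ := norm_sub_le _ _
    _ ≤ _ := add_le_add_left (norm_add_le _ _) _
    _ < ε := by linarith

theorem tendsto_yosida (h : IsSectorialResolvent M Γ R) {u g : H} (hu : (u, g) ∈ Γ) :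
    Tendsto (fun n : ℕ => yosida R (n + 1) u) atTop (𝓝 g) := by
  refine (h.tendsto_smul_resolvent g).congr fun n => ?_
  rw [h.yosida_apply_of_mem (by positivity) hu]

variable [CompleteSpace H]

theorem norm_exp_yosida_le (h : IsSectorialResolvent M Γ R)
    {μ : ℝ} (hμ : 0 < μ) {z : ℂ} (hz : z ∈ cone M) :
    ‖NormedSpace.exp (z • yosida R μ)‖ ≤ 1 :=
  norm_exp_le_one_of_dissipative _ (h.yosida_dissipative hμ hz)

theorem norm_exp_yosida_apply_le (h : IsSectorialResolvent M Γ R)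
    {μ : ℝ} (hμ : 0 < μ) {z : ℂ} (hz : z ∈ cone M) (f : H) :
    ‖NormedSpace.exp (z • yosida R μ) f‖ ≤ ‖f‖ := by
  simpa using ContinuousLinearMap.le_of_opNorm_le _ (h.norm_exp_yosida_le hμ hz) f

theorem norm_exp_yosida_sub_le (h : IsSectorialResolvent M Γ R)
    {μ ν : ℝ} (hμ : 0 < μ) (hν : 0 < ν) {z : ℂ} (hz : z ∈ cone M)
    (f : H) : ‖NormedSpace.exp (z • yosida R μ) f - NormedSpace.exp (z • yosida R ν) f‖ ≤
      ‖z‖ * ‖yosida R μ f - yosida R ν f‖ := by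
  refine (norm_exp_sub_exp_le_of_dissipative _ _ (((h.yosida_commute hμ hν).smul_left
    z).smul_right z) (h.yosida_dissipative hμ hz) (h.yosida_dissipative hν hz) f).trans ?_
  rw [smul_apply, smul_apply, ← smul_sub, norm_smul]

/-- The approximating semigroups are uniformly Cauchy on bounded subsets of the cone. -/
theorem exp_yosida_uniformCauchy (h : IsSectorialResolvent M Γ R)
    (f : H) (r : ℝ) {ε : ℝ} (hε : 0 < ε) :
    ∃ n₀ : ℕ, ∀ m ≥ n₀, ∀ n ≥ n₀, ∀ z ∈ cone M, ‖z‖ ≤ r →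
      ‖NormedSpace.exp (z • yosida R (m + 1)) f - NormedSpace.exp (z • yosida R (n + 1)) f‖ < ε := by
  have hpos : ∀ n : ℕ, (0 : ℝ) < n + 1 := fun n => by positivity
  obtain ⟨u, ⟨g, hu⟩, hfu⟩ := Metric.mem_closure_iff.1 (h.dense f) (ε / 3) (by linarith)
  obtain ⟨n₀, hn₀⟩ := Metric.cauchySeq_iff.1 (h.tendsto_yosida hu).cauchySeq
    (ε / (3 * (|r| + 1))) (by positivity)
  refine ⟨n₀, fun m hm n hn z hz hzr => ?_⟩
  have h1 := h.norm_exp_yosida_apply_le (hpos m) hz (f - u)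
  have h2 := h.norm_exp_yosida_apply_le (hpos n) hz (f - u)
  have h3 := h.norm_exp_yosida_sub_le (hpos m) (hpos n) hz u
  have h4 := hn₀ m hm n hn
  rw [dist_eq_norm] at h4 hfu
  have h5 : ‖z‖ * ‖yosida R (m + 1) u - yosida R (n + 1) u‖ ≤ ε / 3 := by
    calc _ ≤ (|r| + 1) * (ε / (3 * (|r| + 1))) := by
          gcongr
          linarith [le_abs_self r]
      _ = ε / 3 := by field_simp
  rw [map_sub] at h1 h2
  calc _ = ‖(NormedSpace.exp (z • yosida R (m + 1)) f - NormedSpace.exp (z • yosida R (m + 1)) u)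
        + (NormedSpace.exp (z • yosida R (m + 1)) u - NormedSpace.exp (z • yosida R (n + 1)) u)
        - (NormedSpace.exp (z • yosida R (n + 1)) f - NormedSpace.exp (z • yosida R (n + 1)) u)‖ := by
        congr 1; abel
    _ ≤ _ := norm_sub_le _ _
    _ ≤ _ := add_le_add_left (norm_add_le _ _) _
    _ < ε := by linarith

theorem exists_tendsto_exp_yosida (h : IsSectorialResolvent M Γ R)
    {z : ℂ} (hz : z ∈ cone M) (f : H) :
    ∃ y, Tendsto (fun n : ℕ => NormedSpace.exp (z • yosida R (n + 1)) f) atTop (𝓝 y) := by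
  refine cauchySeq_tendsto_of_complete (Metric.cauchySeq_iff.2 fun ε hε => ?_)
  obtain ⟨n₀, hn₀⟩ := h.exp_yosida_uniformCauchy f ‖z‖ hε
  exact ⟨n₀, fun m hm n hn => by rw [dist_eq_norm]; exact hn₀ m hm n hn z hz le_rfl⟩

/-- Strong limit of the exponentials of the Yosida approximations. -/
theorem exists_semigroup (h : IsSectorialResolvent M Γ R) : ∃ S : ℂ → H →L[ℂ] H, ∀ z ∈ cone M, ∀ f,
    Tendsto (fun n : ℕ => NormedSpace.exp (z • yosida R (n + 1)) f) atTop (𝓝 (S z f)) := by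
  choose! y hy using fun (z : ℂ) (hz : z ∈ cone M) (f : H) => h.exists_tendsto_exp_yosida hz f
  classical
  refine ⟨fun z => if hz : z ∈ cone M then
    continuousLinearMapOfTendsto (fun n : ℕ => NormedSpace.exp (z • yosida R (n + 1)))
      (tendsto_pi_nhds.2 (hy z hz)) else 0, fun z hz f => ?_⟩
  beta_reduce
  rw [dif_pos hz]
  exact hy z hz f

end IsSectorialResolvent

/-- `S` is the strong limit, on the cone, of the exponentials of the Yosida approximations. -/
def IsYosidaLimit (M : ℝ) (R : ℝ → H →L[ℂ] H) (S : ℂ → H →L[ℂ] H) : Prop :=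
  ∀ z ∈ cone M, ∀ f,
    Tendsto (fun n : ℕ => NormedSpace.exp (z • yosida R (n + 1)) f) atTop (𝓝 (S z f))

/-! ### The semigroup as strong limit of the Yosida exponentials. -/

namespace IsYosidaLimit

variable {M : ℝ} {Γ : Set (H × H)} {R : ℝ → H →L[ℂ] H} {S : ℂ → H →L[ℂ] H}

theorem map_zero (hS : IsYosidaLimit M R S) : S 0 = ContinuousLinearMap.id ℂ H := by
  ext f
  refine tendsto_nhds_unique (hS 0 (by simp [cone]) f) ?_
  simp

variable [CompleteSpace H]

theorem norm_apply_le (hS : IsYosidaLimit M R S) (h : IsSectorialResolvent M Γ R) {z : ℂ}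
    (hz : z ∈ cone M) (f : H) : ‖S z f‖ ≤ ‖f‖ :=
  le_of_tendsto (hS z hz f).norm
    (Eventually.of_forall fun n => h.norm_exp_yosida_apply_le (by positivity) hz f)

theorem norm_le_one (hS : IsYosidaLimit M R S) (h : IsSectorialResolvent M Γ R) {z : ℂ}
    (hz : z ∈ cone M) : ‖S z‖ ≤ 1 :=
  ContinuousLinearMap.opNorm_le_bound _ zero_le_one fun f => by simpa using hS.norm_apply_le h hz f

theorem map_add (hS : IsYosidaLimit M R S) (h : IsSectorialResolvent M Γ R) {z w : ℂ}
    (hz : z ∈ cone M) (hw : w ∈ cone M) : S (z + w) = (S z).comp (S w) := by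
  let +nondep : NormedAlgebra ℚ (H →L[ℂ] H) := .restrictScalars ℚ ℂ _
  ext f
  refine tendsto_nhds_unique (hS _ (cone_add h.pos hz hw) f) ?_
  have e : ∀ n : ℕ, NormedSpace.exp ((z + w) • yosida R (n + 1)) f =
      NormedSpace.exp (z • yosida R (n + 1)) (NormedSpace.exp (w • yosida R (n + 1)) f) := fun n => by
    rw [add_smul, NormedSpace.exp_add_of_commute
      (((Commute.refl (yosida R (n + 1))).smul_left z).smul_right w)]
    rfl
  simp only [e]
  rw [ContinuousLinearMap.comp_apply]
  have h1 := hS z hz (S w f)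
  have h2 := hS w hw f
  rw [tendsto_iff_norm_sub_tendsto_zero] at h2
  refine h1.congr_dist (squeeze_zero (fun _ => dist_nonneg) (fun n => ?_) h2)
  rw [dist_comm, dist_eq_norm, ← map_sub]
  exact h.norm_exp_yosida_apply_le (by positivity) hz _

theorem tendstoUniformlyOn (hS : IsYosidaLimit M R S) (h : IsSectorialResolvent M Γ R) (f : H)
    (r : ℝ) : TendstoUniformlyOn (fun (n : ℕ) z => NormedSpace.exp (z • yosida R (n + 1)) f)
      (fun z => S z f) atTop (cone M ∩ Metric.closedBall 0 r) := by
  rw [Metric.tendstoUniformlyOn_iff]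
  intro ε hε
  obtain ⟨n₀, hn₀⟩ := h.exp_yosida_uniformCauchy f r (half_pos hε)
  filter_upwards [eventually_ge_atTop n₀] with n hn z hz
  have : ‖S z f - NormedSpace.exp (z • yosida R (n + 1)) f‖ ≤ ε / 2 := by
    refine le_of_tendsto ((hS z hz.1 f).sub_const _).norm ?_
    filter_upwards [eventually_ge_atTop n₀] with m hm
    exact (hn₀ m hm n hn z hz.1 (by simpa using hz.2)).le
  rw [dist_eq_norm]
  linarith

theorem differentiable_exp_smul (A : H →L[ℂ] H) (f : H) :
    Differentiable ℂ (fun z : ℂ => NormedSpace.exp (z • A) f) := fun z =>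
  ((ContinuousLinearMap.apply ℂ H f).hasFDerivAt.comp_hasDerivAt z
    (hasDerivAt_exp_smul_const (𝕂 := ℂ) A z)).differentiableAt

/-- Continuity holds on the closed cone including its apex, because convergence is uniform on
bounded parts of it. This gives strong continuity at `0` along the whole sector. -/
theorem continuousOn (hS : IsYosidaLimit M R S) (h : IsSectorialResolvent M Γ R) (f : H) :
    ContinuousOn (fun z => S z f) (cone M) := by
  intro z hz
  have h1 := (hS.tendstoUniformlyOn h f (‖z‖ + 1)).continuousOn
    (Eventually.of_forall fun n => (differentiable_exp_smul _ f).continuous.continuousOn).frequently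
  refine (h1 z ⟨hz, by simp⟩).mono_of_mem_nhdsWithin ?_
  refine inter_mem self_mem_nhdsWithin (mem_nhdsWithin_of_mem_nhds ?_)
  exact Metric.closedBall_mem_nhds_of_mem (by simp)

/-- Orbits are locally uniform limits of entire functions. Testing against the unit ball of `H`
upgrades this to holomorphy in operator norm. -/
theorem differentiableOn (hS : IsYosidaLimit M R S) (h : IsSectorialResolvent M Γ R) {U : Set ℂ}
    (hU : IsOpen U) (hUM : U ⊆ cone M) : DifferentiableOn ℂ S U := by
  refine differentiableOn_of_weak hU (fun z hz => hS.norm_le_one h (hUM hz)) dense_univ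
    ((fun g => innerSL ℂ g) '' Metric.closedBall 0 1) ?_ ?_ ?_
  · rintro _ ⟨g, hg, rfl⟩
    simpa using hg
  · intro y C hC hy
    rcases eq_or_ne y 0 with rfl | hy0
    · simpa using hC
    have := hy _ ⟨((‖y‖⁻¹ : ℝ) : ℂ) • y, by simp [norm_smul, hy0], rfl⟩
    simp only [innerSL_apply_apply, inner_smul_left, inner_self_eq_norm_sq_to_K] at this
    have hn : ‖y‖ ≠ 0 := norm_ne_zero_iff.2 hy0
    have e : (‖(starRingEnd ℂ) ((‖y‖⁻¹ : ℝ) : ℂ) * ((‖y‖ : ℂ)) ^ 2‖) = ‖y‖ := by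
      rw [Complex.conj_ofReal, ← Complex.ofReal_pow, ← Complex.ofReal_mul, Complex.norm_real,
        Real.norm_of_nonneg (by positivity)]
      field_simp
    exact e ▸ this
  · rintro f - _ ⟨g, -, rfl⟩
    have : DifferentiableOn ℂ (fun z => S z f) U := by
      refine TendstoLocallyUniformlyOn.differentiableOn (φ := atTop)
        (F := fun (n : ℕ) z => NormedSpace.exp (z • yosida R (n + 1)) f) ?_
        (Eventually.of_forall fun n => (differentiable_exp_smul _ f).differentiableOn) hU
      rw [tendstoLocallyUniformlyOn_iff_forall_isCompact hU]
      intro K hKU hK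
      obtain ⟨r, hr⟩ := hK.isBounded.subset_closedBall 0
      exact (hS.tendstoUniformlyOn h f r).mono fun z hz => ⟨hUM (hKU hz), hr hz⟩
    exact (innerSL ℂ g).differentiable.comp_differentiableOn this

/-- The fundamental theorem of calculus for each Yosida exponential, followed by dominated
convergence: the images of `u` under the Yosida operators converge to `g`. -/
theorem integral_eq (hS : IsYosidaLimit M R S) (h : IsSectorialResolvent M Γ R) {u g : H}
    (hu : (u, g) ∈ Γ) {t : ℝ} (ht : 0 ≤ t) : ∫ s in (0 : ℝ)..t, S s g = S t u - u := by
  have hder : ∀ (A : H →L[ℂ] H) (s : ℝ), HasDerivAt (fun s : ℝ => NormedSpace.exp ((s : ℂ) • A) u)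
      (NormedSpace.exp ((s : ℂ) • A) (A u)) s := fun A s => by
    simp only [Complex.coe_smul]
    exact (((ContinuousLinearMap.apply ℂ H u).restrictScalars ℝ).hasFDerivAt.comp_hasDerivAt s
      (hasDerivAt_exp_smul_const (𝕂 := ℝ) A s))
  have hcont : ∀ (A : H →L[ℂ] H) (v : H),
      Continuous fun s : ℝ => NormedSpace.exp ((s : ℂ) • A) v := fun A v =>
    (differentiable_exp_smul A v).continuous.comp Complex.continuous_ofReal
  have hint : ∀ n : ℕ, ∫ s in (0 : ℝ)..t, NormedSpace.exp ((s : ℂ) • yosida R (n + 1))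
      (yosida R (n + 1) u) = NormedSpace.exp ((t : ℂ) • yosida R (n + 1)) u - u := fun n => by
    rw [intervalIntegral.integral_eq_sub_of_hasDerivAt (fun s _ => hder _ s)
      ((hcont _ _).intervalIntegrable _ _)]
    simp
  obtain ⟨C, hC⟩ := (h.tendsto_yosida hu).norm.bddAbove_range
  have hlim := intervalIntegral.tendsto_integral_filter_of_dominated_convergence
    (μ := volume) (a := 0) (b := t) (l := atTop) (f := fun s : ℝ => S s g) (F := fun (n : ℕ) (s : ℝ) =>
      NormedSpace.exp ((s : ℂ) • yosida R (n + 1)) (yosida R (n + 1) u)) (fun _ => C)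
    (Eventually.of_forall fun n => (hcont _ _).aestronglyMeasurable)
    (Eventually.of_forall fun n => Eventually.of_forall fun s hs => ?_) (by simp)
    (Eventually.of_forall fun s hs => ?_)
  · refine tendsto_nhds_unique hlim ?_
    simp only [hint]
    exact (hS t (ofReal_mem_cone ht) u).sub_const u
  · rw [Set.uIoc_of_le ht] at hs
    exact (h.norm_exp_yosida_apply_le (by positivity) (ofReal_mem_cone hs.1.le) _).trans
      (hC ⟨n, rfl⟩)
  · rw [Set.uIoc_of_le ht] at hs
    have hsc : (s : ℂ) ∈ cone M := ofReal_mem_cone hs.1.le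
    have h2 := h.tendsto_yosida hu
    rw [tendsto_iff_norm_sub_tendsto_zero] at h2
    refine (hS s hsc g).congr_dist (squeeze_zero (fun _ => dist_nonneg) (fun n => ?_) h2)
    rw [dist_comm, dist_eq_norm, ← _root_.map_sub]
    exact h.norm_exp_yosida_apply_le (by positivity) hsc _

end IsYosidaLimit

end Generation

/-! ### Sectors -/

theorem mem_sector_iff {θ : ℝ} (h0 : 0 < θ) (h2 : θ < Real.pi / 2) {z : ℂ} :
    z ∈ sector θ ↔ |z.im| < Real.tan θ * z.re := by
  have ht : 0 < Real.tan θ := Real.tan_pos_of_pos_of_lt_pi_div_two h0 h2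
  have key : 0 < z.re → (|z.arg| < θ ↔ |z.im| < Real.tan θ * z.re) := by
    intro hre
    have harg : |z.arg| < Real.pi / 2 := Complex.abs_arg_lt_pi_div_two_iff.2 (Or.inl hre)
    have h3 : |z.im| = Real.tan |z.arg| * z.re := by
      have : |Real.tan z.arg| = Real.tan |z.arg| := by
        rcases le_total 0 z.arg with h | h
        · rw [abs_of_nonneg h, abs_of_nonneg]
          exact Real.tan_nonneg_of_nonneg_of_le_pi_div_two h (by linarith [le_abs_self z.arg])
        · rw [abs_of_nonpos h, Real.tan_neg, abs_of_nonpos]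
          exact Real.tan_nonpos_of_nonpos_of_neg_pi_div_two_le h (by linarith [neg_abs_le z.arg])
      rw [← this, Complex.tan_arg, abs_div, abs_of_pos hre]
      field_simp
    rw [h3, mul_lt_mul_iff_of_pos_right hre]
    exact (Real.strictMonoOn_tan.lt_iff_lt ⟨by linarith [abs_nonneg z.arg, Real.pi_pos], harg⟩
      ⟨by linarith [Real.pi_pos], h2⟩).symm
  constructor
  · rintro ⟨hz, ha⟩
    have hre : 0 < z.re := by
      rcases Complex.abs_arg_lt_pi_div_two_iff.1 (ha.trans h2) with h | h
      · exact h
      · exact absurd h hz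
    exact (key hre).1 ha
  · intro h
    have hre : 0 < z.re := by
      by_contra hn
      nlinarith [abs_nonneg z.im]
    exact ⟨fun h0 => by simp [h0] at hre, (key hre).2 h⟩

theorem isOpen_sector {θ : ℝ} (h0 : 0 < θ) (h2 : θ < Real.pi / 2) : IsOpen (sector θ) := by
  have : sector θ = {z : ℂ | |z.im| < Real.tan θ * z.re} := by
    ext z
    exact mem_sector_iff h0 h2
  rw [this]
  exact isOpen_lt (by fun_prop) (by fun_prop)

theorem ofReal_mem_sector {θ : ℝ} (h0 : 0 < θ) {t : ℝ} (ht : 0 < t) : (t : ℂ) ∈ sector θ :=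
  ⟨by exact_mod_cast ht.ne', by simpa [Complex.arg_ofReal_of_nonneg ht.le] using h0⟩

/-- The angle `arctan (1/M)` is the complement to `π/2` of the half-angle `arctan M` of the
numerical range. -/
theorem sector_subset_cone {M : ℝ} (hM : 0 < M) : sector (Real.arctan (1 / M)) ⊆ cone M := by
  intro z hz
  rw [mem_sector_iff (Real.arctan_pos.2 (by positivity)) (Real.arctan_lt_pi_div_two _),
    Real.tan_arctan] at hz
  have : M * |z.im| ≤ M * (1 / M * z.re) := by gcongr
  rwa [← mul_assoc, mul_one_div_cancel hM.ne', one_mul] at this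

/-! ### The generator -/

section Generator

variable {H : Type*} [NormedAddCommGroup H] [InnerProductSpace ℂ H] [CompleteSpace H]
  {M : ℝ} {Γ : Set (H × H)} {R : ℝ → H →L[ℂ] H} {S : ℂ → H →L[ℂ] H}

/-- The difference quotient of the orbit of `u` is the mean of `S(s) g` over `[0, t]`, and `S(s) g →
g`. -/
theorem IsYosidaLimit.subset_generatorGraph (hS : IsYosidaLimit M R S)
    (h : IsSectorialResolvent M Γ R) : Γ ⊆ generatorGraph (fun t : ℝ≥0 => S (t : ℝ)) := by
  rintro ⟨u, g⟩ hu
  have hc : Tendsto (fun s : ℝ => S s g) (𝓝[≥] 0) (𝓝 g) := by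
    have h1 := (hS.continuousOn h g 0 (by simp [cone])).tendsto
    rw [hS.map_zero] at h1
    refine h1.comp (tendsto_nhdsWithin_iff.2 ⟨?_, ?_⟩)
    · exact (Complex.continuous_ofReal.tendsto' 0 0 (by simp)).mono_left nhdsWithin_le_nhds
    · filter_upwards [self_mem_nhdsWithin] with s hs using ofReal_mem_cone hs
  have hint : ∀ t : ℝ, 0 ≤ t → IntervalIntegrable (fun s : ℝ => S s g) volume 0 t := fun t ht =>
    ContinuousOn.intervalIntegrable_of_Icc ht ((hS.continuousOn h g).comp
      Complex.continuous_ofReal.continuousOn fun s hs => ofReal_mem_cone hs.1)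
  simp only [generatorGraph, Set.mem_ofPred_eq]
  rw [Metric.tendsto_nhds]
  intro ε hε
  obtain ⟨δ, hδ, hδs⟩ := Metric.mem_nhdsWithin_iff.1
    ((Metric.tendsto_nhds.1 hc) (ε / 2) (half_pos hε))
  have hmem : ∀ᶠ t : ℝ≥0 in 𝓝[>] 0, (t : ℝ) < δ :=
    ((NNReal.continuous_coe.tendsto' 0 0 (by simp)).mono_left nhdsWithin_le_nhds).eventually_lt_const
      hδ
  filter_upwards [hmem, self_mem_nhdsWithin] with t ht ht0
  have ht0' : (0 : ℝ) < t := ht0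
  have e1 : S (t : ℝ) u - u - ((t : ℝ) : ℂ) • g = ∫ s in (0 : ℝ)..t, (S s g - g) := by
    rw [intervalIntegral.integral_sub (hint _ ht0'.le) (by simp), hS.integral_eq h hu ht0'.le]
    simp
  have e2 : ‖S (t : ℝ) u - u - ((t : ℝ) : ℂ) • g‖ ≤ ε / 2 * |(t : ℝ) - 0| := by
    rw [e1]
    refine intervalIntegral.norm_integral_le_of_norm_le_const fun s hs => ?_
    rw [Set.uIoc_of_le ht0'.le] at hs
    have := hδs ⟨by simpa [abs_of_pos hs.1] using hs.2.trans_lt ht, hs.1.le⟩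
    rw [← dist_eq_norm]
    exact le_of_lt this
  rw [sub_zero, abs_of_pos ht0'] at e2
  have hne : ((t : ℝ) : ℂ) ≠ 0 := by exact_mod_cast ht0'.ne'
  have e3 : ((t : ℝ) : ℂ)⁻¹ • (S (t : ℝ) u - u) - g =
      ((t : ℝ) : ℂ)⁻¹ • (S (t : ℝ) u - u - ((t : ℝ) : ℂ) • g) := by
    rw [smul_sub _ _ (((t : ℝ) : ℂ) • g), smul_smul, inv_mul_cancel₀ hne, one_smul]
  rw [dist_eq_norm, e3, norm_smul, norm_inv, Complex.norm_real, Real.norm_of_nonneg ht0'.le,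
    inv_mul_lt_iff₀ ht0']
  nlinarith

/-- The semigroup of a sectorial resolvent is generated by its graph. -/
theorem IsYosidaLimit.generatorGraph_eq (hS : IsYosidaLimit M R S)
    (h : IsSectorialResolvent M Γ R) : generatorGraph (fun t : ℝ≥0 => S (t : ℝ)) = Γ := by
  refine Set.Subset.antisymm ?_ (hS.subset_generatorGraph h)
  rintro ⟨f, g⟩ hfg
  -- Maximality: solve `u - Au = f - g` inside `Γ`. Then `w = f - u` is mapped to itself by the
  -- generator, while contractivity forces the generator to be dissipative, so `w = 0`.
  have hΓ := h.resolvent_mem one_pos (f - g)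
  set u := R 1 (f - g) with hu
  have hk := hS.subset_generatorGraph h hΓ
  simp only [generatorGraph, Set.mem_ofPred_eq] at hfg hk
  have hw := hfg.sub hk
  have e : g - (((1 : ℝ) : ℂ) • u - (f - g)) = f - u := by
    simp only [Complex.ofReal_one, one_smul]
    abel
  rw [e] at hw
  have h1 := ((innerSL ℂ (f - u)).continuous.tendsto _).comp hw
  have h2 : (inner ℂ (f - u) (f - u)).re ≤ 0 := by
    refine le_of_tendsto ((Complex.continuous_re.tendsto _).comp h1) ?_
    filter_upwards [self_mem_nhdsWithin] with t ht
    have ht0 : (0 : ℝ) < t := ht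
    simp only [Function.comp_apply, innerSL_apply_apply]
    have e2 : ((t : ℝ) : ℂ)⁻¹ • (S (t : ℝ) f - f) - ((t : ℝ) : ℂ)⁻¹ • (S (t : ℝ) u - u) =
        (((t : ℝ)⁻¹ : ℝ) : ℂ) • (S (t : ℝ) (f - u) - (f - u)) := by
      rw [map_sub, ← smul_sub, Complex.ofReal_inv]
      congr 1
      abel
    rw [e2, inner_smul_right, Complex.re_ofReal_mul, inner_sub_right, Complex.sub_re]
    refine mul_nonpos_of_nonneg_of_nonpos (by positivity) (sub_nonpos.2 ?_)
    refine ((Complex.re_le_norm _).trans (norm_inner_le_norm _ _)).trans ?_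
    have h3 := hS.norm_apply_le h (ofReal_mem_cone ht0.le) (f - u)
    have h4 : (inner ℂ (f - u) (f - u)).re = ‖f - u‖ * ‖f - u‖ := by
      rw [← sq]
      exact inner_self_eq_norm_sq (𝕜 := ℂ) _
    rw [h4]
    gcongr
  have h5 : f - u = 0 := by
    have h4 : (inner ℂ (f - u) (f - u)).re = ‖f - u‖ ^ 2 := inner_self_eq_norm_sq (𝕜 := ℂ) _
    rw [h4] at h2
    exact norm_eq_zero.1 (pow_eq_zero_iff two_ne_zero |>.1 (le_antisymm h2 (by positivity)))
  rw [sub_eq_zero] at h5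
  have : (((1 : ℝ) : ℂ) • u - (f - g)) = g := by rw [← h5]; simp
  rw [this, ← h5] at hΓ
  exact hΓ

end Generator

/-! ### The resolvent of a sectorial form -/

section FormResolvent

variable {V H : Type*} [NormedAddCommGroup V] [InnerProductSpace ℂ V] [CompleteSpace V]
  [NormedAddCommGroup H] [InnerProductSpace ℂ H] [CompleteSpace H]

/-- The graph of the operator associated with the form `(v, w) ↦ ⟪w, A v⟫` along `j`. -/
def abstractGraph (j : V →L[ℂ] H) (A : V →L[ℂ] V) : Set (H × H) :=
  {w | ∃ v, j v = w.1 ∧ ∀ h, inner ℂ h (A v) = inner ℂ (j h) (-w.2)}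

/-- The resolvent `j (A + μ j* j)⁻¹ j*` of the operator associated with a form. -/
def formResolvent (j : V →L[ℂ] H) (A : V →L[ℂ] V) (μ : ℝ) : H →L[ℂ] H :=
  j ∘L Ring.inverse (A + (μ : ℂ) • (j.adjoint ∘L j)) ∘L j.adjoint

/-- Lax–Milgram: adding `μ j*j` makes the form coercive on `V`. -/
theorem isUnit_form_add {j : V →L[ℂ] H} {A : V →L[ℂ] V} {μ δ : ℝ} (hδ : 0 < δ)
    (hco : ∀ v, δ * ‖v‖ ^ 2 ≤ (inner ℂ v (A v)).re + μ * ‖j v‖ ^ 2) :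
    IsUnit (A + (μ : ℂ) • (j.adjoint ∘L j)) := by
  refine ContinuousLinearMap.isUnit_of_forall_le_norm_inner_map _ (c := ⟨δ, hδ.le⟩) hδ fun v => ?_
  have e : (inner ℂ v ((A + (μ : ℂ) • (j.adjoint ∘L j)) v)).re =
      (inner ℂ v (A v)).re + μ * ‖j v‖ ^ 2 := by
    rw [add_apply, smul_apply, ContinuousLinearMap.comp_apply, inner_add_right, inner_smul_right,
      ContinuousLinearMap.adjoint_inner_right, Complex.add_re, Complex.re_ofReal_mul]
    congr 2
    exact inner_self_eq_norm_sq (𝕜 := ℂ) _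
  rw [norm_inner_symm]
  refine le_trans ?_ (Complex.re_le_norm _)
  rw [e, mul_comm]
  exact hco v

/-- A closed sectorial form with dense domain defines a sectorial resolvent. -/
theorem isSectorialResolvent_of_form {j : V →L[ℂ] H} {A : V →L[ℂ] V} {M : ℝ} (hM : 0 < M)
    (hco : ∀ μ : ℝ, 0 < μ → ∃ δ > 0, ∀ v, δ * ‖v‖ ^ 2 ≤ (inner ℂ v (A v)).re + μ * ‖j v‖ ^ 2)
    (hsec : ∀ v, |(inner ℂ v (A v)).im| ≤ M * (inner ℂ v (A v)).re)
    (hj : DenseRange j) :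
    IsSectorialResolvent M (abstractGraph j A) (formResolvent j A) := by
  have hunit : ∀ μ : ℝ, 0 < μ → IsUnit (A + (μ : ℂ) • (j.adjoint ∘L j)) := fun μ hμ => by
    obtain ⟨δ, hδ, h⟩ := hco μ hμ
    exact isUnit_form_add hδ h
  -- Testing against all `h` turns membership in the graph into the operator equation `A v = -j* g`.
  have hadj : ∀ (v : V) (g : H), (∀ h, inner ℂ h (A v) = inner ℂ (j h) (-g)) ↔
      A v = -(j.adjoint g) := by
    intro v g
    constructor
    · intro h
      refine ext_inner_left ℂ fun w => ?_
      rw [h w, ← map_neg, ContinuousLinearMap.adjoint_inner_right]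
    · intro h w
      rw [h, ← map_neg, ContinuousLinearMap.adjoint_inner_right]
  have hmem : ∀ μ : ℝ, 0 < μ → ∀ u g, (u, g) ∈ abstractGraph j A ↔
      formResolvent j A μ ((μ : ℂ) • u - g) = u := by
    intro μ hμ u g
    set B := A + (μ : ℂ) • (j.adjoint ∘L j) with hB
    have hBB : ∀ v, Ring.inverse B (B v) = v := fun v =>
      DFunLike.congr_fun (Ring.inverse_mul_cancel B (hunit μ hμ)) v
    have hBB' : ∀ v, B (Ring.inverse B v) = v := fun v =>
      DFunLike.congr_fun (Ring.mul_inverse_cancel B (hunit μ hμ)) v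
    have hBv : ∀ v, B v = A v + (μ : ℂ) • j.adjoint (j v) := fun v => rfl
    constructor
    · rintro ⟨v, rfl, hv⟩
      rw [hadj] at hv
      have : j.adjoint ((μ : ℂ) • j v - g) = B v := by
        rw [hBv, hv, map_sub, map_smul]
        abel
      change j (Ring.inverse B (j.adjoint ((μ : ℂ) • j v - g))) = j v
      rw [this, hBB]
    · intro h
      change j (Ring.inverse B (j.adjoint ((μ : ℂ) • u - g))) = u at h
      refine ⟨Ring.inverse B (j.adjoint ((μ : ℂ) • u - g)), h, ?_⟩
      rw [hadj]
      have h2 := hBB' (j.adjoint ((μ : ℂ) • u - g))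
      rw [hBv, h, map_sub, map_smul] at h2
      rw [map_sub, map_smul]
      have := eq_sub_of_add_eq h2
      rw [this]
      abel
  refine ⟨hM, hmem, ?_, ?_⟩
  · rintro _ g ⟨v, rfl, hv⟩
    have := hsec v
    have e : inner ℂ (j v) g = -inner ℂ v (A v) := by
      rw [hv v, inner_neg_right, neg_neg]
    rw [e, Complex.neg_im, Complex.neg_re, abs_neg]
    linarith
  · let K : Submodule ℂ H := LinearMap.range (formResolvent j A 1).toLinearMap
    have hK : (K : Set H) ⊆ {u | ∃ g, (u, g) ∈ abstractGraph j A} := by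
      rintro _ ⟨f, rfl⟩
      exact ⟨((1 : ℝ) : ℂ) • formResolvent j A 1 f - f, (hmem 1 one_pos _ _).2 (by
        exact congrArg (fun v => formResolvent j A 1 v) (sub_sub_cancel _ f))⟩
    -- The range of `R 1` lies in the domain, so it suffices that it has trivial orthogonal
    -- complement. If `f` is orthogonal to `j v` for `v = B⁻¹ j* f`, coercivity gives `v = 0`, hence
    -- `j* f = 0`, and `f` is orthogonal to the dense range of `j`.
    refine Dense.mono hK ?_
    rw [Submodule.dense_iff_topologicalClosure_eq_top,
      Submodule.topologicalClosure_eq_top_iff, Submodule.eq_bot_iff]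
    intro f hf
    set B := A + ((1 : ℝ) : ℂ) • (j.adjoint ∘L j) with hB
    have hBB' : ∀ v, B (Ring.inverse B v) = v := fun v =>
      DFunLike.congr_fun (Ring.mul_inverse_cancel B (hunit 1 one_pos)) v
    set v := Ring.inverse B (j.adjoint f) with hv
    have h0 : inner ℂ (j v) f = 0 := (Submodule.mem_orthogonal _ _).1 hf _ ⟨f, rfl⟩
    obtain ⟨δ, hδ, hco1⟩ := hco 1 one_pos
    have hv0 : v = 0 := by
      have h1 : inner ℂ v (B v) = 0 := by
        rw [hv, hBB', ContinuousLinearMap.adjoint_inner_right]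
        exact h0
      have h2 : inner ℂ v (B v) = inner ℂ v (A v) + inner ℂ (j v) (j v) := by
        change inner ℂ v (A v + ((1 : ℝ) : ℂ) • j.adjoint (j v)) = _
        rw [inner_add_right, Complex.ofReal_one, one_smul, ContinuousLinearMap.adjoint_inner_right]
      have h3 : (inner ℂ v (A v)).re + 1 * ‖j v‖ ^ 2 = 0 := by
        have h4 : (inner ℂ (j v) (j v)).re = ‖j v‖ ^ 2 := inner_self_eq_norm_sq (𝕜 := ℂ) _
        rw [one_mul, ← h4, ← Complex.add_re, ← h2, h1, Complex.zero_re]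
      have h5 := hco1 v
      rw [h3] at h5
      have h6 : ‖v‖ ^ 2 ≤ 0 := by nlinarith
      exact norm_eq_zero.1 (pow_eq_zero_iff two_ne_zero |>.1 (le_antisymm h6 (by positivity)))
    have h7 : j.adjoint f = 0 := by
      rw [← hBB' (j.adjoint f), ← hv, hv0, map_zero]
    refine hj.eq_zero_of_inner_left ℂ ?_
    intro w
    rw [← ContinuousLinearMap.adjoint_inner_left, h7, inner_zero_left]

end FormResolvent

/-! ### Mollification in `L²` -/

theorem eLpNorm_two_sq {X F : Type*} [MeasurableSpace X] [NormedAddCommGroup F] (f : X → F)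
    (ν : Measure X) : eLpNorm f 2 ν ^ (2 : ℝ) = ∫⁻ x, ‖f x‖ₑ ^ (2 : ℝ) ∂ν := by
  have := eLpNorm_nnreal_pow_eq_lintegral (f := f) (μ := ν) (p := 2) two_ne_zero
  simpa only [NNReal.coe_ofNat, ENNReal.coe_ofNat] using this

section Mollify

variable {E : Type*} [NormedAddCommGroup E] [NormedSpace ℝ E] [FiniteDimensional ℝ E]
  [MeasurableSpace E] [BorelSpace E] {μ : Measure E} [μ.IsAddHaarMeasure]
  {F : Type*} [NormedAddCommGroup F]

/-- Translations are continuous in `L²`. -/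
theorem tendsto_eLpNorm_translate {f : E → F} (hf : MemLp f 2 μ) :
    Tendsto (fun t => eLpNorm (fun x => f (x - t) - f x) 2 μ) (𝓝 0) (𝓝 0) := by
  let g : E → C(E, E) := fun t => ⟨fun x => x - t, by fun_prop⟩
  have hg : Continuous g := ContinuousMap.continuous_of_continuous_uncurry _ (by
    simp only [g]
    exact continuous_snd.sub continuous_fst)
  have hgm : ∀ t, MeasurePreserving (g t) μ μ := fun t => measurePreserving_sub_right μ t
  have hc := Continuous.compMeasurePreservingLp (p := 2)
    (continuous_const (y := hf.toLp f)) hg hgm (by simp)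
  have h0 := hc.tendsto 0
  have e0 : Lp.compMeasurePreserving (g 0) (hgm 0) (hf.toLp f) = hf.toLp f := by
    have : (g 0 : E → E) = id := by ext x; simp [g]
    simp only [this]
    exact Lp.compMeasurePreserving_id_apply _
  rw [e0, Lp.tendsto_Lp_iff_tendsto_eLpNorm'] at h0
  refine h0.congr fun t => eLpNorm_congr_ae ?_
  rw [Lp.toLp_compMeasurePreserving]
  filter_upwards [((hf.comp_measurePreserving (hgm t))).coeFn_toLp, hf.coeFn_toLp] with x h1 h2
  rw [Pi.sub_apply, h1, h2]
  rfl

variable [NormedSpace ℝ F] [CompleteSpace F]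

/-- The bump is a probability density supported where `‖t‖ < rOut`. The mollification error at `x`
is the mean of `f(x-t) - f(x)`, so Jensen and Tonelli bound its `L²` norm by the worst translation
error. -/
theorem eLpNorm_mollify_sub_le {f : E → F} (hf : MemLp f 2 μ) (φ : ContDiffBump (0 : E))
    {C : ℝ≥0∞} (hC : ∀ t : E, ‖t‖ < φ.rOut → eLpNorm (fun x => f (x - t) - f x) 2 μ ≤ C) :
    eLpNorm (fun x => convolution (φ.normed μ) f (ContinuousLinearMap.lsmul ℝ ℝ) μ x - f x) 2 μ
      ≤ C := by
  set ρ : E → ℝ := φ.normed μ with hρ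
  have hρc : Continuous ρ := φ.continuous_normed
  have hρi : Integrable ρ μ := hρc.integrable_of_hasCompactSupport φ.hasCompactSupport_normed
  set ν := μ.withDensity (fun t => ENNReal.ofReal (ρ t)) with hν
  have hmeas : Measurable (fun t => ENNReal.ofReal (ρ t)) := hρc.measurable.ennreal_ofReal
  have hprob : IsProbabilityMeasure ν := ⟨by
    rw [hν, withDensity_apply _ MeasurableSet.univ, Measure.restrict_univ,
      ← ofReal_integral_eq_lintegral_ofReal hρi (Eventually.of_forall φ.nonneg_normed),
      φ.integral_normed, ENNReal.ofReal_one]⟩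
  have hsub : AEStronglyMeasurable (fun p : E × E => f (p.1 - p.2) - f p.1) (μ.prod μ) :=
    (hf.1.comp_quasiMeasurePreserving (quasiMeasurePreserving_sub μ μ)).sub hf.1.comp_fst
  have hν_ac : ν ≪ μ := withDensity_absolutelyContinuous _ _
  have hsubx : ∀ x, AEStronglyMeasurable (fun t => f (x - t) - f x) μ := fun x =>
    (hf.1.comp_quasiMeasurePreserving
      (Measure.measurePreserving_sub_left μ x).quasiMeasurePreserving).sub aestronglyMeasurable_const
  have hlint : ∀ g : E → ℝ≥0∞, AEMeasurable g μ →
      ∫⁻ t, g t ∂ν = ∫⁻ t, ENNReal.ofReal (ρ t) * g t ∂μ := fun g hg =>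
    lintegral_withDensity_eq_lintegral_mul₀ hmeas.aemeasurable hg
  have hpt : ∀ x, ‖convolution ρ f (ContinuousLinearMap.lsmul ℝ ℝ) μ x - f x‖ₑ ^ (2 : ℝ) ≤
      ∫⁻ t, ENNReal.ofReal (ρ t) * ‖f (x - t) - f x‖ₑ ^ (2 : ℝ) ∂μ := by
    intro x
    have hex : Integrable (fun t => ρ t • f (x - t)) μ :=
      (φ.hasCompactSupport_normed.convolutionExists_left (ContinuousLinearMap.lsmul ℝ ℝ)
        hρc (hf.locallyIntegrable (by norm_num)) x)
    have e1 : convolution ρ f (ContinuousLinearMap.lsmul ℝ ℝ) μ x - f x =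
        ∫ t, ρ t • (f (x - t) - f x) ∂μ := by
      simp only [smul_sub]
      rw [integral_sub hex (hρi.smul_const _), integral_smul_const, φ.integral_normed, one_smul]
      rfl
    have e2 : ‖convolution ρ f (ContinuousLinearMap.lsmul ℝ ℝ) μ x - f x‖ₑ ≤
        eLpNorm (fun t => f (x - t) - f x) 1 ν := by
      rw [e1, eLpNorm_one_eq_lintegral_enorm, hlint _ (hsubx x).enorm]
      refine (enorm_integral_le_lintegral_enorm _).trans (le_of_eq ?_)
      refine lintegral_congr fun t => ?_
      rw [enorm_smul, Real.enorm_of_nonneg (φ.nonneg_normed t)]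
    have e3 := e2.trans (eLpNorm_le_eLpNorm_of_exponent_le (p := 1) (q := 2) (by norm_num)
      ((hsubx x).mono_ac hν_ac))
    refine (ENNReal.rpow_le_rpow e3 (by norm_num)).trans (le_of_eq ?_)
    rw [eLpNorm_two_sq, hlint _ ((hsubx x).enorm.pow_const _)]
  have key : eLpNorm (fun x => convolution ρ f (ContinuousLinearMap.lsmul ℝ ℝ) μ x - f x) 2 μ
      ^ (2 : ℝ) ≤ C ^ (2 : ℝ) := by
    rw [eLpNorm_two_sq]
    refine (lintegral_mono hpt).trans ?_
    rw [lintegral_lintegral_swap]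
    · have : ∀ t, ∫⁻ x, ENNReal.ofReal (ρ t) * ‖f (x - t) - f x‖ₑ ^ (2 : ℝ) ∂μ ≤
          ENNReal.ofReal (ρ t) * C ^ (2 : ℝ) := by
        intro t
        rw [lintegral_const_mul' _ _ ENNReal.ofReal_ne_top]
        by_cases ht : ‖t‖ < φ.rOut
        · gcongr
          rw [← eLpNorm_two_sq (fun x => f (x - t) - f x)]
          exact ENNReal.rpow_le_rpow (hC t ht) (by norm_num)
        · have : ρ t = 0 := by
            by_contra hne
            have : t ∈ Function.support (φ.normed μ) := hne
            rw [φ.support_normed_eq] at this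
            exact ht (by simpa using this)
          simp [this]
      refine (lintegral_mono this).trans ?_
      rw [lintegral_mul_const _ hmeas]
      have h1 : ∫⁻ t, ENNReal.ofReal (ρ t) ∂μ = 1 := by
        rw [← ofReal_integral_eq_lintegral_ofReal hρi (Eventually.of_forall φ.nonneg_normed),
          φ.integral_normed, ENNReal.ofReal_one]
      rw [h1, one_mul]
    · exact (hmeas.comp measurable_snd).aemeasurable.mul (hsub.enorm.pow_const _)
  exact (ENNReal.rpow_le_rpow_iff (by norm_num)).1 key

variable (E) in
/-- A standard sequence of shrinking bumps. -/
def stdBump (n : ℕ) : ContDiffBump (0 : E) where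
  rIn := 1 / (2 * ((n : ℝ) + 1))
  rOut := 1 / ((n : ℝ) + 1)
  rIn_pos := by positivity
  rIn_lt_rOut := by
    apply one_div_lt_one_div_of_lt <;> linarith [(Nat.cast_nonneg n : (0 : ℝ) ≤ n)]

theorem tendsto_mollify {f : E → F} (hf : MemLp f 2 μ) :
    Tendsto (fun n => eLpNorm (fun x => convolution ((stdBump E n).normed μ) f
      (ContinuousLinearMap.lsmul ℝ ℝ) μ x - f x) 2 μ) atTop (𝓝 0) := by
  rw [ENNReal.tendsto_nhds_zero]
  intro ε hε
  obtain ⟨δ, hδ, hδs⟩ := Metric.eventually_nhds_iff.1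
    (ENNReal.tendsto_nhds_zero.1 (tendsto_eLpNorm_translate hf) ε hε)
  have h1 : ∀ᶠ n : ℕ in atTop, 1 / ((n : ℝ) + 1) < δ :=
    tendsto_one_div_add_atTop_nhds_zero_nat.eventually_lt_const hδ
  filter_upwards [h1] with n hn
  exact eLpNorm_mollify_sub_le hf _ fun t ht => hδs (by simpa using ht.trans hn)

end Mollify

/-! ### Smooth approximation in `H¹` -/

section Approx

variable {N : ℕ}

/-- The classical gradient. -/
def classGrad (u : RN N → ℂ) (x : RN N) : EuclideanSpace ℂ (Fin N) :=
  WithLp.toLp 2 fun i => fderiv ℝ u x (EuclideanSpace.single i 1)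

/-- The function `ρ(x - ·)` is itself a test function. Inserting it into the definition of the weak
gradient moves the derivative from the kernel onto `u`. -/
theorem classGrad_mollify {u : RN N → ℂ} {G : RN N → EuclideanSpace ℂ (Fin N)}
    (h : HasWeakGradient u G) (φ : ContDiffBump (0 : RN N)) (x : RN N) :
    classGrad (convolution (φ.normed volume) u (ContinuousLinearMap.lsmul ℝ ℝ) volume) x =
      convolution (φ.normed volume) G (ContinuousLinearMap.lsmul ℝ ℝ) volume x := by
  set ρ : RN N → ℝ := φ.normed volume with hρ
  have hρc : ContDiff ℝ ∞ ρ := φ.contDiff_normed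
  have hρs : HasCompactSupport ρ := φ.hasCompactSupport_normed
  ext i
  have h1 := (hρs.hasFDerivAt_convolution_left (ContinuousLinearMap.lsmul ℝ ℝ)
    (hρc.of_le (by exact_mod_cast le_top)) h.locInt x).fderiv
  have h2 := h.integral_eq (fun t => ρ (x - t)) (hρc.comp (contDiff_const.sub contDiff_id))
    (hρs.comp_homeomorph (Homeomorph.subLeft x)) i
  have hd : ∀ t, fderiv ℝ (fun t => ρ (x - t)) t (EuclideanSpace.single i 1) =
      - fderiv ℝ ρ (x - t) (EuclideanSpace.single i 1) := by
    intro t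
    have h3 : HasFDerivAt ρ (fderiv ℝ ρ (x - t)) (x - t) :=
      (hρc.differentiable (by simp)).differentiableAt.hasFDerivAt
    have h4 : HasFDerivAt (fun t => x - t) (-(ContinuousLinearMap.id ℝ (RN N))) t := by
      simpa using (hasFDerivAt_id t).const_sub x
    have h5 : HasFDerivAt (fun t => ρ (x - t)) _ t := h3.comp t h4
    rw [h5.fderiv]
    simp
  have hexG : Integrable (fun t => ρ t • G (x - t)) volume :=
    (hρs.convolutionExists_left (ContinuousLinearMap.lsmul ℝ ℝ) hρc.continuous h.locInt_grad x)
  have hexu : Integrable (fun t => (fderiv ℝ ρ t).smulRight (u (x - t))) volume := by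
    have := ((hρs.fderiv (𝕜 := ℝ)).convolutionExists_left
      (ContinuousLinearMap.precompL (RN N) (ContinuousLinearMap.lsmul ℝ ℝ (E := ℂ)))
      (hρc.continuous_fderiv (by simp)) h.locInt x)
    refine this.congr (Eventually.of_forall fun t => ?_)
    ext v
    simp [ContinuousLinearMap.precompL_apply]
  simp only [classGrad]
  rw [h1]
  have e1 : (convolution (fderiv ℝ ρ) u (ContinuousLinearMap.precompL (RN N)
      (ContinuousLinearMap.lsmul ℝ ℝ)) volume x) (EuclideanSpace.single i 1) =
      ∫ t, u (x - t) * ((fderiv ℝ ρ t (EuclideanSpace.single i 1) : ℝ) : ℂ) := by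
    have : convolution (fderiv ℝ ρ) u (ContinuousLinearMap.precompL (RN N)
      (ContinuousLinearMap.lsmul ℝ ℝ)) volume x = ∫ t, (fderiv ℝ ρ t).smulRight (u (x - t)) := by
      rw [convolution_def]
      refine integral_congr_ae (Eventually.of_forall fun t => ?_)
      ext v
      simp [ContinuousLinearMap.precompL_apply]
    rw [this, ContinuousLinearMap.integral_apply hexu]
    refine integral_congr_ae (Eventually.of_forall fun t => ?_)
    simp [mul_comm]
  have e2 : (convolution ρ G (ContinuousLinearMap.lsmul ℝ ℝ) volume x) i =
      ∫ t, G (x - t) i * ((ρ t : ℝ) : ℂ) := by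
    rw [convolution_def]
    have := ((EuclideanSpace.proj i : EuclideanSpace ℂ (Fin N) →L[ℂ] ℂ).restrictScalars
      ℝ).integral_comp_comm hexG
    simp only [ContinuousLinearMap.lsmul_apply]
    refine Eq.trans this.symm ?_
    refine integral_congr_ae (Eventually.of_forall fun t => ?_)
    simp [mul_comm]
  rw [e1, e2]
  have e3 := integral_sub_left_eq_self (fun t => u t * ((fderiv ℝ ρ (x - t)
    (EuclideanSpace.single i 1) : ℝ) : ℂ)) volume x
  have e4 := integral_sub_left_eq_self (fun t => G t i * ((ρ (x - t) : ℝ) : ℂ)) volume x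
  simp only [sub_sub_cancel] at e3 e4
  rw [e3, e4]
  simp only [hd, Complex.ofReal_neg, mul_neg, integral_neg, neg_inj] at h2
  exact h2

theorem continuous_classGrad {u : RN N → ℂ} (hu : ContDiff ℝ 1 u) : Continuous (classGrad u) :=
  (PiLp.continuous_toLp 2 _).comp (continuous_pi fun _ =>
    (hu.continuous_fderiv one_ne_zero).clm_apply continuous_const)

/-- Functions in `H¹` are limits of smooth functions. -/
theorem HasWeakGradient.exists_approx {u : RN N → ℂ} {G : RN N → EuclideanSpace ℂ (Fin N)}
    (h : HasWeakGradient u G) (hu : MemLp u 2 volume) (hG : MemLp G 2 volume) :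
    ∃ v : ℕ → RN N → ℂ, (∀ n, ContDiff ℝ 1 (v n)) ∧ (∀ n, MemLp (v n) 2 volume) ∧
      (∀ n, MemLp (classGrad (v n)) 2 volume) ∧
      Tendsto (fun n => eLpNorm (v n - u) 2 volume) atTop (𝓝 0) ∧
      Tendsto (fun n => eLpNorm (classGrad (v n) - G) 2 volume) atTop (𝓝 0) ∧
      ∀ᵐ x, Tendsto (fun n => v n x) atTop (𝓝 (u x)) := by
  set w : ℕ → RN N → ℂ := fun n => convolution ((stdBump (RN N) n).normed volume) u
    (ContinuousLinearMap.lsmul ℝ ℝ) volume with hw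
  have hwc : ∀ n, ContDiff ℝ 1 (w n) := fun n => by
    exact_mod_cast (stdBump (RN N) n).hasCompactSupport_normed.contDiff_convolution_left
      (ContinuousLinearMap.lsmul ℝ ℝ) (n := 1) (stdBump (RN N) n).contDiff_normed h.locInt
  have hwu : Tendsto (fun n => eLpNorm (w n - u) 2 volume) atTop (𝓝 0) := tendsto_mollify hu
  have hwG : Tendsto (fun n => eLpNorm (classGrad (w n) - G) 2 volume) atTop (𝓝 0) := by
    refine (tendsto_mollify hG).congr fun n => ?_
    congr 1
    ext1 x
    rw [Pi.sub_apply, classGrad_mollify h]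
  -- From `n₀` on, the distances to `u` and `G` are finite, so the shifted mollifications lie in
  -- `L²`. A further subsequence converges almost everywhere, as the chain rule requires.
  obtain ⟨n₀, hn₀⟩ := eventually_atTop.1 ((hwu.eventually_lt_const ENNReal.zero_lt_top).and
    (hwG.eventually_lt_const ENNReal.zero_lt_top))
  have hshift := tendsto_add_atTop_nat n₀
  obtain ⟨ns, hns, hae⟩ := (tendstoInMeasure_of_tendsto_eLpNorm two_ne_zero
    (fun n => (hwc (n + n₀)).continuous.aestronglyMeasurable) hu.1
    (hwu.comp hshift)).exists_seq_tendsto_ae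
  refine ⟨fun n => w (ns n + n₀), fun n => hwc _, fun n => ?_, fun n => ?_,
    (hwu.comp hshift).comp hns.tendsto_atTop, (hwG.comp hshift).comp hns.tendsto_atTop, hae⟩
  · have h1 : MemLp (w (ns n + n₀) - u) 2 volume :=
      ⟨(hwc _).continuous.aestronglyMeasurable.sub hu.1, (hn₀ _ (by omega)).1⟩
    simpa using h1.add hu
  · have h1 : MemLp (classGrad (w (ns n + n₀)) - G) 2 volume :=
      ⟨(continuous_classGrad (hwc _)).aestronglyMeasurable.sub hG.1, (hn₀ _ (by omega)).2⟩
    simpa using h1.add hG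

end Approx

/-! ### Calculus of weak gradients -/

section Calculus

theorem tendsto_clm_apply {ι 𝕜 E F : Type*} [NontriviallyNormedField 𝕜] [NormedAddCommGroup E]
    [NormedSpace 𝕜 E] [NormedAddCommGroup F] [NormedSpace 𝕜 F] {l : Filter ι} {A : ι → E →L[𝕜] F}
    {x : ι → E} {B : E →L[𝕜] F} {y : E} (hA : Tendsto A l (𝓝 B)) (hx : Tendsto x l (𝓝 y)) :
    Tendsto (fun i => A i (x i)) l (𝓝 (B y)) :=
  ((continuous_fst.clm_apply continuous_snd).tendsto (B, y)).comp (hA.prodMk_nhds hx)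

/-- The integral of a product is continuous in `L² × L²`. -/
theorem tendsto_integral_mul {X : Type*} [MeasurableSpace X] {μ : Measure X} {f g : X → ℂ}
    {fn gn : ℕ → X → ℂ} (hf : MemLp f 2 μ) (hg : MemLp g 2 μ) (hfn : ∀ n, MemLp (fn n) 2 μ)
    (hgn : ∀ n, MemLp (gn n) 2 μ) (h1 : Tendsto (fun n => eLpNorm (fn n - f) 2 μ) atTop (𝓝 0))
    (h2 : Tendsto (fun n => eLpNorm (gn n - g) 2 μ) atTop (𝓝 0)) :
    Tendsto (fun n => ∫ x, fn n x * gn n x ∂μ) atTop (𝓝 (∫ x, f x * g x ∂μ)) := by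
  have e : ∀ {f g : X → ℂ} (hf : MemLp f 2 μ) (hg : MemLp g 2 μ),
      (ContinuousLinearMap.mul ℂ ℂ).lpPairing μ 2 2 (hf.toLp f) (hg.toLp g)
        = ∫ x, f x * g x ∂μ := by
    intro f g hf hg
    rw [ContinuousLinearMap.lpPairing_eq_integral]
    refine integral_congr_ae ?_
    filter_upwards [hf.coeFn_toLp, hg.coeFn_toLp] with x h1 h2
    rw [h1, h2, ContinuousLinearMap.mul_apply']
  have h1' := (Lp.tendsto_Lp_iff_tendsto_eLpNorm'' fn hfn f hf).2 h1
  have h2' := (Lp.tendsto_Lp_iff_tendsto_eLpNorm'' gn hgn g hg).2 h2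
  have := tendsto_clm_apply
    ((((ContinuousLinearMap.mul ℂ ℂ).lpPairing μ 2 2).continuous.tendsto _).comp h1') h2'
  simpa only [Function.comp_def, e] using this

variable {N : ℕ}

theorem memLp_of_continuous_compact {F : Type*} [NormedAddCommGroup F] {f : RN N → F}
    (hf : Continuous f) (hc : HasCompactSupport f) (p : ℝ≥0∞) : MemLp f p volume :=
  hf.memLp_of_hasCompactSupport hc

theorem continuous_fderiv_ofReal_apply {φ : RN N → ℝ} (hφ : ContDiff ℝ ∞ φ) (v : RN N) :
    Continuous fun x => ((fderiv ℝ φ x v : ℝ) : ℂ) :=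
  Complex.continuous_ofReal.comp ((hφ.continuous_fderiv (by simp)).clm_apply continuous_const)

theorem hasCompactSupport_fderiv_ofReal_apply {φ : RN N → ℝ} (hc : HasCompactSupport φ)
    (v : RN N) : HasCompactSupport fun x => ((fderiv ℝ φ x v : ℝ) : ℂ) :=
  (hc.fderiv_apply (𝕜 := ℝ) v).comp_left (g := ((↑) : ℝ → ℂ)) Complex.ofReal_zero

/-- Integration by parts of a `C¹` function against a test function. -/
theorem integral_mul_fderiv_of_contDiff {v : RN N → ℂ} (hv : ContDiff ℝ 1 v) {φ : RN N → ℝ}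
    (hφ : ContDiff ℝ ∞ φ) (hc : HasCompactSupport φ) (e : RN N) :
    ∫ x, v x * ((fderiv ℝ φ x e : ℝ) : ℂ) = -∫ x, fderiv ℝ v x e * ((φ x : ℝ) : ℂ) := by
  have hd : ∀ x, fderiv ℝ (fun x => ((φ x : ℝ) : ℂ)) x e = ((fderiv ℝ φ x e : ℝ) : ℂ) := fun x => by
    have h1 := Complex.ofRealCLM.hasFDerivAt.comp x
      ((hφ.differentiable (by simp)).differentiableAt (x := x)).hasFDerivAt
    have h2 : HasFDerivAt (fun x => ((φ x : ℝ) : ℂ)) _ x := h1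
    rw [h2.fderiv]
    simp
  have hφC : Continuous fun x => ((φ x : ℝ) : ℂ) := Complex.continuous_ofReal.comp hφ.continuous
  have hφc : HasCompactSupport fun x => ((φ x : ℝ) : ℂ) :=
    hc.comp_left (g := ((↑) : ℝ → ℂ)) Complex.ofReal_zero
  have key := integral_mul_fderiv_eq_neg_fderiv_mul_of_integrable (μ := volume) (f := v)
    (g := fun x => ((φ x : ℝ) : ℂ)) (v := e) ?_ ?_ ?_
    (fun x _ => (hv.differentiable one_ne_zero).differentiableAt) (fun x _ => ?_)
  · simpa only [hd] using key
  · exact (((hv.continuous_fderiv one_ne_zero).clm_apply continuous_const).mul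
      hφC).integrable_of_hasCompactSupport hφc.mul_left
  · simp only [hd]
    exact (hv.continuous.mul (continuous_fderiv_ofReal_apply hφ e)).integrable_of_hasCompactSupport
      (hasCompactSupport_fderiv_ofReal_apply hc e).mul_left
  · exact (hv.continuous.mul hφC).integrable_of_hasCompactSupport hφc.mul_left
  · exact Complex.ofRealCLM.differentiable.differentiableAt.comp x
      (hφ.differentiable (by simp)).differentiableAt

theorem tendsto_eLpNorm_of_le {X F F' : Type*} [MeasurableSpace X] {μ : Measure X}
    [NormedAddCommGroup F] [NormedAddCommGroup F'] {fn : ℕ → X → F} {gn : ℕ → X → F'} {K : ℝ}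
    (h : ∀ n x, ‖fn n x‖ ≤ K * ‖gn n x‖)
    (hg : Tendsto (fun n => eLpNorm (gn n) 2 μ) atTop (𝓝 0)) :
    Tendsto (fun n => eLpNorm (fn n) 2 μ) atTop (𝓝 0) := by
  have h1 : Tendsto (fun n => ENNReal.ofReal K * eLpNorm (gn n) 2 μ) atTop (𝓝 0) := by
    simpa using ENNReal.Tendsto.const_mul hg (Or.inr ENNReal.ofReal_ne_top)
  exact tendsto_of_tendsto_of_tendsto_of_le_of_le tendsto_const_nhds h1 (fun _ => zero_le)
    fun n => eLpNorm_le_mul_eLpNorm_of_ae_le_mul (Eventually.of_forall (h n)) 2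

theorem norm_coord_le (y : EuclideanSpace ℂ (Fin N)) (i : Fin N) : ‖y i‖ ≤ ‖y‖ :=
  PiLp.norm_apply_le y i

theorem MemLp.coord {G : RN N → EuclideanSpace ℂ (Fin N)} {p : ℝ≥0∞} (hG : MemLp G p volume)
    (i : Fin N) : MemLp (fun x => G x i) p volume :=
  hG.of_le ((PiLp.continuous_apply 2 _ i).comp_aestronglyMeasurable hG.1)
    (Eventually.of_forall fun _ => norm_coord_le _ i)

theorem aestronglyMeasurable_euclidean {g : Fin N → RN N → ℂ}
    (hg : ∀ i, AEStronglyMeasurable (g i) volume) :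
    AEStronglyMeasurable (fun x => (WithLp.toLp 2 fun i => g i x : EuclideanSpace ℂ (Fin N)))
      volume :=
  (PiLp.continuous_toLp 2 _).comp_aestronglyMeasurable
    (aemeasurable_pi_lambda _ fun i => (hg i).aemeasurable).aestronglyMeasurable

/-- Chain rule for functions of bounded derivative. -/
theorem HasWeakGradient.comp {u : RN N → ℂ} {G : RN N → EuclideanSpace ℂ (Fin N)}
    (h : HasWeakGradient u G) (hu : MemLp u 2 volume) (hG : MemLp G 2 volume) {F : ℂ → ℂ}
    (hF : ContDiff ℝ 1 F) (hF0 : F 0 = 0) {K : ℝ≥0} (hK : ∀ z, ‖fderiv ℝ F z‖ ≤ K) :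
    MemLp (F ∘ u) 2 volume ∧
    MemLp (fun x => (WithLp.toLp 2 fun i => fderiv ℝ F (u x) (G x i) :
      EuclideanSpace ℂ (Fin N))) 2 volume ∧
    HasWeakGradient (F ∘ u)
      (fun x => WithLp.toLp 2 fun i => fderiv ℝ F (u x) (G x i)) := by
  have hFd : Differentiable ℝ F := hF.differentiable one_ne_zero
  have hF' : Continuous (fderiv ℝ F) := hF.continuous_fderiv one_ne_zero
  have hLip : LipschitzWith K F := lipschitzWith_of_nnnorm_fderiv_le hFd fun z => hK z
  have hLip' : ∀ z w, ‖F z - F w‖ ≤ K * ‖z - w‖ := fun z w => by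
    simpa [dist_eq_norm] using hLip.dist_le_mul z w
  have hap : ∀ z y, ‖fderiv ℝ F z y‖ ≤ K * ‖y‖ := fun z y =>
    ContinuousLinearMap.le_of_opNorm_le _ (hK z) y
  have hFu : MemLp (F ∘ u) 2 volume :=
    hu.of_le_mul (c := K) (hF.continuous.comp_aestronglyMeasurable hu.1)
      (Eventually.of_forall fun x => by simpa [hF0] using hLip' (u x) 0)
  have hWm : ∀ (v : RN N → ℂ) (g : RN N → ℂ), AEStronglyMeasurable v volume →
      AEStronglyMeasurable g volume →
      AEStronglyMeasurable (fun x => fderiv ℝ F (v x) (g x)) volume := fun v g hv hg =>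
    (show Continuous fun p : ℂ × ℂ => fderiv ℝ F p.1 p.2 by
      exact (hF'.comp continuous_fst).clm_apply continuous_snd).comp_aestronglyMeasurable
      (hv.prodMk hg)
  have hWi : ∀ i, MemLp (fun x => fderiv ℝ F (u x) (G x i)) 2 volume := fun i =>
    (MemLp.coord hG i).of_le_mul (c := K) (hWm _ _ hu.1 (MemLp.coord hG i).1)
      (Eventually.of_forall fun x => hap _ _)
  have hW : MemLp (fun x => (WithLp.toLp 2 fun i => fderiv ℝ F (u x) (G x i) :
      EuclideanSpace ℂ (Fin N))) 2 volume := by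
    refine hG.of_le_mul (c := K) (aestronglyMeasurable_euclidean fun i => (hWi i).1)
      (Eventually.of_forall fun x => ?_)
    rw [EuclideanSpace.norm_eq, EuclideanSpace.norm_eq, ← Real.sqrt_sq (NNReal.coe_nonneg K),
      ← Real.sqrt_mul (by positivity), Finset.mul_sum]
    refine Real.sqrt_le_sqrt (Finset.sum_le_sum fun i _ => ?_)
    rw [← mul_pow]
    exact pow_le_pow_left₀ (norm_nonneg _) (hap _ _) 2
  refine ⟨hFu, hW, hFu.locallyIntegrable (by norm_num), hW.locallyIntegrable (by norm_num), ?_⟩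
  intro φ hφ hc i
  obtain ⟨v, hvc, hv, hvg, hvu, hvG, hae⟩ := h.exists_approx hu hG
  have hφL : MemLp (fun x => ((φ x : ℝ) : ℂ)) 2 volume := memLp_of_continuous_compact
    (Complex.continuous_ofReal.comp hφ.continuous)
    (hc.comp_left (g := ((↑) : ℝ → ℂ)) Complex.ofReal_zero) 2
  have hφ'L := memLp_of_continuous_compact (continuous_fderiv_ofReal_apply hφ
    (EuclideanSpace.single i 1)) (hasCompactSupport_fderiv_ofReal_apply hc _) 2
  have hFv : ∀ n, MemLp (F ∘ v n) 2 volume := fun n =>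
    (hv n).of_le_mul (c := K) (hF.continuous.comp_aestronglyMeasurable (hv n).1)
      (Eventually.of_forall fun x => by simpa [hF0] using hLip' (v n x) 0)
  have L1 : Tendsto (fun n => ∫ x, (F ∘ v n) x * ((fderiv ℝ φ x
      (EuclideanSpace.single i 1) : ℝ) : ℂ)) atTop
      (𝓝 (∫ x, (F ∘ u) x * ((fderiv ℝ φ x (EuclideanSpace.single i 1) : ℝ) : ℂ))) :=
    tendsto_integral_mul hFu hφ'L hFv (fun _ => hφ'L)
      (tendsto_eLpNorm_of_le (K := K) (fun n x => by simpa using hLip' (v n x) (u x)) hvu)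
      (by simp)
  have e : ∀ n, ∫ x, (F ∘ v n) x * ((fderiv ℝ φ x (EuclideanSpace.single i 1) : ℝ) : ℂ) =
      -∫ x, fderiv ℝ F (v n x) (classGrad (v n) x i) * ((φ x : ℝ) : ℂ) := fun n => by
    rw [integral_mul_fderiv_of_contDiff (hF.comp (hvc n)) hφ hc]
    congr 1
    refine integral_congr_ae (Eventually.of_forall fun x => ?_)
    beta_reduce
    rw [fderiv_comp x hFd.differentiableAt ((hvc n).differentiable one_ne_zero).differentiableAt]
    rfl
  have hWn : ∀ n, MemLp (fun x => fderiv ℝ F (v n x) (G x i)) 2 volume := fun n =>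
    (MemLp.coord hG i).of_le_mul (c := K) (hWm _ _ (hv n).1 (MemLp.coord hG i).1)
      (Eventually.of_forall fun x => hap _ _)
  have hDn : ∀ n, MemLp (fun x => fderiv ℝ F (v n x) (classGrad (v n) x i)) 2 volume := fun n =>
    (MemLp.coord (hvg n) i).of_le_mul (c := K) (hWm _ _ (hv n).1 (MemLp.coord (hvg n) i).1)
      (Eventually.of_forall fun x => hap _ _)
  -- Split `F'(v_n)∇v_n = F'(v_n)(∇v_n - G) + F'(v_n) G`. The first part vanishes in `L²` because
  -- `F'` is bounded. The second converges by dominated convergence, using only continuity of `F'`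
  -- and `v_n → u` almost everywhere.
  have L2 : Tendsto (fun n => ∫ x, (fderiv ℝ F (v n x) (classGrad (v n) x i)
      - fderiv ℝ F (v n x) (G x i)) * ((φ x : ℝ) : ℂ)) atTop (𝓝 0) := by
    have := tendsto_integral_mul (f := fun _ => 0) (MemLp.zero' (p := 2) (μ := volume)) hφL
      (fun n => (hDn n).sub (hWn n)) (fun _ => hφL)
      (tendsto_eLpNorm_of_le (K := K) (fun n x => by
        have h1 := hap (v n x) (classGrad (v n) x i - G x i)
        rw [map_sub] at h1
        have h2 := norm_coord_le (classGrad (v n) x - G x) i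
        have h3 : K * ‖classGrad (v n) x i - G x i‖ ≤ K * ‖(classGrad (v n) - G) x‖ := by
          gcongr
          exact h2
        simpa using h1.trans h3) hvG) (by simp)
    simpa using this
  have L3 : Tendsto (fun n => ∫ x, fderiv ℝ F (v n x) (G x i) * ((φ x : ℝ) : ℂ)) atTop
      (𝓝 (∫ x, fderiv ℝ F (u x) (G x i) * ((φ x : ℝ) : ℂ))) := by
    refine tendsto_integral_of_dominated_convergence (fun x => K * ‖G x i‖ * ‖((φ x : ℝ) : ℂ)‖)
      (fun n => (hWn n).1.mul hφL.1) ?_ (fun n => Eventually.of_forall fun x => ?_) ?_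
    · have := (((MemLp.coord hG i).norm.const_mul (K : ℝ)).integrable_mul hφL.norm)
      exact this
    · rw [norm_mul]
      gcongr
      exact hap _ _
    · filter_upwards [hae] with x hx
      exact (tendsto_clm_apply ((hF'.tendsto _).comp hx) tendsto_const_nhds).mul_const _
  have L4 : Tendsto (fun n => ∫ x, fderiv ℝ F (v n x) (classGrad (v n) x i) * ((φ x : ℝ) : ℂ))
      atTop (𝓝 (∫ x, fderiv ℝ F (u x) (G x i) * ((φ x : ℝ) : ℂ))) := by
    have := L2.add L3
    rw [zero_add] at this
    refine this.congr fun n => ?_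
    refine (integral_add (((hDn n).sub (hWn n)).integrable_mul hφL)
      ((hWn n).integrable_mul hφL)).symm.trans ?_
    refine integral_congr_ae (Eventually.of_forall fun x => ?_)
    simp only [Pi.mul_apply, Pi.sub_apply]
    ring
  refine tendsto_nhds_unique L1 ?_
  simp only [e]
  exact L4.neg

/-- The weak gradient of `|u|²`. -/
theorem HasWeakGradient.integral_normSq {u : RN N → ℂ} {G : RN N → EuclideanSpace ℂ (Fin N)}
    (h : HasWeakGradient u G) (hu : MemLp u 2 volume) (hG : MemLp G 2 volume) {φ : RN N → ℝ}
    (hφ : ContDiff ℝ ∞ φ) (hc : HasCompactSupport φ) (i : Fin N) :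
    ∫ x, ‖u x‖ ^ 2 * fderiv ℝ φ x (EuclideanSpace.single i 1) =
      -∫ x, 2 * (conj (u x) * G x i).re * φ x := by
  obtain ⟨v, hvc, hv, hvg, hvu, hvG, -⟩ := h.exists_approx hu hG
  have hφ' := continuous_fderiv_ofReal_apply hφ (EuclideanSpace.single i 1)
  have hc' := hasCompactSupport_fderiv_ofReal_apply hc (EuclideanSpace.single i 1)
  have hφC : Continuous fun x => ((φ x : ℝ) : ℂ) := Complex.continuous_ofReal.comp hφ.continuous
  have hφc : HasCompactSupport fun x => ((φ x : ℝ) : ℂ) :=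
    hc.comp_left (g := ((↑) : ℝ → ℂ)) Complex.ofReal_zero
  -- multiplication by a bounded continuous function after conjugation
  have aux : ∀ {ψ : RN N → ℂ}, Continuous ψ → HasCompactSupport ψ → ∃ K : ℝ,
      ∀ (w : RN N → ℂ) (x : RN N), ‖conj (w x) * ψ x‖ ≤ K * ‖w x‖ := by
    intro ψ hψ hψc
    obtain ⟨K, hK⟩ := hψ.bounded_above_of_compact_support hψc
    refine ⟨K, fun w x => ?_⟩
    rw [norm_mul, RCLike.norm_conj, mul_comm]
    gcongr
    exact hK x
  have hm : ∀ {ψ : RN N → ℂ}, Continuous ψ → HasCompactSupport ψ → ∀ {w : RN N → ℂ},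
      MemLp w 2 volume → MemLp (fun x => conj (w x) * ψ x) 2 volume := by
    intro ψ hψ hψc w hw
    obtain ⟨K, hK⟩ := aux hψ hψc
    exact hw.of_le_mul ((Complex.continuous_conj.comp_aestronglyMeasurable hw.1).mul
      hψ.aestronglyMeasurable) (Eventually.of_forall (hK w))
  have hlim : ∀ {ψ : RN N → ℂ}, Continuous ψ → HasCompactSupport ψ →
      Tendsto (fun n => eLpNorm ((fun x => conj (v n x) * ψ x) - fun x => conj (u x) * ψ x) 2
        volume) atTop (𝓝 0) := by
    intro ψ hψ hψc
    obtain ⟨K, hK⟩ := aux hψ hψc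
    refine tendsto_eLpNorm_of_le (K := K) (fun n x => ?_) hvu
    have := hK (v n - u) x
    rw [Pi.sub_apply, map_sub, sub_mul] at this
    exact this
  have L1 := tendsto_integral_mul hu (hm hφ' hc' hu) hv (fun n => hm hφ' hc' (hv n)) hvu
    (hlim hφ' hc')
  have hvGi : Tendsto (fun n => eLpNorm ((fun x => classGrad (v n) x i) - fun x => G x i) 2
      volume) atTop (𝓝 0) :=
    tendsto_eLpNorm_of_le (K := 1) (fun n x => by
      simpa using norm_coord_le (classGrad (v n) x - G x) i) hvG
  have L2 := tendsto_integral_mul (MemLp.coord hG i) (hm hφC hφc hu) (fun n => MemLp.coord (hvg n) i)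
    (fun n => hm hφC hφc (hv n)) hvGi (hlim hφC hφc)
  have hre : ∀ (w : RN N → ℂ), ∫ x, ‖w x‖ ^ 2 * fderiv ℝ φ x (EuclideanSpace.single i 1) =
      (∫ x, w x * (conj (w x) * ((fderiv ℝ φ x (EuclideanSpace.single i 1) : ℝ) : ℂ))).re := by
    intro w
    have : ∀ x, w x * (conj (w x) * ((fderiv ℝ φ x (EuclideanSpace.single i 1) : ℝ) : ℂ)) =
        ((‖w x‖ ^ 2 * fderiv ℝ φ x (EuclideanSpace.single i 1) : ℝ) : ℂ) := fun x => by
      rw [← mul_assoc, Complex.mul_conj', ← Complex.ofReal_pow, ← Complex.ofReal_mul]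
    simp only [this]
    rw [integral_complex_ofReal, Complex.ofReal_re]
  have hre2 : ∀ (w : RN N → ℂ) (W : RN N → ℂ), MemLp w 2 volume → MemLp W 2 volume →
      ∫ x, 2 * (conj (w x) * W x).re * φ x =
      2 * (∫ x, W x * (conj (w x) * ((φ x : ℝ) : ℂ))).re := by
    intro w W hw hW
    have h1 : Integrable (fun x => W x * (conj (w x) * ((φ x : ℝ) : ℂ))) volume :=
      hW.integrable_mul (hm hφC hφc hw)
    have h2 := Complex.reCLM.integral_comp_comm h1
    rw [← Complex.reCLM_apply, ← h2, ← integral_const_mul]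
    refine integral_congr_ae (Eventually.of_forall fun x => ?_)
    simp only [Complex.reCLM_apply]
    rw [show W x * (conj (w x) * ((φ x : ℝ) : ℂ)) = ((φ x : ℝ) : ℂ) * (conj (w x) * W x) by ring,
      Complex.re_ofReal_mul]
    ring
  have hcl : ∀ n, ∫ x, ‖v n x‖ ^ 2 * fderiv ℝ φ x (EuclideanSpace.single i 1) =
      -∫ x, 2 * (conj (v n x) * classGrad (v n) x i).re * φ x := by
    intro n
    have hd : ∀ x, HasFDerivAt (fun x => ‖v n x‖ ^ 2)
        (2 • (innerSL ℝ (v n x)).comp (fderiv ℝ (v n) x)) x := fun x =>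
      (((hvc n).differentiable one_ne_zero).differentiableAt.hasFDerivAt).norm_sq
    have hC1 : ContDiff ℝ 1 (fun x => ‖v n x‖ ^ 2) := (hvc n).norm_sq ℝ
    have key := integral_mul_fderiv_of_contDiff (v := fun x => ((‖v n x‖ ^ 2 : ℝ) : ℂ))
      (Complex.ofRealCLM.contDiff.comp hC1) hφ hc (EuclideanSpace.single i 1)
    have hd2 : ∀ x, fderiv ℝ (fun x => ((‖v n x‖ ^ 2 : ℝ) : ℂ)) x (EuclideanSpace.single i 1) =
        ((2 * (conj (v n x) * classGrad (v n) x i).re : ℝ) : ℂ) := fun x => by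
      have h2 : HasFDerivAt (fun x => ((‖v n x‖ ^ 2 : ℝ) : ℂ)) _ x :=
        Complex.ofRealCLM.hasFDerivAt.comp x (hd x)
      rw [h2.fderiv]
      simp [classGrad, Complex.inner]
      ring
    simp only [hd2, ← Complex.ofReal_mul] at key
    rw [integral_complex_ofReal, integral_complex_ofReal] at key
    exact_mod_cast key
  have L1' := (Complex.continuous_re.tendsto _).comp L1
  have L2' := ((Complex.continuous_re.tendsto _).comp L2).const_mul 2
  rw [hre, hre2 u (fun x => G x i) hu (MemLp.coord hG i)]
  refine tendsto_nhds_unique L1' ?_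
  refine L2'.neg.congr fun n => ?_
  have h3 := hcl n
  rw [hre, hre2 (v n) (fun x => classGrad (v n) x i) (hv n) (MemLp.coord (hvg n) i)] at h3
  exact h3.symm

end Calculus

/-! ### Truncation -/

/-- Squaring removes the kink of the positive part at `0`, which makes `smoothPos` a `C¹` function.
-/
theorem hasDerivAt_max_zero_sq (t : ℝ) :
    HasDerivAt (fun t : ℝ => max t 0 ^ 2) (2 * max t 0) t := by
  rcases lt_trichotomy t 0 with h | rfl | h
  · have : (fun t : ℝ => max t 0 ^ 2) =ᶠ[𝓝 t] fun _ => 0 := by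
      filter_upwards [gt_mem_nhds h] with s hs
      simp [max_eq_right hs.le]
    rw [max_eq_right h.le, mul_zero]
    exact (hasDerivAt_const t (0 : ℝ)).congr_of_eventuallyEq this
  · rw [hasDerivAt_iff_isLittleO]
    simp only [max_self, mul_zero, smul_zero, sub_zero, ne_eq, OfNat.ofNat_ne_zero,
      not_false_eq_true, zero_pow]
    refine Asymptotics.IsBigO.trans_isLittleO (g := fun t : ℝ => t ^ 2) ?_
      (Asymptotics.isLittleO_pow_id one_lt_two)
    refine Asymptotics.IsBigO.of_bound 1 (Eventually.of_forall fun s => ?_)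
    rw [one_mul, norm_pow, norm_pow, Real.norm_eq_abs, Real.norm_eq_abs]
    refine pow_le_pow_left₀ (abs_nonneg _) ?_ 2
    rcases le_total s 0 with hs | hs
    · simp [max_eq_right hs]
    · simp [max_eq_left hs]
  · have : (fun t : ℝ => max t 0 ^ 2) =ᶠ[𝓝 t] fun t => t ^ 2 := by
      filter_upwards [lt_mem_nhds h] with s hs
      simp [max_eq_left hs.le]
    rw [max_eq_left h.le]
    simpa using (hasDerivAt_pow 2 t).congr_of_eventuallyEq this

/-- A `C¹` approximation of the positive part. -/
def smoothPos (ε t : ℝ) : ℝ := Real.sqrt (max t 0 ^ 2 + ε ^ 2) - ε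

/-- The derivative of `smoothPos`. -/
def smoothPos' (ε t : ℝ) : ℝ := max t 0 / Real.sqrt (max t 0 ^ 2 + ε ^ 2)

theorem hasDerivAt_smoothPos {ε : ℝ} (hε : 0 < ε) (t : ℝ) :
    HasDerivAt (smoothPos ε) (smoothPos' ε t) t := by
  have h := (((hasDerivAt_max_zero_sq t).add_const (ε ^ 2)).sqrt (by positivity)).sub_const ε
  refine h.congr_deriv ?_
  rw [smoothPos', mul_div_mul_left _ _ two_ne_zero]

theorem continuous_smoothPos' {ε : ℝ} (hε : 0 < ε) : Continuous (smoothPos' ε) := by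
  unfold smoothPos'
  refine Continuous.div (by fun_prop) (by fun_prop) fun t => ?_
  positivity

theorem abs_smoothPos'_le {ε : ℝ} (hε : 0 < ε) (t : ℝ) : |smoothPos' ε t| ≤ 1 := by
  rw [smoothPos', abs_of_nonneg (by positivity), div_le_one (by positivity)]
  refine Real.le_sqrt_of_sq_le ?_
  nlinarith

theorem smoothPos_nonneg_le {ε : ℝ} (hε : 0 < ε) (t : ℝ) :
    0 ≤ smoothPos ε t ∧ smoothPos ε t ≤ max t 0 := by
  have h0 : 0 ≤ max t 0 := le_max_right _ _
  constructor
  · rw [smoothPos, sub_nonneg]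
    exact Real.le_sqrt_of_sq_le (by nlinarith)
  · rw [smoothPos, sub_le_iff_le_add]
    exact Real.sqrt_le_iff.2 ⟨by positivity, by nlinarith⟩

theorem tendsto_smoothPos (t : ℝ) :
    Tendsto (fun n : ℕ => smoothPos (1 / ((n : ℝ) + 1)) t) atTop (𝓝 (max t 0)) := by
  have hc : Continuous fun ε : ℝ => Real.sqrt (max t 0 ^ 2 + ε ^ 2) - ε := by fun_prop
  have := (hc.tendsto 0).comp (tendsto_one_div_add_atTop_nhds_zero_nat (𝕜 := ℝ))
  simpa [Function.comp_def, smoothPos, Real.sqrt_sq (le_max_right t 0)] using this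

/-- The limit at `t = 0` is `0`, matching the strict inequality in `truncGrad`. No separate argument
about the gradient on the level set is needed. -/
theorem tendsto_smoothPos' (t : ℝ) :
    Tendsto (fun n : ℕ => smoothPos' (1 / ((n : ℝ) + 1)) t) atTop (𝓝 (if 0 < t then 1 else 0)) := by
  split_ifs with h
  · have hc : ContinuousAt (fun ε : ℝ => max t 0 / Real.sqrt (max t 0 ^ 2 + ε ^ 2)) 0 := by
      refine ContinuousAt.div (by fun_prop) (by fun_prop) ?_
      rw [max_eq_left h.le]
      positivity
    have := hc.tendsto.comp (tendsto_one_div_add_atTop_nhds_zero_nat (𝕜 := ℝ))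
    simpa [Function.comp_def, smoothPos', Real.sqrt_sq (le_max_right t 0), max_eq_left h.le,
      Real.sqrt_sq h.le, h.ne'] using this
  · simp [smoothPos', max_eq_right (not_lt.1 h)]

variable {N : ℕ}

/-- The truncation `(Re z - k)⁺`. -/
def truncFun (k : ℝ) (z : ℂ) : ℂ := ((max (z.re - k) 0 : ℝ) : ℂ)

open Classical in
/-- The gradient of `(Re u - k)⁺`. -/
def truncGrad (k : ℝ) (u : RN N → ℂ) (G : RN N → EuclideanSpace ℂ (Fin N)) (x : RN N) :
    EuclideanSpace ℂ (Fin N) :=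
  WithLp.toLp 2 fun i => if k < (u x).re then (((G x i).re : ℝ) : ℂ) else 0

theorem norm_truncFun_le {k : ℝ} (hk : 0 ≤ k) (z : ℂ) : ‖truncFun k z‖ ≤ ‖z‖ := by
  rw [truncFun, Complex.norm_real, Real.norm_of_nonneg (le_max_right _ _)]
  exact max_le ((sub_le_self _ hk).trans (Complex.re_le_norm z)) (norm_nonneg _)

theorem norm_truncGrad_le (k : ℝ) (u : RN N → ℂ) (G : RN N → EuclideanSpace ℂ (Fin N))
    (x : RN N) : ‖truncGrad k u G x‖ ≤ ‖G x‖ := by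
  rw [EuclideanSpace.norm_eq, EuclideanSpace.norm_eq]
  refine Real.sqrt_le_sqrt (Finset.sum_le_sum fun i _ => pow_le_pow_left₀ (norm_nonneg _) ?_ 2)
  simp only [truncGrad]
  split_ifs
  · rw [Complex.norm_real]
    exact Complex.abs_re_le_norm _
  · simp

theorem continuous_truncFun (k : ℝ) : Continuous (truncFun k) := by
  unfold truncFun
  fun_prop

theorem aestronglyMeasurable_truncGrad {u : RN N → ℂ} {G : RN N → EuclideanSpace ℂ (Fin N)}
    (hu : AEStronglyMeasurable u volume) (hG : AEStronglyMeasurable G volume) (k : ℝ) :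
    AEStronglyMeasurable (truncGrad k u G) volume := by
  refine aestronglyMeasurable_euclidean fun i => ?_
  have h1 : NullMeasurableSet {x | k < (u x).re} volume :=
    nullMeasurableSet_lt aemeasurable_const (Complex.measurable_re.comp_aemeasurable hu.aemeasurable)
  have h2 : AEStronglyMeasurable (fun x => (((G x i).re : ℝ) : ℂ)) volume :=
    (by fun_prop : Continuous fun y : EuclideanSpace ℂ (Fin N) =>
      (((y i).re : ℝ) : ℂ)).comp_aestronglyMeasurable hG
  exact h2.indicator₀ h1

/-- The weak gradient of `(Re u - k)⁺`. -/
theorem HasWeakGradient.trunc {u : RN N → ℂ} {G : RN N → EuclideanSpace ℂ (Fin N)}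
    (h : HasWeakGradient u G) (hu : MemLp u 2 volume) (hG : MemLp G 2 volume) {k : ℝ}
    (hk : 0 ≤ k) : HasWeakGradient (fun x => truncFun k (u x)) (truncGrad k u G) := by
  have hw : MemLp (fun x => truncFun k (u x)) 2 volume :=
    hu.of_le ((continuous_truncFun k).comp_aestronglyMeasurable hu.1)
      (Eventually.of_forall fun x => norm_truncFun_le hk _)
  have hW : MemLp (truncGrad k u G) 2 volume :=
    hG.of_le (aestronglyMeasurable_truncGrad hu.1 hG.1 k)
      (Eventually.of_forall fun x => norm_truncGrad_le k u G x)
  refine ⟨hw.locallyIntegrable (by norm_num), hW.locallyIntegrable (by norm_num), ?_⟩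
  intro φ hφ hc i
  have hφL : MemLp (fun x => ((φ x : ℝ) : ℂ)) 2 volume := memLp_of_continuous_compact
    (Complex.continuous_ofReal.comp hφ.continuous)
    (hc.comp_left (g := ((↑) : ℝ → ℂ)) Complex.ofReal_zero) 2
  have hφ'L := memLp_of_continuous_compact (continuous_fderiv_ofReal_apply hφ
    (EuclideanSpace.single i 1)) (hasCompactSupport_fderiv_ofReal_apply hc _) 2
  -- The chain rule applies to these `C¹` regularisations, which have derivative at most `1`. Since
  -- `k ≥ 0` they vanish at `0`, and `ε → 0` is a dominated limit on both sides.
  set F : ℝ → ℂ → ℂ := fun ε z => ((smoothPos ε (z.re - k) : ℝ) : ℂ) with hF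
  have hFd : ∀ ε : ℝ, 0 < ε → ∀ z, HasFDerivAt (F ε)
      (Complex.ofRealCLM.comp (smoothPos' ε (z.re - k) • Complex.reCLM)) z := by
    intro ε hε z
    have h1 : HasFDerivAt (fun z : ℂ => z.re - k) Complex.reCLM z :=
      Complex.reCLM.hasFDerivAt.sub_const k
    have h2 : HasFDerivAt (smoothPos ε ∘ fun z : ℂ => z.re - k) _ z :=
      (hasDerivAt_smoothPos hε (z.re - k)).comp_hasFDerivAt z h1
    exact Complex.ofRealCLM.hasFDerivAt.comp z h2
  have hF' : ∀ ε : ℝ, 0 < ε → ∀ z y, fderiv ℝ (F ε) z y =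
      ((smoothPos' ε (z.re - k) * y.re : ℝ) : ℂ) := fun ε hε z y => by
    rw [(hFd ε hε z).fderiv]
    simp
  have hcomp : ∀ n : ℕ, _ := fun n : ℕ => h.comp hu hG (F := F (1 / ((n : ℝ) + 1))) (K := 1)
    (by
      have hε : (0 : ℝ) < 1 / ((n : ℝ) + 1) := by positivity
      refine contDiff_one_iff_fderiv.2 ⟨fun z => (hFd _ hε z).differentiableAt, ?_⟩
      have : fderiv ℝ (F (1 / ((n : ℝ) + 1))) = fun z =>
          Complex.ofRealCLM.comp (smoothPos' (1 / ((n : ℝ) + 1)) (z.re - k) • Complex.reCLM) :=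
        funext fun z => (hFd _ hε z).fderiv
      rw [this]
      exact continuous_const.clm_comp (((continuous_smoothPos' hε).comp
        (Complex.continuous_re.sub continuous_const)).smul continuous_const))
    (by
      simp only [hF, smoothPos, Complex.zero_re, zero_sub]
      rw [max_eq_right (by linarith)]
      have hε : (0 : ℝ) < 1 / ((n : ℝ) + 1) := by positivity
      generalize 1 / ((n : ℝ) + 1) = ε at hε
      simp [Real.sqrt_sq hε.le])
    (fun z => by
      refine ContinuousLinearMap.opNorm_le_bound _ (by positivity) fun y => ?_
      rw [hF' _ (by positivity), Complex.norm_real, norm_mul]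
      refine mul_le_mul (abs_smoothPos'_le (by positivity) _) (Complex.abs_re_le_norm _)
        (norm_nonneg _) (by positivity))
  have L1 : Tendsto (fun n : ℕ => ∫ x, (F (1 / ((n : ℝ) + 1)) ∘ u) x * ((fderiv ℝ φ x
      (EuclideanSpace.single i 1) : ℝ) : ℂ)) atTop
      (𝓝 (∫ x, truncFun k (u x) * ((fderiv ℝ φ x (EuclideanSpace.single i 1) : ℝ) : ℂ))) := by
    refine tendsto_integral_of_dominated_convergence (fun x => ‖u x‖ * ‖((fderiv ℝ φ x
      (EuclideanSpace.single i 1) : ℝ) : ℂ)‖) (fun n => (hcomp n).1.1.mul hφ'L.1)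
      (hu.norm.integrable_mul hφ'L.norm) (fun n => Eventually.of_forall fun x => ?_)
      (Eventually.of_forall fun x => ?_)
    · rw [norm_mul]
      gcongr
      refine le_trans ?_ (norm_truncFun_le hk (u x))
      have := smoothPos_nonneg_le (ε := 1 / ((n : ℝ) + 1)) (by positivity) ((u x).re - k)
      simp only [hF, Function.comp_apply, truncFun, Complex.norm_real]
      rw [Real.norm_of_nonneg this.1, Real.norm_of_nonneg (le_max_right _ _)]
      exact this.2
    · exact ((Complex.continuous_ofReal.tendsto _).comp (tendsto_smoothPos _)).mul_const _
  have L2 : Tendsto (fun n : ℕ => ∫ x, fderiv ℝ (F (1 / ((n : ℝ) + 1))) (u x) (G x i)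
      * ((φ x : ℝ) : ℂ)) atTop (𝓝 (∫ x, truncGrad k u G x i * ((φ x : ℝ) : ℂ))) := by
    refine tendsto_integral_of_dominated_convergence (fun x => ‖G x i‖ * ‖((φ x : ℝ) : ℂ)‖)
      (fun n => (MemLp.coord (hcomp n).2.1 i).1.mul hφL.1)
      ((MemLp.coord hG i).norm.integrable_mul hφL.norm) (fun n => Eventually.of_forall fun x => ?_)
      (Eventually.of_forall fun x => ?_)
    · rw [norm_mul, hF' _ (by positivity), Complex.norm_real, norm_mul]
      gcongr
      have h1 := abs_smoothPos'_le (ε := 1 / ((n : ℝ) + 1)) (by positivity) ((u x).re - k)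
      calc _ ≤ 1 * ‖G x i‖ := mul_le_mul h1 (Complex.abs_re_le_norm _) (abs_nonneg _) zero_le_one
        _ = _ := one_mul _
    · refine Tendsto.mul_const _ ?_
      have h1 := (Complex.continuous_ofReal.tendsto _).comp
        ((tendsto_smoothPos' ((u x).re - k)).mul_const (G x i).re)
      have e : truncGrad k u G x i =
          (((if 0 < (u x).re - k then 1 else 0) * (G x i).re : ℝ) : ℂ) := by
        simp only [truncGrad, sub_pos]
        split_ifs <;> simp
      rw [e]
      refine h1.congr fun n => ?_
      rw [hF' _ (by positivity), Function.comp_apply]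
  refine tendsto_nhds_unique L1 (L2.neg.congr fun n => ?_)
  exact ((hcomp n).2.2.integral_eq φ hφ hc i).symm

/-! ### Weighted identities and Hardy's inequality -/

section Weighted

variable {N : ℕ}

/-- The radial component `x · G(x)`. -/
def radial (G : RN N → EuclideanSpace ℂ (Fin N)) (x : RN N) : ℂ := ∑ i, ((x i : ℝ) : ℂ) * G x i

theorem norm_radial_le (G : RN N → EuclideanSpace ℂ (Fin N)) (x : RN N) :
    ‖radial G x‖ ≤ ‖x‖ * ‖G x‖ := by
  have h : radial G x = inner ℂ (WithLp.toLp 2 fun i => ((x i : ℝ) : ℂ) :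
      EuclideanSpace ℂ (Fin N)) (G x) := by
    rw [radial, PiLp.inner_apply]
    refine Finset.sum_congr rfl fun i _ => ?_
    simp [mul_comm]
  rw [h]
  refine (norm_inner_le_norm _ _).trans (le_of_eq ?_)
  congr 1
  rw [EuclideanSpace.norm_eq, EuclideanSpace.norm_eq]
  simp

theorem aestronglyMeasurable_radial {G : RN N → EuclideanSpace ℂ (Fin N)}
    (hG : AEStronglyMeasurable G volume) : AEStronglyMeasurable (radial G) volume := by
  refine Finset.aestronglyMeasurable_fun_sum _ fun i _ => AEStronglyMeasurable.mul ?_ ?_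
  · exact (Complex.continuous_ofReal.comp (PiLp.continuous_apply 2 _ i)).aestronglyMeasurable
  · exact (PiLp.continuous_apply 2 _ i).comp_aestronglyMeasurable hG

theorem sum_smul_single (x : RN N) :
    ∑ i, x i • (EuclideanSpace.single i (1 : ℝ) : RN N) = x := by
  have := (EuclideanSpace.basisFun (Fin N) ℝ).sum_repr x
  simpa using this

variable {u : RN N → ℂ} {G : RN N → EuclideanSpace ℂ (Fin N)}

theorem integrable_conj_mul_re (hu : MemLp u 2 volume) {g : RN N → ℂ} (hg : MemLp g 2 volume)
    {ψ : RN N → ℝ} (hψ : Continuous ψ) (hc : HasCompactSupport ψ) :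
    Integrable (fun x => 2 * (conj (u x) * g x).re * ψ x) volume := by
  obtain ⟨C, hC⟩ := hψ.bounded_above_of_compact_support hc
  have h1 : Integrable (fun x => conj (u x) * g x) volume := by
    have hu' : MemLp (fun x => conj (u x)) 2 volume :=
      hu.of_le (Complex.continuous_conj.comp_aestronglyMeasurable hu.1)
        (Eventually.of_forall fun x => by simp)
    exact hu'.integrable_mul hg
  exact (h1.re.const_mul 2).mul_bdd hψ.aestronglyMeasurable (Eventually.of_forall hC)

/-- Integration by parts of `|u|²` against the vector field `g(x) x`. -/
theorem HasWeakGradient.integral_radial_of_compact (h : HasWeakGradient u G)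
    (hu : MemLp u 2 volume) (hG : MemLp G 2 volume) {g : RN N → ℝ} (hg : ContDiff ℝ ∞ g)
    (hc : HasCompactSupport g) :
    ∫ x, ‖u x‖ ^ 2 * (fderiv ℝ g x x + N * g x) =
      -∫ x, 2 * (conj (u x) * radial G x).re * g x := by
  have hxi : ∀ i, ContDiff ℝ ∞ (fun x : RN N => x i) := fun i =>
    (EuclideanSpace.proj i : RN N →L[ℝ] ℝ).contDiff
  set ψ : Fin N → RN N → ℝ := fun i x => g x * x i with hψ
  have hψc : ∀ i, ContDiff ℝ ∞ (ψ i) := fun i => hg.mul (hxi i)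
  have hψs : ∀ i, HasCompactSupport (ψ i) := fun i => hc.mul_right
  have hd : ∀ i x, fderiv ℝ (ψ i) x (EuclideanSpace.single i 1) =
      x i * fderiv ℝ g x (EuclideanSpace.single i 1) + g x := by
    intro i x
    have h1 : HasFDerivAt (fun x : RN N => x i) (EuclideanSpace.proj i : RN N →L[ℝ] ℝ) x :=
      (EuclideanSpace.proj i : RN N →L[ℝ] ℝ).hasFDerivAt
    have h2 := ((hg.differentiable (by simp)).differentiableAt (x := x)).hasFDerivAt.mul h1
    have h3 : HasFDerivAt (ψ i) _ x := h2
    rw [h3.fderiv]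
    simp
    ring
  -- The divergence of the field `g(x) x` is `x·∇g + N g`.
  have hsum : ∀ x, ∑ i, fderiv ℝ (ψ i) x (EuclideanSpace.single i 1) =
      fderiv ℝ g x x + N * g x := by
    intro x
    simp only [hd, Finset.sum_add_distrib, Finset.sum_const, Finset.card_univ, Fintype.card_fin,
      nsmul_eq_mul]
    congr 1
    have := congrArg (fderiv ℝ g x) (sum_smul_single x)
    rw [map_sum] at this
    simpa using this
  have husq : Integrable (fun x => ‖u x‖ ^ 2) volume := (memLp_two_iff_integrable_sq_norm hu.1).1 hu
  have hi1 : ∀ i, Integrable (fun x => ‖u x‖ ^ 2 *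
      fderiv ℝ (ψ i) x (EuclideanSpace.single i 1)) volume := fun i => by
    have hcont : Continuous fun x => fderiv ℝ (ψ i) x (EuclideanSpace.single i 1) :=
      ((hψc i).continuous_fderiv (by simp)).clm_apply continuous_const
    obtain ⟨C, hC⟩ := hcont.bounded_above_of_compact_support
      ((hψs i).fderiv_apply (𝕜 := ℝ) (EuclideanSpace.single i 1))
    exact husq.mul_bdd hcont.aestronglyMeasurable (Eventually.of_forall hC)
  have hi2 : ∀ i, Integrable (fun x => 2 * (conj (u x) * G x i).re * ψ i x) volume := fun i =>
    integrable_conj_mul_re hu (MemLp.coord hG i) (hψc i).continuous (hψs i)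
  calc ∫ x, ‖u x‖ ^ 2 * (fderiv ℝ g x x + N * g x)
      = ∫ x, ∑ i, ‖u x‖ ^ 2 * fderiv ℝ (ψ i) x (EuclideanSpace.single i 1) := by
        simp only [← hsum, Finset.mul_sum]
    _ = ∑ i, ∫ x, ‖u x‖ ^ 2 * fderiv ℝ (ψ i) x (EuclideanSpace.single i 1) :=
        integral_finsetSum _ fun i _ => hi1 i
    _ = ∑ i, -∫ x, 2 * (conj (u x) * G x i).re * ψ i x :=
        Finset.sum_congr rfl fun i _ => h.integral_normSq hu hG (hψc i) (hψs i) i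
    _ = -∫ x, ∑ i, 2 * (conj (u x) * G x i).re * ψ i x := by
        rw [Finset.sum_neg_distrib, integral_finsetSum _ fun i _ => hi2 i]
    _ = -∫ x, 2 * (conj (u x) * radial G x).re * g x := by
        congr 1
        refine integral_congr_ae (Eventually.of_forall fun x => ?_)
        simp only [radial, Finset.mul_sum, Complex.re_sum, Finset.sum_mul]
        refine Finset.sum_congr rfl fun i _ => ?_
        rw [show conj (u x) * (((x i : ℝ) : ℂ) * G x i) = ((x i : ℝ) : ℂ) * (conj (u x) * G x i) by
          ring, Complex.re_ofReal_mul]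
        simp only [hψ]
        ring

/-- The same identity for bounded weights, by cutting off at infinity. -/
theorem HasWeakGradient.integral_radial_of_bounded (h : HasWeakGradient u G)
    (hu : MemLp u 2 volume) (hG : MemLp G 2 volume) {f : RN N → ℝ} (hf : ContDiff ℝ ∞ f) {C : ℝ}
    (hfC : ∀ x, |f x| ≤ C) (hfC' : ∀ x, |fderiv ℝ f x x| ≤ C)
    (hint : Integrable (fun x => 2 * (conj (u x) * radial G x).re * f x) volume) :
    ∫ x, ‖u x‖ ^ 2 * (fderiv ℝ f x x + N * f x) =
      -∫ x, 2 * (conj (u x) * radial G x).re * f x := by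
  let η : ContDiffBump (0 : RN N) := ⟨1, 2, one_pos, one_lt_two⟩
  have hη : ContDiff ℝ ∞ η := η.contDiff
  have hη1 : ∀ x, |η x| ≤ 1 := fun x => by
    rw [abs_of_nonneg η.nonneg]
    exact η.le_one
  have hC0 : 0 ≤ C := (abs_nonneg _).trans (hfC 0)
  set c : ℕ → ℝ := fun n => 1 / ((n : ℝ) + 1) with hc
  have hc0 : Tendsto c atTop (𝓝 0) := tendsto_one_div_add_atTop_nhds_zero_nat
  have hcpos : ∀ n, 0 < c n := fun n => by simp only [hc]; positivity
  have hdc : Continuous fun y => fderiv ℝ η y y :=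
    (hη.continuous_fderiv (by simp)).clm_apply continuous_id
  obtain ⟨D, hD⟩ := hdc.bounded_above_of_compact_support (by
    refine (η.hasCompactSupport.fderiv (𝕜 := ℝ)).mono fun y hy => ?_
    intro h0
    exact hy (by simp [h0]))
  set g : ℕ → RN N → ℝ := fun n x => η (c n • x) * f x with hg
  have hηn : ∀ n, ContDiff ℝ ∞ (fun x => η (c n • x)) := fun n =>
    hη.comp (contDiff_const_smul (c n))
  have hgc : ∀ n, ContDiff ℝ ∞ (g n) := fun n => (hηn n).mul hf
  have hgs : ∀ n, HasCompactSupport (g n) := fun n =>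
    HasCompactSupport.mul_right (f := fun x => η (c n • x)) (η.hasCompactSupport.comp_homeomorph
      (Homeomorph.smulOfNeZero (c n) (hcpos n).ne'))
  -- The Euler derivative `x·∇` commutes with dilations, so the cut-off contributes the Euler
  -- derivative of `η` at `c_n x`. This is bounded uniformly in `n` and tends to `0` pointwise.
  have hgd : ∀ n x, fderiv ℝ (g n) x x = η (c n • x) * fderiv ℝ f x x
      + fderiv ℝ η (c n • x) (c n • x) * f x := by
    intro n x
    have h1 : HasFDerivAt (fun x : RN N => c n • x) (c n • ContinuousLinearMap.id ℝ (RN N)) x :=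
      (hasFDerivAt_id x).const_smul (c n)
    have h2 := ((hη.differentiable (by simp)).differentiableAt (x := c n • x)).hasFDerivAt.comp x h1
    have h3 := h2.mul ((hf.differentiable (by simp)).differentiableAt (x := x)).hasFDerivAt
    have h4 : HasFDerivAt (g n) _ x := h3
    rw [h4.fderiv]
    simp
    ring
  have hlimc : ∀ x : RN N, Tendsto (fun n => c n • x) atTop (𝓝 0) := fun x => by
    simpa using hc0.smul_const x
  have hlimη : ∀ x : RN N, Tendsto (fun n => η (c n • x)) atTop (𝓝 1) := fun x => by
    have h1 := (hη.continuous.tendsto 0).comp (hlimc x)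
    have h2 : η 0 = 1 := η.one_of_mem_closedBall (by simp [η])
    rwa [h2] at h1
  have hlimg : ∀ x, Tendsto (fun n => g n x) atTop (𝓝 (f x)) := fun x => by
    simpa using (hlimη x).mul_const (f x)
  have hlimgd : ∀ x, Tendsto (fun n => fderiv ℝ (g n) x x) atTop (𝓝 (fderiv ℝ f x x)) := fun x => by
    simp only [hgd]
    have h1 := (hdc.tendsto 0).comp (hlimc x)
    simpa using ((hlimη x).mul_const (fderiv ℝ f x x)).add (h1.mul_const (f x))
  have husq : Integrable (fun x => ‖u x‖ ^ 2) volume := (memLp_two_iff_integrable_sq_norm hu.1).1 hu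
  have hgb : ∀ n x, |g n x| ≤ |f x| := fun n x => by
    rw [hg, abs_mul]
    exact mul_le_of_le_one_left (abs_nonneg _) (hη1 _)
  have hgdb : ∀ n x, |fderiv ℝ (g n) x x + N * g n x| ≤ C + D * C + N * C := by
    intro n x
    rw [hgd]
    have h1 : |η (c n • x) * fderiv ℝ f x x| ≤ 1 * C := by
      rw [abs_mul]
      exact mul_le_mul (hη1 _) (hfC' x) (abs_nonneg _) zero_le_one
    have h2 : |fderiv ℝ η (c n • x) (c n • x) * f x| ≤ D * C := by
      rw [abs_mul]
      exact mul_le_mul (hD _) (hfC x) (abs_nonneg _) ((norm_nonneg _).trans (hD 0))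
    have h3 : |(N : ℝ) * g n x| ≤ N * C := by
      rw [abs_mul, Nat.abs_cast]
      gcongr
      exact (hgb n x).trans (hfC x)
    refine (abs_add_le _ _).trans (add_le_add ((abs_add_le _ _).trans (add_le_add ?_ h2)) h3)
    simpa using h1
  have L1 : Tendsto (fun n => ∫ x, ‖u x‖ ^ 2 * (fderiv ℝ (g n) x x + N * g n x)) atTop
      (𝓝 (∫ x, ‖u x‖ ^ 2 * (fderiv ℝ f x x + N * f x))) := by
    refine tendsto_integral_of_dominated_convergence (fun x => ‖u x‖ ^ 2 * (C + D * C + N * C))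
      (fun n => husq.1.mul ?_) (husq.mul_const _) (fun n => Eventually.of_forall fun x => ?_)
      (Eventually.of_forall fun x => ((hlimgd x).add ((hlimg x).const_mul _)).const_mul _)
    · exact ((((hgc n).continuous_fderiv (by simp)).clm_apply continuous_id).add
        ((hgc n).continuous.const_mul _)).aestronglyMeasurable
    · rw [norm_mul, norm_pow, norm_norm]
      gcongr
      exact hgdb n x
  have L2 : Tendsto (fun n => ∫ x, 2 * (conj (u x) * radial G x).re * g n x) atTop
      (𝓝 (∫ x, 2 * (conj (u x) * radial G x).re * f x)) := by
    have hm : AEStronglyMeasurable (fun x => 2 * (conj (u x) * radial G x).re) volume :=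
      (Complex.continuous_re.comp_aestronglyMeasurable
        ((Complex.continuous_conj.comp_aestronglyMeasurable hu.1).mul
          (aestronglyMeasurable_radial hG.1))).const_mul 2
    refine tendsto_integral_of_dominated_convergence
      (fun x => ‖2 * (conj (u x) * radial G x).re * f x‖)
      (fun n => hm.mul (hgc n).continuous.aestronglyMeasurable) hint.norm
      (fun n => Eventually.of_forall fun x => ?_)
      (Eventually.of_forall fun x => (hlimg x).const_mul _)
    rw [norm_mul, norm_mul (2 * (conj (u x) * radial G x).re) (f x)]
    have h1 := norm_nonneg (2 * (conj (u x) * radial G x).re)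
    exact mul_le_mul_of_nonneg_left (hgb n x) h1
  refine tendsto_nhds_unique L1 (L2.neg.congr fun n => ?_)
  exact (h.integral_radial_of_compact hu hG (hgc n) (hgs n)).symm

/-- The regularised power `(|x|² + ε)^s`. -/
def regPow (s ε : ℝ) (x : RN N) : ℝ := (‖x‖ ^ 2 + ε) ^ s

theorem contDiff_regPow {s ε : ℝ} (hε : 0 < ε) : ContDiff ℝ ∞ (regPow s ε : RN N → ℝ) := by
  refine ContDiff.rpow_const_of_ne ((contDiff_norm_sq ℝ).add contDiff_const) fun x => ?_
  positivity

theorem fderiv_regPow {s ε : ℝ} (hε : 0 < ε) (x : RN N) :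
    fderiv ℝ (regPow s ε) x x = 2 * s * (‖x‖ ^ 2 / (‖x‖ ^ 2 + ε)) * regPow s ε x := by
  have h1 : HasFDerivAt (fun x : RN N => ‖x‖ ^ 2 + ε) (2 • innerSL ℝ x) x := by
    simpa using ((hasFDerivAt_id x).norm_sq).add_const ε
  have hpos : (0 : ℝ) < ‖x‖ ^ 2 + ε := by positivity
  have h2 : HasFDerivAt (regPow s ε : RN N → ℝ) _ x := h1.rpow_const (Or.inl hpos.ne') (p := s)
  rw [h2.fderiv]
  simp only [smul_apply, innerSL_apply_apply, real_inner_self_eq_norm_sq, smul_eq_mul,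
    nsmul_eq_mul, Nat.cast_ofNat, regPow]
  rw [Real.rpow_sub_one hpos.ne']
  field_simp

theorem regPow_nonneg {s ε : ℝ} (hε : 0 < ε) (x : RN N) : 0 ≤ regPow s ε x := by
  unfold regPow
  positivity

theorem regPow_le {s ε : ℝ} (hs : s ≤ 0) (hε : 0 < ε) (x : RN N) : regPow s ε x ≤ ε ^ s :=
  Real.rpow_le_rpow_of_nonpos hε (by nlinarith [norm_nonneg x]) hs

theorem abs_fderiv_regPow_le {s ε : ℝ} (hε : 0 < ε) (x : RN N) :
    |fderiv ℝ (regPow s ε) x x| ≤ 2 * |s| * regPow s ε x := by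
  rw [fderiv_regPow hε, abs_mul, abs_mul, abs_mul, abs_two, abs_of_nonneg (regPow_nonneg hε x)]
  have h1 : |‖x‖ ^ 2 / (‖x‖ ^ 2 + ε)| ≤ 1 := by
    rw [abs_of_nonneg (by positivity), div_le_one (by positivity)]
    linarith
  have h2 := regPow_nonneg (s := s) hε x
  calc _ ≤ 2 * |s| * 1 * regPow s ε x := by gcongr
    _ = _ := by ring

theorem HasWeakGradient.integral_regPow (h : HasWeakGradient u G)
    (hu : MemLp u 2 volume) (hG : MemLp G 2 volume) {s ε : ℝ} (hs : s ≤ 0) (hε : 0 < ε)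
    (hint : Integrable (fun x => 2 * (conj (u x) * radial G x).re * regPow s ε x) volume) :
    ∫ x, ‖u x‖ ^ 2 * (fderiv ℝ (regPow s ε) x x + N * regPow s ε x) =
      -∫ x, 2 * (conj (u x) * radial G x).re * regPow s ε x := by
  refine h.integral_radial_of_bounded hu hG (contDiff_regPow hε)
    (C := (2 * |s| + 1) * ε ^ s) (fun x => ?_) (fun x => ?_) hint
  · rw [abs_of_nonneg (regPow_nonneg hε x)]
    refine (regPow_le hs hε x).trans ?_
    have : 0 ≤ |s| * ε ^ s := by positivity
    linarith
  · refine (abs_fderiv_regPow_le hε x).trans ?_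
    have := regPow_le hs hε x
    have h3 : 2 * |s| * regPow s ε x ≤ 2 * |s| * ε ^ s := by gcongr
    have : 0 ≤ ε ^ s := by positivity
    linarith

theorem two_mul_re_conj_mul_le (a b : ℂ) : |2 * (conj a * b).re| ≤ 2 * (‖a‖ * ‖b‖) := by
  rw [abs_mul, abs_two]
  gcongr
  refine (Complex.abs_re_le_norm _).trans ?_
  rw [norm_mul, RCLike.norm_conj]

/-- Hardy's inequality. -/
theorem HasWeakGradient.hardy (h : HasWeakGradient u G) (hu : MemLp u 2 volume)
    (hG : MemLp G 2 volume) (hN : 3 ≤ N) :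
    Integrable (fun x => ‖u x‖ ^ 2 / ‖x‖ ^ 2) volume ∧
    (((N : ℝ) - 2) / 2) ^ 2 * ∫ x, ‖u x‖ ^ 2 / ‖x‖ ^ 2 ≤ ∫ x, ‖G x‖ ^ 2 := by
  have hN' : (3 : ℝ) ≤ N := by exact_mod_cast hN
  set a : ℝ := ((N : ℝ) - 2) / 2 with ha
  have ha0 : 0 < a := by rw [ha]; linarith
  have husq : Integrable (fun x => ‖u x‖ ^ 2) volume := (memLp_two_iff_integrable_sq_norm hu.1).1 hu
  have hGsq : Integrable (fun x => ‖G x‖ ^ 2) volume := (memLp_two_iff_integrable_sq_norm hG.1).1 hG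
  have hreg : ∀ (ε : ℝ), 0 < ε → ∀ x : RN N, regPow (-1) ε x = 1 / (‖x‖ ^ 2 + ε) := fun ε hε x => by
    rw [regPow, Real.rpow_neg_one, one_div]
  have hregi : ∀ ε : ℝ, 0 < ε → Integrable (fun x => ‖u x‖ ^ 2 * regPow (-1) ε x) volume := by
    intro ε hε
    refine husq.mul_bdd (c := ε ^ (-1 : ℝ)) (contDiff_regPow hε).continuous.aestronglyMeasurable
      (Eventually.of_forall fun x => ?_)
    rw [Real.norm_of_nonneg (regPow_nonneg hε x)]
    exact regPow_le (by norm_num) hε x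
  -- Young's inequality with weight `a = (N-2)/2`, the choice that produces the Hardy constant `a²`.
  have hpt : ∀ ε : ℝ, 0 < ε → ∀ x, |2 * (conj (u x) * radial G x).re * regPow (-1) ε x| ≤
      a * (‖u x‖ ^ 2 * regPow (-1) ε x) + a⁻¹ * ‖G x‖ ^ 2 := by
    intro ε hε x
    rw [abs_mul, abs_of_nonneg (regPow_nonneg hε x), hreg ε hε]
    have h1 := (two_mul_re_conj_mul_le (u x) (radial G x))
    have h2 := norm_radial_le G x
    have hp : (0 : ℝ) < ‖x‖ ^ 2 + ε := by positivity
    have h3 : |2 * (conj (u x) * radial G x).re| ≤ 2 * (‖u x‖ * (‖x‖ * ‖G x‖)) :=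
      h1.trans (by gcongr)
    have h4 : 2 * (‖u x‖ * (‖x‖ * ‖G x‖)) ≤
        a * ‖u x‖ ^ 2 + a⁻¹ * ‖G x‖ ^ 2 * (‖x‖ ^ 2 + ε) := by
      have h5 : 0 ≤ a⁻¹ * (a * ‖u x‖ - ‖x‖ * ‖G x‖) ^ 2 := by positivity
      have h6 : 0 ≤ a⁻¹ * ‖G x‖ ^ 2 * ε := by positivity
      have h7 : a⁻¹ * (a * ‖u x‖ - ‖x‖ * ‖G x‖) ^ 2 = a * ‖u x‖ ^ 2
          - 2 * (‖u x‖ * (‖x‖ * ‖G x‖)) + a⁻¹ * ‖G x‖ ^ 2 * ‖x‖ ^ 2 := by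
        field_simp
        ring
      linarith
    calc _ ≤ (a * ‖u x‖ ^ 2 + a⁻¹ * ‖G x‖ ^ 2 * (‖x‖ ^ 2 + ε)) * (1 / (‖x‖ ^ 2 + ε)) := by
          gcongr
          exact h3.trans h4
      _ = _ := by field_simp
  have hmeas : ∀ ε : ℝ, 0 < ε → AEStronglyMeasurable
      (fun x => 2 * (conj (u x) * radial G x).re * regPow (-1) ε x) volume := fun ε hε =>
    ((Complex.continuous_re.comp_aestronglyMeasurable
        ((Complex.continuous_conj.comp_aestronglyMeasurable hu.1).mul
          (aestronglyMeasurable_radial hG.1))).const_mul 2).mul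
      (contDiff_regPow hε).continuous.aestronglyMeasurable
  have hbnd : ∀ ε : ℝ, 0 < ε → a ^ 2 * ∫ x, ‖u x‖ ^ 2 * regPow (-1) ε x ≤ ∫ x, ‖G x‖ ^ 2 := by
    intro ε hε
    have hi : Integrable (fun x => a * (‖u x‖ ^ 2 * regPow (-1) ε x) + a⁻¹ * ‖G x‖ ^ 2) volume :=
      ((hregi ε hε).const_mul a).add (hGsq.const_mul _)
    have hint : Integrable (fun x => 2 * (conj (u x) * radial G x).re * regPow (-1) ε x) volume :=
      hi.mono' (hmeas ε hε) (Eventually.of_forall (hpt ε hε))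
    have key := h.integral_regPow hu hG (s := -1) (by norm_num) hε hint
    -- The field `x/(|x|²+ε)` has divergence at least `(N-2)/(|x|²+ε)`, because `|x|²/(|x|²+ε) ≤ 1`.
    have h1 : 2 * a * ∫ x, ‖u x‖ ^ 2 * regPow (-1) ε x ≤
        ∫ x, ‖u x‖ ^ 2 * (fderiv ℝ (regPow (-1) ε) x x + N * regPow (-1) ε x) := by
      rw [← integral_const_mul]
      refine integral_mono ((hregi ε hε).const_mul _) ?_ fun x => ?_
      · refine husq.mul_bdd (c := (2 * |(-1 : ℝ)| + N) * ε ^ (-1 : ℝ)) ?_ (Eventually.of_forall fun x => ?_)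
        · exact ((((contDiff_regPow hε).continuous_fderiv (by simp)).clm_apply continuous_id).add
            ((contDiff_regPow hε).continuous.const_mul _)).aestronglyMeasurable
        · have h2 := abs_fderiv_regPow_le (s := -1) hε x
          have h3 := regPow_le (s := -1) (by norm_num) hε x
          have h4 := regPow_nonneg (s := -1) hε x
          refine (norm_add_le _ _).trans ?_
          rw [norm_mul, Real.norm_of_nonneg h4, Real.norm_natCast, add_mul]
          refine add_le_add (h2.trans ?_) ?_ <;> gcongr
      · beta_reduce
        rw [fderiv_regPow hε]
        have h4 := regPow_nonneg (s := -1) hε x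
        have h5 : ‖x‖ ^ 2 / (‖x‖ ^ 2 + ε) ≤ 1 := by
          rw [div_le_one (by positivity)]
          linarith
        have h6 : 2 * a = N - 2 := by rw [ha]; ring
        have h7 : ‖u x‖ ^ 2 * regPow (-1) ε x * (‖x‖ ^ 2 / (‖x‖ ^ 2 + ε)) ≤
            ‖u x‖ ^ 2 * regPow (-1) ε x * 1 := by gcongr
        rw [h6]
        nlinarith
    have h2 : -∫ x, 2 * (conj (u x) * radial G x).re * regPow (-1) ε x ≤
        (a * ∫ x, ‖u x‖ ^ 2 * regPow (-1) ε x) + a⁻¹ * ∫ x, ‖G x‖ ^ 2 := by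
      have h3 : ∫ x, -(2 * (conj (u x) * radial G x).re * regPow (-1) ε x) ≤
          ∫ x, (a * (‖u x‖ ^ 2 * regPow (-1) ε x) + a⁻¹ * ‖G x‖ ^ 2) :=
        integral_mono hint.neg hi fun x => (neg_le_abs _).trans (hpt ε hε x)
      rw [integral_neg, integral_add ((hregi ε hε).const_mul a) (hGsq.const_mul _),
        integral_const_mul, integral_const_mul] at h3
      exact h3
    rw [key] at h1
    have h3 : a * ∫ x, ‖u x‖ ^ 2 * regPow (-1) ε x ≤ a⁻¹ * ∫ x, ‖G x‖ ^ 2 := by linarith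
    have h4 : a * (a * ∫ x, ‖u x‖ ^ 2 * regPow (-1) ε x) ≤ a * (a⁻¹ * ∫ x, ‖G x‖ ^ 2) := by gcongr
    rw [← mul_assoc, ← mul_assoc, mul_inv_cancel₀ ha0.ne', one_mul, ← sq] at h4
    exact h4
  set c : ℕ → ℝ := fun n => 1 / ((n : ℝ) + 1) with hc
  have hc0 : Tendsto c atTop (𝓝 0) := tendsto_one_div_add_atTop_nhds_zero_nat
  have hcpos : ∀ n, 0 < c n := fun n => by simp only [hc]; positivity
  have hlim : ∀ᵐ x : RN N, Tendsto (fun n => ‖u x‖ ^ 2 * regPow (-1) (c n) x) atTop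
      (𝓝 (‖u x‖ ^ 2 / ‖x‖ ^ 2)) := by
    have hne : ∀ᵐ x : RN N, x ≠ 0 := by
      have : Nonempty (Fin N) := ⟨⟨0, by omega⟩⟩
      exact Measure.ae_ne volume 0
    filter_upwards [hne] with x hx
    simp only [hreg _ (hcpos _)]
    have h1 : Tendsto (fun n => ‖x‖ ^ 2 + c n) atTop (𝓝 (‖x‖ ^ 2)) := by
      simpa using hc0.const_add (‖x‖ ^ 2)
    have h2 := (h1.inv₀ (by simpa using hx)).const_mul (‖u x‖ ^ 2)
    simpa only [one_div, div_eq_mul_inv, one_mul] using h2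
  -- The bound is uniform in `ε`, so Fatou's lemma gives both integrability of `|u|²/|x|²` and the
  -- inequality.
  have hfatou : ∫⁻ x, ‖‖u x‖ ^ 2 / ‖x‖ ^ 2‖ₑ ≤ ENNReal.ofReal ((a ^ 2)⁻¹ * ∫ x, ‖G x‖ ^ 2) := by
    have h1 := Lp.eLpNorm_lim_le_liminf_eLpNorm (p := 1) (μ := volume)
      (f := fun n x => ‖u x‖ ^ 2 * regPow (-1) (c n) x) (fun n => (hregi _ (hcpos n)).1) _ hlim
    rw [eLpNorm_one_eq_lintegral_enorm] at h1
    refine h1.trans ?_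
    refine liminf_le_of_frequently_le' (Eventually.of_forall fun n => ?_).frequently
    rw [eLpNorm_one_eq_lintegral_enorm]
    have h2 : ∀ x, ‖‖u x‖ ^ 2 * regPow (-1) (c n) x‖ₑ =
        ENNReal.ofReal (‖u x‖ ^ 2 * regPow (-1) (c n) x) := fun x =>
      Real.enorm_of_nonneg (mul_nonneg (by positivity) (regPow_nonneg (hcpos n) x))
    simp only [h2]
    rw [← ofReal_integral_eq_lintegral_ofReal (hregi _ (hcpos n)) (Eventually.of_forall fun x =>
      mul_nonneg (by positivity) (regPow_nonneg (hcpos n) x))]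
    refine ENNReal.ofReal_le_ofReal ?_
    rw [le_inv_mul_iff₀ (by positivity)]
    exact hbnd _ (hcpos n)
  have hm : AEStronglyMeasurable (fun x : RN N => ‖u x‖ ^ 2 / ‖x‖ ^ 2) volume :=
    aestronglyMeasurable_of_tendsto_ae atTop (fun n => (hregi _ (hcpos n)).1) hlim
  have hInt : Integrable (fun x : RN N => ‖u x‖ ^ 2 / ‖x‖ ^ 2) volume :=
    ⟨hm, hfatou.trans_lt ENNReal.ofReal_lt_top⟩
  refine ⟨hInt, ?_⟩
  have h1 : ∀ x, ‖‖u x‖ ^ 2 / ‖x‖ ^ 2‖ₑ = ENNReal.ofReal (‖u x‖ ^ 2 / ‖x‖ ^ 2) := fun x =>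
    Real.enorm_of_nonneg (by positivity)
  simp only [h1] at hfatou
  rw [← ofReal_integral_eq_lintegral_ofReal hInt (Eventually.of_forall fun x => by positivity),
    ENNReal.ofReal_le_ofReal_iff (mul_nonneg (by positivity) (integral_nonneg fun x => by positivity)),
    le_inv_mul_iff₀ (by positivity)] at hfatou
  exact hfatou

/-- The drift identity: integration by parts against the field `|x|^{2s} x`. -/
theorem HasWeakGradient.drift (h : HasWeakGradient u G) (hu : MemLp u 2 volume)
    (hG : MemLp G 2 volume) (hN : 0 < N) {s : ℝ} (hs : s ≤ 0)
    (hi1 : Integrable (fun x => ‖u x‖ ^ 2 * ‖x‖ ^ (2 * s)) volume)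
    (hi2 : Integrable (fun x => ‖u x‖ * ‖radial G x‖ * ‖x‖ ^ (2 * s)) volume) :
    (2 * s + N) * ∫ x, ‖u x‖ ^ 2 * ‖x‖ ^ (2 * s) =
      -(2 * ∫ x, (conj (u x) * radial G x).re * ‖x‖ ^ (2 * s)) := by
  set c : ℕ → ℝ := fun n => 1 / ((n : ℝ) + 1) with hc
  have hc0 : Tendsto c atTop (𝓝 0) := tendsto_one_div_add_atTop_nhds_zero_nat
  have hcpos : ∀ n, 0 < c n := fun n => by simp only [hc]; positivity
  have hne : ∀ᵐ x : RN N, x ≠ 0 := by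
    have : Nonempty (Fin N) := ⟨⟨0, hN⟩⟩
    exact Measure.ae_ne volume 0
  have hpow : ∀ x : RN N, ‖x‖ ^ (2 * s) = (‖x‖ ^ 2) ^ s := fun x => by
    rw [← Real.rpow_natCast, ← Real.rpow_mul (norm_nonneg _)]
    norm_num
  -- Because `s ≤ 0`, the regularised weights increase to the singular weight, so the latter
  -- dominates both sides of the identity.
  have hle : ∀ n, ∀ x : RN N, x ≠ 0 → regPow s (c n) x ≤ ‖x‖ ^ (2 * s) := fun n x hx => by
    rw [hpow]
    exact Real.rpow_le_rpow_of_nonpos (by positivity) (by linarith [hcpos n]) hs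
  have hl0 : ∀ x : RN N, Tendsto (fun n => ‖x‖ ^ 2 + c n) atTop (𝓝 (‖x‖ ^ 2)) := fun x => by
    simpa using hc0.const_add (‖x‖ ^ 2)
  have hl1 : ∀ x : RN N, x ≠ 0 → Tendsto (fun n => regPow s (c n) x) atTop (𝓝 (‖x‖ ^ (2 * s))) :=
    fun x hx => by
    rw [hpow]
    exact (hl0 x).rpow_const (Or.inl (by positivity))
  have hl2 : ∀ x : RN N, x ≠ 0 → Tendsto (fun n => fderiv ℝ (regPow s (c n)) x x) atTop
      (𝓝 (2 * s * ‖x‖ ^ (2 * s))) := fun x hx => by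
    simp only [fderiv_regPow (hcpos _)]
    have hx2 : ‖x‖ ^ 2 ≠ 0 := by positivity
    have h1 : Tendsto (fun n => ‖x‖ ^ 2 / (‖x‖ ^ 2 + c n)) atTop (𝓝 (‖x‖ ^ 2 / ‖x‖ ^ 2)) :=
      tendsto_const_nhds.div (hl0 x) hx2
    rw [div_self hx2] at h1
    simpa using (h1.const_mul (2 * s)).mul (hl1 x hx)
  have hmr : AEStronglyMeasurable (fun x => 2 * (conj (u x) * radial G x).re) volume :=
    (Complex.continuous_re.comp_aestronglyMeasurable
        ((Complex.continuous_conj.comp_aestronglyMeasurable hu.1).mul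
          (aestronglyMeasurable_radial hG.1))).const_mul 2
  have hmi : ∀ n, AEStronglyMeasurable
      (fun x => 2 * (conj (u x) * radial G x).re * regPow s (c n) x) volume := fun n =>
    hmr.mul (contDiff_regPow (hcpos n)).continuous.aestronglyMeasurable
  have hdom : ∀ n, ∀ᵐ x, ‖2 * (conj (u x) * radial G x).re * regPow s (c n) x‖ ≤
      2 * (‖u x‖ * ‖radial G x‖ * ‖x‖ ^ (2 * s)) := fun n => by
    filter_upwards [hne] with x hx
    rw [norm_mul, Real.norm_of_nonneg (regPow_nonneg (hcpos n) x), ← mul_assoc]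
    exact mul_le_mul (two_mul_re_conj_mul_le _ _) (hle n x hx) (regPow_nonneg (hcpos n) x)
      (by positivity)
  have key := fun n => h.integral_regPow hu hG hs (hcpos n) ((hi2.const_mul 2).mono' (hmi n) (hdom n))
  have L1 : Tendsto (fun n => ∫ x, ‖u x‖ ^ 2 * (fderiv ℝ (regPow s (c n)) x x
      + N * regPow s (c n) x)) atTop
      (𝓝 (∫ x, ‖u x‖ ^ 2 * (2 * s * ‖x‖ ^ (2 * s) + N * ‖x‖ ^ (2 * s)))) := by
    refine tendsto_integral_of_dominated_convergence
      (fun x => (2 * |s| + N) * (‖u x‖ ^ 2 * ‖x‖ ^ (2 * s))) (fun n => ?_) (hi1.const_mul _)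
      (fun n => ?_) ?_
    · exact (hu.1.norm.pow 2).mul ((((contDiff_regPow (hcpos n)).continuous_fderiv
        (by simp)).clm_apply continuous_id).add
        ((contDiff_regPow (hcpos n)).continuous.const_mul _)).aestronglyMeasurable
    · filter_upwards [hne] with x hx
      have h2 := abs_fderiv_regPow_le (s := s) (hcpos n) x
      have h3 := hle n x hx
      have h4 := regPow_nonneg (s := s) (hcpos n) x
      have h5 : ‖fderiv ℝ (regPow s (c n)) x x + N * regPow s (c n) x‖ ≤
          (2 * |s| + N) * ‖x‖ ^ (2 * s) := by
        refine (norm_add_le _ _).trans ?_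
        rw [norm_mul, Real.norm_of_nonneg h4, Real.norm_natCast, add_mul]
        refine add_le_add (h2.trans ?_) ?_ <;> gcongr
      rw [norm_mul, norm_pow, norm_norm]
      calc _ ≤ ‖u x‖ ^ 2 * ((2 * |s| + N) * ‖x‖ ^ (2 * s)) := by gcongr
        _ = _ := by ring
    · filter_upwards [hne] with x hx
      exact ((hl2 x hx).add ((hl1 x hx).const_mul _)).const_mul _
  have L2 : Tendsto (fun n => ∫ x, 2 * (conj (u x) * radial G x).re * regPow s (c n) x) atTop
      (𝓝 (∫ x, 2 * (conj (u x) * radial G x).re * ‖x‖ ^ (2 * s))) := by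
    refine tendsto_integral_of_dominated_convergence _ hmi (hi2.const_mul 2) hdom ?_
    filter_upwards [hne] with x hx using (hl1 x hx).const_mul _
  have := tendsto_nhds_unique L1 (L2.neg.congr fun n => (key n).symm)
  rw [← integral_const_mul, ← integral_const_mul]
  simp only [mul_assoc] at this ⊢
  rw [← this]
  refine integral_congr_ae (Eventually.of_forall fun x => ?_)
  beta_reduce
  ring

end Weighted

/-! ### Weak gradients: congruence and uniqueness -/

section WeakGradient

variable {N : ℕ} {u u' : RN N → ℂ} {G G' : RN N → EuclideanSpace ℂ (Fin N)}

theorem HasWeakGradient.congr_ae (h : HasWeakGradient u G) (hu : u =ᵐ[volume] u')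
    (hG : G =ᵐ[volume] G') : HasWeakGradient u' G' where
  locInt := h.locInt.congr hu
  locInt_grad := h.locInt_grad.congr hG
  integral_eq φ hφ hc i := by
    have h1 : ∫ x, u' x * ((fderiv ℝ φ x (EuclideanSpace.single i 1) : ℝ) : ℂ) =
        ∫ x, u x * ((fderiv ℝ φ x (EuclideanSpace.single i 1) : ℝ) : ℂ) :=
      integral_congr_ae (hu.mono fun x hx => by simp only [hx])
    have h2 : ∫ x, G' x i * ((φ x : ℝ) : ℂ) = ∫ x, G x i * ((φ x : ℝ) : ℂ) :=
      integral_congr_ae (hG.mono fun x hx => by simp only [hx])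
    rw [h1, h2, h.integral_eq φ hφ hc i]

theorem LocallyIntegrable.coord (hG : LocallyIntegrable G volume) (i : Fin N) :
    LocallyIntegrable (fun x => G x i) volume := by
  refine hG.mono ((PiLp.continuous_apply 2 _ i).comp_aestronglyMeasurable
    hG.aestronglyMeasurable) (Eventually.of_forall fun x => norm_coord_le _ i)

/-- Uniqueness makes the arbitrary choice in `weakGrad` harmless: any concrete weak gradient may be
used in the form and its domain. -/
theorem HasWeakGradient.ae_eq (h : HasWeakGradient u G) (h' : HasWeakGradient u G') :
    G =ᵐ[volume] G' := by
  have hi : ∀ i, ∀ᵐ x, G x i = G' x i := fun i => by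
    refine ae_eq_of_integral_contDiff_smul_eq (LocallyIntegrable.coord h.locInt_grad i)
      (LocallyIntegrable.coord h'.locInt_grad i) fun φ hφ hc => ?_
    have h1 := h.integral_eq φ hφ hc i
    rw [h'.integral_eq φ hφ hc i, neg_inj] at h1
    simp only [Complex.real_smul, mul_comm ((φ _ : ℝ) : ℂ)]
    exact h1.symm
  filter_upwards [ae_all_iff.2 hi] with x hx
  ext i
  exact hx i

theorem HasWeakGradient.weakGrad (h : HasWeakGradient u G) :
    HasWeakGradient u (weakGrad u) := by
  have h' : ∃ G, HasWeakGradient u G := ⟨G, h⟩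
  rw [PolyGrowth.weakGrad, dif_pos h']
  exact h'.choose_spec

end WeakGradient

/-! ### Pairs in the form domain -/

/-- The density of the form at `x`. -/
def formDensity {N : ℕ} (α β b c lam : ℝ) (x : RN N) (a : ℂ) (A : EuclideanSpace ℂ (Fin N))
    (d : ℂ) (D : EuclideanSpace ℂ (Fin N)) : ℂ :=
  ((1 + ‖x‖ ^ α : ℝ) : ℂ) * ∑ i, A i * conj (D i)
      + (((α - b) * ‖x‖ ^ (α - 2) : ℝ) : ℂ) * (∑ i, ((x i : ℝ) : ℂ) * A i) * conj d
      + ((c * ‖x‖ ^ (α - 2) : ℝ) : ℂ) * a * conj d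
      + ((‖x‖ ^ β : ℝ) : ℂ) * a * conj d
      + (lam : ℂ) * a * conj d

/-- `u` belongs to the form domain, with weak gradient `G`. -/
structure IsFormPair {N : ℕ} (α β : ℝ) (u : RN N → ℂ) (G : RN N → EuclideanSpace ℂ (Fin N)) :
    Prop where
  weak : HasWeakGradient u G
  mem : MemLp u 2 volume
  mem_grad : MemLp G 2 volume
  mem_wgrad : MemLp (fun x => Real.sqrt (1 + ‖x‖ ^ α) • G x) 2 volume
  mem_sing : MemLp (fun x => Real.sqrt (‖x‖ ^ (α - 2)) • u x) 2 volume
  mem_pot : MemLp (fun x => Real.sqrt (‖x‖ ^ β) • u x) 2 volume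

section FormPair

variable {N : ℕ} {α β b c lam : ℝ}

theorem mem_formDomain_iff {u : LpRN N 2} :
    u ∈ formDomain N α β ↔ IsFormPair α β u (weakGrad u) := by
  refine ⟨fun ⟨⟨h1, ⟨G, h2⟩, h3⟩, h4, h5, h6⟩ => ⟨h2.weakGrad, h1, h3, h4, h5, h6⟩, fun h =>
    ⟨⟨h.mem, ⟨_, h.weak⟩, h.mem_grad⟩, h.mem_wgrad, h.mem_sing, h.mem_pot⟩⟩

theorem IsFormPair.congr_ae {u u' : RN N → ℂ} {G G' : RN N → EuclideanSpace ℂ (Fin N)}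
    (h : IsFormPair α β u G) (hu : u =ᵐ[volume] u') (hG : G =ᵐ[volume] G') :
    IsFormPair α β u' G' where
  weak := h.weak.congr_ae hu hG
  mem := h.mem.ae_eq hu
  mem_grad := h.mem_grad.ae_eq hG
  mem_wgrad := h.mem_wgrad.ae_eq (hG.mono fun x hx => by simp only [hx])
  mem_sing := h.mem_sing.ae_eq (hu.mono fun x hx => by simp only [hx])
  mem_pot := h.mem_pot.ae_eq (hu.mono fun x hx => by simp only [hx])

theorem IsFormPair.mem_formDomain {u : LpRN N 2} {G : RN N → EuclideanSpace ℂ (Fin N)}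
    (h : IsFormPair α β u G) : u ∈ formDomain N α β :=
  mem_formDomain_iff.2 (h.congr_ae (ae_eq_refl _) (h.weak.ae_eq h.weak.weakGrad))

theorem IsFormPair.form_eq {u v : LpRN N 2} {u' v' : RN N → ℂ}
    {G H : RN N → EuclideanSpace ℂ (Fin N)} (hu : HasWeakGradient u' G) (hv : HasWeakGradient v' H)
    (hu' : u =ᵐ[volume] u') (hv' : v =ᵐ[volume] v') :
    form α β b c lam u v = ∫ x, formDensity α β b c lam x (u' x) (G x) (v' x) (H x) := by
  have h1 := hu.congr_ae hu'.symm (ae_eq_refl _)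
  have h2 := hv.congr_ae hv'.symm (ae_eq_refl _)
  refine integral_congr_ae ?_
  filter_upwards [h1.weakGrad.ae_eq h1, h2.weakGrad.ae_eq h2, hu', hv'] with x e1 e2 e3 e4
  simp only [formDensity, e1, e2, e3, e4]

end FormPair

/-! ### Pointwise operators on `L²` -/

section Pointwise

variable {X E F : Type*} [MeasurableSpace X] {μ : Measure X} [NormedAddCommGroup E]
  [NormedSpace ℂ E] [NormedAddCommGroup F] [NormedSpace ℂ F]

/-- The operator on `L²` acting pointwise by uniformly bounded linear maps. -/
def pointwiseOp (m : X → E →ₗ[ℂ] F) (C : ℝ)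
    (hm : ∀ v : X → E, AEStronglyMeasurable v μ → AEStronglyMeasurable (fun x => m x (v x)) μ)
    (hb : ∀ x y, ‖m x y‖ ≤ C * ‖y‖) : Lp E 2 μ →L[ℂ] Lp F 2 μ :=
  have hmem : ∀ v : Lp E 2 μ, MemLp (fun x => m x (v x)) 2 μ := fun v =>
    (Lp.memLp v).of_le_mul (hm _ (Lp.aestronglyMeasurable v)) (Eventually.of_forall fun x => hb x _)
  LinearMap.mkContinuous
    { toFun := fun v => (hmem v).toLp _
      map_add' := fun v w => by
        rw [← MemLp.toLp_add]
        refine MemLp.toLp_congr _ _ ?_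
        filter_upwards [Lp.coeFn_add v w] with x hx
        simp only [Pi.add_apply] at hx ⊢
        rw [hx, map_add]
      map_smul' := fun a v => by
        rw [RingHom.id_apply, ← MemLp.toLp_const_smul]
        refine MemLp.toLp_congr _ _ ?_
        filter_upwards [Lp.coeFn_smul a v] with x hx
        simp only [Pi.smul_apply] at hx ⊢
        rw [hx, map_smul] } C
    (fun v => Lp.norm_le_mul_norm_of_ae_le_mul (by
      filter_upwards [(hmem v).coeFn_toLp] with x hx
      change ‖((hmem v).toLp _) x‖ ≤ _
      rw [hx]
      exact hb x _))

theorem coeFn_pointwiseOp (m : X → E →ₗ[ℂ] F) (C : ℝ)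
    (hm : ∀ v : X → E, AEStronglyMeasurable v μ → AEStronglyMeasurable (fun x => m x (v x)) μ)
    (hb : ∀ x y, ‖m x y‖ ≤ C * ‖y‖) (v : Lp E 2 μ) :
    pointwiseOp m C hm hb v =ᵐ[μ] fun x => m x (v x) :=
  MemLp.coeFn_toLp ((Lp.memLp v).of_le_mul (hm _ (Lp.aestronglyMeasurable v))
    (Eventually.of_forall fun x => hb x _))

end Pointwise

/-! ### The form as a bounded operator -/

section FormSpace

variable {N : ℕ} {α β b c lam : ℝ}

/-- Values of the pair `(√(1+|x|^α) ∇u, w u)`. -/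
abbrev PairVal (N : ℕ) : Type := WithLp 2 (EuclideanSpace ℂ (Fin N) × ℂ)

/-- The weight of the gradient. -/
def gradWeight (α : ℝ) (x : RN N) : ℝ := Real.sqrt (1 + ‖x‖ ^ α)

/-- The weight of the function in the form norm. -/
def funWeight (α β : ℝ) (x : RN N) : ℝ := Real.sqrt (1 + ‖x‖ ^ (α - 2) + ‖x‖ ^ β)

theorem one_le_gradWeight (x : RN N) : 1 ≤ gradWeight α x :=
  Real.one_le_sqrt.2 (le_add_of_nonneg_right (by positivity))

theorem one_le_funWeight (x : RN N) : 1 ≤ funWeight α β x := by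
  refine Real.one_le_sqrt.2 ?_
  have h1 : 0 ≤ ‖x‖ ^ (α - 2) := by positivity
  have h2 : 0 ≤ ‖x‖ ^ β := by positivity
  linarith

theorem sq_gradWeight (x : RN N) : gradWeight α x ^ 2 = 1 + ‖x‖ ^ α :=
  Real.sq_sqrt (by positivity)

theorem sq_funWeight (x : RN N) : funWeight α β x ^ 2 = 1 + ‖x‖ ^ (α - 2) + ‖x‖ ^ β :=
  Real.sq_sqrt (by positivity)

theorem measurable_gradWeight : Measurable (gradWeight α : RN N → ℝ) := by
  unfold gradWeight; fun_prop

theorem measurable_funWeight : Measurable (funWeight α β : RN N → ℝ) := by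
  unfold funWeight; fun_prop

/-- The square of the left side is `|x|^α |x|^{α-2}`, one factor for each squared weight. This
bounds the drift term of the form by the form norm. -/
theorem norm_rpow_mul_le (x : RN N) (hx : x ≠ 0) :
    ‖x‖ ^ (α - 2) * ‖x‖ ≤ gradWeight α x * funWeight α β x := by
  have hp : 0 < ‖x‖ := norm_pos_iff.2 hx
  rw [gradWeight, funWeight, ← Real.sqrt_mul (by positivity)]
  refine Real.le_sqrt_of_sq_le ?_
  have h0 : ‖x‖ ^ α = ‖x‖ ^ (α - 2) * ‖x‖ ^ 2 := by
    rw [← Real.rpow_natCast, ← Real.rpow_add hp]; norm_num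
  have h1 : 0 ≤ ‖x‖ ^ (α - 2) := by positivity
  have h2 : 0 ≤ ‖x‖ ^ β := by positivity
  have h3 : 0 ≤ ‖x‖ ^ α := by positivity
  calc (‖x‖ ^ (α - 2) * ‖x‖) ^ 2 = ‖x‖ ^ α * ‖x‖ ^ (α - 2) := by rw [h0]; ring
    _ ≤ (1 + ‖x‖ ^ α) * (1 + ‖x‖ ^ (α - 2) + ‖x‖ ^ β) := by gcongr <;> linarith

/-- The fibre maps of the embedding of the form space into `L²`. -/
def embFiber (α β : ℝ) (x : RN N) : PairVal N →ₗ[ℂ] ℂ where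
  toFun y := ((funWeight α β x)⁻¹ : ℝ) * y.snd
  map_add' y z := by simp [mul_add]
  map_smul' a y := by simp; ring

/-- The fibre maps of the operator representing the form. -/
def formFiber (α β b c lam : ℝ) (x : RN N) : PairVal N →ₗ[ℂ] PairVal N where
  toFun y := WithLp.toLp 2 (y.fst,
    (((α - b) * ‖x‖ ^ (α - 2) * (gradWeight α x)⁻¹ * (funWeight α β x)⁻¹ : ℝ) : ℂ) *
      ∑ i, ((x i : ℝ) : ℂ) * y.fst i +
    (((c * ‖x‖ ^ (α - 2) + ‖x‖ ^ β + lam) * (funWeight α β x ^ 2)⁻¹ : ℝ) : ℂ) * y.snd)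
  map_add' y z := by
    refine (WithLp.equiv 2 _).injective (Prod.ext rfl ?_)
    simp [mul_add, Finset.sum_add_distrib]
    ring
  map_smul' a y := by
    refine (WithLp.equiv 2 _).injective (Prod.ext rfl ?_)
    simp [mul_add, Finset.mul_sum]
    congr 1
    · exact Finset.sum_congr rfl fun i _ => by ring
    · ring

theorem norm_embFiber_le (x : RN N) (y : PairVal N) : ‖embFiber α β x y‖ ≤ 1 * ‖y‖ := by
  have h : ‖((funWeight α β x)⁻¹ : ℝ)‖ ≤ 1 := by
    rw [norm_inv, Real.norm_of_nonneg (zero_le_one.trans (one_le_funWeight x))]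
    exact inv_le_one_of_one_le₀ (one_le_funWeight x)
  calc ‖embFiber α β x y‖ = ‖((funWeight α β x)⁻¹ : ℝ)‖ * ‖y.snd‖ := by
        simp [embFiber]
    _ ≤ 1 * ‖y‖ := mul_le_mul h (WithLp.norm_snd_le _ _) (norm_nonneg _) zero_le_one

theorem norm_formFiber_le (hc : 0 ≤ c) (hlam : 0 ≤ lam) (x : RN N) (y : PairVal N) :
    ‖formFiber α β b c lam x y‖ ≤ (1 + |α - b| + (c + 1 + lam)) * ‖y‖ := by
  have hw1 := one_le_gradWeight (α := α) x
  have hw0 := one_le_funWeight (α := α) (β := β) x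
  have h1 : 0 ≤ ‖x‖ ^ (α - 2) := by positivity
  have h2 : 0 ≤ ‖x‖ ^ β := by positivity
  have hf : ‖y.fst‖ ≤ ‖y‖ := WithLp.norm_fst_le _ _
  have hs : ‖y.snd‖ ≤ ‖y‖ := WithLp.norm_snd_le _ _
  have hA : ‖(((α - b) * ‖x‖ ^ (α - 2) * (gradWeight α x)⁻¹ * (funWeight α β x)⁻¹ : ℝ) : ℂ) *
      ∑ i, ((x i : ℝ) : ℂ) * y.fst i‖ ≤ |α - b| * ‖y‖ := by
    by_cases hx : x = 0
    · subst hx; simp; positivity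
    have hr := norm_radial_le (fun _ => y.fst) x
    have hk := norm_rpow_mul_le (α := α) (β := β) x hx
    rw [norm_mul, Complex.norm_real, Real.norm_eq_abs, abs_mul, abs_mul, abs_mul,
      abs_of_nonneg h1, abs_of_nonneg (inv_nonneg.2 (zero_le_one.trans hw1)),
      abs_of_nonneg (inv_nonneg.2 (zero_le_one.trans hw0))]
    calc |α - b| * ‖x‖ ^ (α - 2) * (gradWeight α x)⁻¹ * (funWeight α β x)⁻¹ *
          ‖∑ i, ((x i : ℝ) : ℂ) * y.fst i‖
        ≤ |α - b| * ‖x‖ ^ (α - 2) * (gradWeight α x)⁻¹ * (funWeight α β x)⁻¹ *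
          (‖x‖ * ‖y.fst‖) := by gcongr; exact hr
      _ = |α - b| * ((‖x‖ ^ (α - 2) * ‖x‖) * ((gradWeight α x) * (funWeight α β x))⁻¹) *
          ‖y.fst‖ := by rw [mul_inv]; ring
      _ ≤ |α - b| * 1 * ‖y‖ := by
          gcongr
          rw [← div_eq_mul_inv]
          exact div_le_one_of_le₀ hk (by positivity)
      _ = _ := by ring
  have hB : ‖(((c * ‖x‖ ^ (α - 2) + ‖x‖ ^ β + lam) * (funWeight α β x ^ 2)⁻¹ : ℝ) : ℂ) * y.snd‖ ≤
      (c + 1 + lam) * ‖y‖ := by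
    rw [norm_mul, Complex.norm_real, Real.norm_of_nonneg (by positivity)]
    refine mul_le_mul ?_ hs (norm_nonneg _) (by positivity)
    rw [← div_eq_mul_inv, sq_funWeight, div_le_iff₀ (by positivity)]
    nlinarith [mul_nonneg hlam h1, mul_nonneg hlam h2, mul_nonneg hc h2, mul_nonneg hc h1]
  have hC : ‖formFiber α β b c lam x y‖ ≤ ‖y.fst‖ + ‖(formFiber α β b c lam x y).snd‖ := by
    have h3 := WithLp.prod_norm_sq_eq_of_L2 (formFiber α β b c lam x y)
    have h4 : (formFiber α β b c lam x y).fst = y.fst := rfl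
    rw [h4] at h3
    refine abs_le_of_sq_le_sq' ?_ (by positivity) |>.2
    rw [h3]
    nlinarith [norm_nonneg y.fst, norm_nonneg (formFiber α β b c lam x y).snd]
  have hD : ‖(formFiber α β b c lam x y).snd‖ ≤ |α - b| * ‖y‖ + (c + 1 + lam) * ‖y‖ :=
    (norm_add_le _ _).trans (add_le_add hA hB)
  linarith

theorem aestronglyMeasurable_embFiber (v : RN N → PairVal N) (hv : AEStronglyMeasurable v volume) :
    AEStronglyMeasurable (fun x => embFiber α β x (v x)) volume :=
  AEStronglyMeasurable.mul
    (Complex.measurable_ofReal.comp measurable_funWeight.inv).aestronglyMeasurable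
    ((WithLp.continuous_snd 2 _ _).comp_aestronglyMeasurable hv)

theorem aestronglyMeasurable_formFiber (v : RN N → PairVal N)
    (hv : AEStronglyMeasurable v volume) :
    AEStronglyMeasurable (fun x => formFiber α β b c lam x (v x)) volume := by
  have h1 : AEStronglyMeasurable (fun x => (v x).fst) volume :=
    (WithLp.continuous_fst 2 _ _).comp_aestronglyMeasurable hv
  have h2 : AEStronglyMeasurable (fun x => (v x).snd) volume :=
    (WithLp.continuous_snd 2 _ _).comp_aestronglyMeasurable hv
  refine (WithLp.prod_continuous_toLp 2 _ _).comp_aestronglyMeasurable (h1.prodMk ?_)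
  refine AEStronglyMeasurable.add (AEStronglyMeasurable.mul ?_ (aestronglyMeasurable_radial h1))
    (AEStronglyMeasurable.mul ?_ h2)
  · have := measurable_gradWeight (N := N) (α := α)
    have := measurable_funWeight (N := N) (α := α) (β := β)
    exact Measurable.aestronglyMeasurable (by fun_prop)
  · have := measurable_funWeight (N := N) (α := α) (β := β)
    exact Measurable.aestronglyMeasurable (by fun_prop)

/-- The embedding of the weighted pairs into `L²`. -/
def pairEmb (α β : ℝ) : Lp (α := RN N) (PairVal N) 2 volume →L[ℂ] LpRN N 2 :=
  pointwiseOp (embFiber α β) 1 aestronglyMeasurable_embFiber norm_embFiber_le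

/-- The operator representing the form on weighted pairs. -/
def pairForm (α β b c lam : ℝ) (hc : 0 ≤ c) (hlam : 0 ≤ lam) :
    Lp (α := RN N) (PairVal N) 2 volume →L[ℂ] Lp (α := RN N) (PairVal N) 2 volume :=
  pointwiseOp (formFiber α β b c lam) _ aestronglyMeasurable_formFiber (norm_formFiber_le hc hlam)

/-- The weighted pair attached to a test function in direction `i`. -/
def testPair (α β : ℝ) (φ : RN N → ℝ) (i : Fin N) (x : RN N) : PairVal N :=
  WithLp.toLp 2 (EuclideanSpace.single i ((((gradWeight α x)⁻¹ * φ x : ℝ)) : ℂ),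
    (((funWeight α β x)⁻¹ * fderiv ℝ φ x (EuclideanSpace.single i 1) : ℝ) : ℂ))

/-- Weighted pairs `(√(1+|x|^α) ∇u, w u)`: the orthogonal complement of the test pairs. -/
def formSpace (N : ℕ) (α β : ℝ) : Submodule ℂ (Lp (α := RN N) (PairVal N) 2 volume) :=
  (Submodule.span ℂ {t | ∃ φ : RN N → ℝ, ContDiff ℝ ∞ φ ∧ HasCompactSupport φ ∧
    ∃ i, t =ᵐ[volume] testPair α β φ i})ᗮ

theorem memLp_testPair {φ : RN N → ℝ} (hφ : ContDiff ℝ ∞ φ) (hc : HasCompactSupport φ)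
    (i : Fin N) : MemLp (testPair α β φ i) 2 volume := by
  have hd : Continuous fun x => fderiv ℝ φ x (EuclideanSpace.single i 1) :=
    (hφ.continuous_fderiv (by simp)).clm_apply continuous_const
  have h1 : MemLp φ 2 volume := hφ.continuous.memLp_of_hasCompactSupport hc
  have h2 : MemLp (fun x => fderiv ℝ φ x (EuclideanSpace.single i 1)) 2 volume :=
    hd.memLp_of_hasCompactSupport (hc.fderiv_apply (𝕜 := ℝ) _)
  have h3 : MemLp (fun x => ‖φ x‖ + ‖fderiv ℝ φ x (EuclideanSpace.single i 1)‖) 2 volume :=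
    h1.norm.add h2.norm
  have hw1 : ∀ x : RN N, (gradWeight α x)⁻¹ ≤ 1 := fun x =>
    inv_le_one_of_one_le₀ (one_le_gradWeight x)
  have hw0 : ∀ x : RN N, (funWeight α β x)⁻¹ ≤ 1 := fun x =>
    inv_le_one_of_one_le₀ (one_le_funWeight x)
  have hw1' : ∀ x : RN N, 0 ≤ (gradWeight α x)⁻¹ := fun x => inv_nonneg.2 (Real.sqrt_nonneg _)
  have hw0' : ∀ x : RN N, 0 ≤ (funWeight α β x)⁻¹ := fun x => inv_nonneg.2 (Real.sqrt_nonneg _)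
  refine h3.of_le ?_ (Eventually.of_forall fun x => ?_)
  · have hm1 := measurable_gradWeight (N := N) (α := α)
    have hm2 := measurable_funWeight (N := N) (α := α) (β := β)
    refine (WithLp.prod_continuous_toLp 2 _ _).comp_aestronglyMeasurable
      (AEStronglyMeasurable.prodMk ?_ ?_)
    · have hs : Continuous fun z : ℂ => EuclideanSpace.single (𝕜 := ℂ) i z :=
        (PiLp.continuous_toLp 2 _).comp (continuous_single (A := fun _ : Fin N => ℂ) i)
      exact hs.comp_aestronglyMeasurable (Measurable.aestronglyMeasurable
        (Complex.measurable_ofReal.comp (hm1.inv.mul hφ.continuous.measurable)))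
    · exact Measurable.aestronglyMeasurable
        (Complex.measurable_ofReal.comp (hm2.inv.mul hd.measurable))
  · have h4 : ‖testPair α β φ i x‖ ^ 2 =
        ((gradWeight α x)⁻¹ * φ x) ^ 2 + ((funWeight α β x)⁻¹ *
          fderiv ℝ φ x (EuclideanSpace.single i 1)) ^ 2 := by
      rw [WithLp.prod_norm_sq_eq_of_L2]
      simp only [testPair, WithLp.toLp_fst, WithLp.toLp_snd, PiLp.norm_single,
        Complex.norm_real, Real.norm_eq_abs, sq_abs]
    refine (abs_le_of_sq_le_sq' ?_ (norm_nonneg _)).2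
    rw [h4, Real.norm_of_nonneg (by positivity), add_sq, mul_pow, mul_pow, Real.norm_eq_abs,
      Real.norm_eq_abs, sq_abs, sq_abs]
    have e1 : ((gradWeight α x)⁻¹) ^ 2 ≤ 1 := pow_le_one₀ (hw1' x) (hw1 x)
    have e2 : ((funWeight α β x)⁻¹) ^ 2 ≤ 1 := pow_le_one₀ (hw0' x) (hw0 x)
    have e3 : 0 ≤ 2 * |φ x| * |fderiv ℝ φ x (EuclideanSpace.single i 1)| := by positivity
    nlinarith [sq_nonneg (φ x), sq_nonneg (fderiv ℝ φ x (EuclideanSpace.single i 1))]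

end FormSpace

/-! ### Identification of the form space with the form domain -/

section FormSpace

variable {N : ℕ} {α β b c lam : ℝ}

/-- For the function `u` and gradient `G` encoded in `v`, the weights cancel and the condition reads
`∫ G_i φ + u ∂_i φ = 0`: it says that `G` is the weak gradient of `u`. -/
theorem mem_formSpace_iff {v : Lp (α := RN N) (PairVal N) 2 volume} :
    v ∈ formSpace N α β ↔ ∀ φ : RN N → ℝ, ContDiff ℝ ∞ φ → HasCompactSupport φ → ∀ i,
      ∫ x, inner ℂ (testPair α β φ i x) (v x) = 0 := by
  rw [formSpace, Submodule.mem_orthogonal]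
  constructor
  · intro h φ hφ hc i
    have h1 := h ((memLp_testPair hφ hc i).toLp _)
      (Submodule.subset_span ⟨φ, hφ, hc, i, MemLp.coeFn_toLp _⟩)
    rw [L2.inner_def] at h1
    rw [← h1]
    refine integral_congr_ae ?_
    filter_upwards [(memLp_testPair (α := α) (β := β) hφ hc i).coeFn_toLp] with x hx
    rw [hx]
  · intro h t ht
    induction ht using Submodule.span_induction with
    | mem t ht =>
      obtain ⟨φ, hφ, hc, i, ht⟩ := ht
      rw [L2.inner_def, ← h φ hφ hc i]
      exact integral_congr_ae (ht.mono fun x hx => by simp only [hx])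
    | zero => simp
    | add x y _ _ hx hy => rw [inner_add_left, hx, hy, add_zero]
    | smul a x _ hx => rw [inner_smul_left, hx, mul_zero]

theorem inner_testPair (φ : RN N → ℝ) (i : Fin N) (x : RN N) (y : PairVal N) :
    inner ℂ (testPair α β φ i x) y =
      (((gradWeight α x)⁻¹ : ℝ) : ℂ) * y.fst i * ((φ x : ℝ) : ℂ) +
      (((funWeight α β x)⁻¹ : ℝ) : ℂ) * y.snd *
        ((fderiv ℝ φ x (EuclideanSpace.single i 1) : ℝ) : ℂ) := by
  rw [WithLp.prod_inner_apply]
  simp [testPair, EuclideanSpace.inner_single_left]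
  ring

/-- The gradient encoded in a weighted pair. -/
def pairGrad (α : ℝ) (v : RN N → PairVal N) (x : RN N) : EuclideanSpace ℂ (Fin N) :=
  (((gradWeight α x)⁻¹ : ℝ) : ℂ) • (v x).fst

/-- The function encoded in a weighted pair. -/
def pairFun (α β : ℝ) (v : RN N → PairVal N) (x : RN N) : ℂ :=
  (((funWeight α β x)⁻¹ : ℝ) : ℂ) * (v x).snd

theorem coeFn_pairEmb (v : Lp (α := RN N) (PairVal N) 2 volume) :
    pairEmb α β v =ᵐ[volume] pairFun α β v :=
  coeFn_pointwiseOp (embFiber α β) _ _ _ v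

theorem memLp_weight_smul {F : Type*} [NormedAddCommGroup F] [NormedSpace ℝ F] {g : RN N → F}
    (hg : MemLp g 2 volume) {m : RN N → ℝ} (hm : Measurable m) (hb : ∀ x, |m x| ≤ 1) :
    MemLp (fun x => m x • g x) 2 volume :=
  hg.of_le (hm.aestronglyMeasurable.smul hg.1) (Eventually.of_forall fun x => by
    rw [norm_smul]
    exact mul_le_of_le_one_left (norm_nonneg _) (hb x))

theorem MemLp.pair_fst {v : RN N → PairVal N} (hv : MemLp v 2 volume) :
    MemLp (fun x => (v x).fst) 2 volume :=
  hv.of_le ((WithLp.continuous_fst 2 _ _).comp_aestronglyMeasurable hv.1)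
    (Eventually.of_forall fun _ => WithLp.norm_fst_le _ _)

theorem MemLp.pair_snd {v : RN N → PairVal N} (hv : MemLp v 2 volume) :
    MemLp (fun x => (v x).snd) 2 volume :=
  hv.of_le ((WithLp.continuous_snd 2 _ _).comp_aestronglyMeasurable hv.1)
    (Eventually.of_forall fun _ => WithLp.norm_snd_le _ _)

theorem memLp_weight_pairFun {v : RN N → PairVal N} (hv : MemLp v 2 volume) {m : RN N → ℝ}
    (hm : Measurable m) (h0 : ∀ x, 0 ≤ m x) (hb : ∀ x, m x ≤ funWeight α β x) :
    MemLp (fun x => m x • pairFun α β v x) 2 volume := by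
  have h1 : MemLp (fun x => (m x * (funWeight α β x)⁻¹) • (v x).snd) 2 volume :=
    memLp_weight_smul (MemLp.pair_snd hv) (hm.mul measurable_funWeight.inv) fun x => by
      have h2 : 0 ≤ funWeight α β x := Real.sqrt_nonneg _
      rw [abs_of_nonneg (mul_nonneg (h0 x) (inv_nonneg.2 h2)), ← div_eq_mul_inv]
      exact div_le_one_of_le₀ (hb x) h2
  refine h1.ae_eq (Eventually.of_forall fun x => ?_)
  simp only [pairFun, Complex.real_smul, Complex.ofReal_mul]
  ring

theorem memLp_weight_pairGrad {v : RN N → PairVal N} (hv : MemLp v 2 volume) {m : RN N → ℝ}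
    (hm : Measurable m) (h0 : ∀ x, 0 ≤ m x) (hb : ∀ x, m x ≤ gradWeight α x) :
    MemLp (fun x => m x • pairGrad α v x) 2 volume := by
  have h1 : MemLp (fun x => (m x * (gradWeight α x)⁻¹) • (v x).fst) 2 volume :=
    memLp_weight_smul (MemLp.pair_fst hv) (hm.mul measurable_gradWeight.inv) fun x => by
      have h2 : 0 ≤ gradWeight α x := Real.sqrt_nonneg _
      rw [abs_of_nonneg (mul_nonneg (h0 x) (inv_nonneg.2 h2)), ← div_eq_mul_inv]
      exact div_le_one_of_le₀ (hb x) h2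
  refine h1.ae_eq (Eventually.of_forall fun x => ?_)
  simp only [pairGrad]
  rw [mul_smul, Complex.coe_smul]

theorem sqrt_le_funWeight_sing (x : RN N) : Real.sqrt (‖x‖ ^ (α - 2)) ≤ funWeight α β x :=
  Real.sqrt_le_sqrt (by
    have : 0 ≤ ‖x‖ ^ β := by positivity
    linarith)

theorem sqrt_le_funWeight_pot (x : RN N) : Real.sqrt (‖x‖ ^ β) ≤ funWeight α β x :=
  Real.sqrt_le_sqrt (by
    have : 0 ≤ ‖x‖ ^ (α - 2) := by positivity
    linarith)

theorem isFormPair_of_mem_formSpace {v : Lp (α := RN N) (PairVal N) 2 volume}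
    (hv : v ∈ formSpace N α β) : IsFormPair α β (pairFun α β v) (pairGrad α v) := by
  have hm := Lp.memLp v
  have hu : MemLp (pairFun α β v) 2 volume := by
    simpa using memLp_weight_pairFun (α := α) (β := β) hm (m := fun _ => 1) measurable_const
      (fun _ => zero_le_one) one_le_funWeight
  have hG : MemLp (pairGrad α v) 2 volume := by
    simpa using memLp_weight_pairGrad (α := α) hm (m := fun _ => 1) measurable_const
      (fun _ => zero_le_one) one_le_gradWeight
  refine ⟨⟨hu.locallyIntegrable one_le_two, hG.locallyIntegrable one_le_two, fun φ hφ hc i => ?_⟩,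
    hu, hG, memLp_weight_pairGrad hm measurable_gradWeight (fun x => Real.sqrt_nonneg _)
      (fun x => le_refl _),
    memLp_weight_pairFun hm (by fun_prop) (fun x => Real.sqrt_nonneg _) sqrt_le_funWeight_sing,
    memLp_weight_pairFun hm (by fun_prop) (fun x => Real.sqrt_nonneg _) sqrt_le_funWeight_pot⟩
  have h1 := mem_formSpace_iff.1 hv φ hφ hc i
  simp only [inner_testPair] at h1
  have hφ2 : MemLp (fun x => ((φ x : ℝ) : ℂ)) 2 volume :=
    (Complex.continuous_ofReal.comp hφ.continuous).memLp_of_hasCompactSupport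
      (hc.comp_left Complex.ofReal_zero)
  have hd2 : MemLp (fun x => ((fderiv ℝ φ x (EuclideanSpace.single i 1) : ℝ) : ℂ)) 2 volume :=
    (continuous_fderiv_ofReal_apply hφ _).memLp_of_hasCompactSupport
      (hasCompactSupport_fderiv_ofReal_apply hc _)
  have hi1 : Integrable (fun x => pairGrad α v x i * ((φ x : ℝ) : ℂ)) volume :=
    (MemLp.coord hG i).integrable_mul hφ2
  have hi2 : Integrable (fun x => pairFun α β v x *
      ((fderiv ℝ φ x (EuclideanSpace.single i 1) : ℝ) : ℂ)) volume := hu.integrable_mul hd2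
  have h2 := integral_add hi1 hi2
  have h3 : ∫ x, (pairGrad α v x i * ((φ x : ℝ) : ℂ) + pairFun α β v x *
      ((fderiv ℝ φ x (EuclideanSpace.single i 1) : ℝ) : ℂ)) = 0 := by
    rw [← h1]
    rfl
  rw [h3] at h2
  exact eq_neg_of_add_eq_zero_right h2.symm

theorem pairEmb_mem_formDomain {v : Lp (α := RN N) (PairVal N) 2 volume}
    (hv : v ∈ formSpace N α β) : pairEmb α β v ∈ formDomain N α β :=
  ((isFormPair_of_mem_formSpace hv).congr_ae (coeFn_pairEmb v).symm (ae_eq_refl _)).mem_formDomain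

/-- The weights `gradWeight` and `funWeight` are square roots of sums of the weights in the form
domain, so membership there is square integrability of the weighted pair. -/
theorem IsFormPair.exists_mem_formSpace {u : RN N → ℂ} {G : RN N → EuclideanSpace ℂ (Fin N)}
    (h : IsFormPair α β u G) : ∃ v ∈ formSpace N α β, pairEmb α β v =ᵐ[volume] u := by
  set V : RN N → PairVal N := fun x =>
    WithLp.toLp 2 (gradWeight α x • G x, ((funWeight α β x : ℝ) : ℂ) * u x) with hV
  have hm0 := measurable_funWeight (N := N) (α := α) (β := β)
  have h2 : MemLp (fun x => ((funWeight α β x : ℝ) : ℂ) * u x) 2 volume := by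
    refine ((h.mem.norm.add h.mem_sing.norm).add h.mem_pot.norm).of_le
      ((Complex.measurable_ofReal.comp hm0).aestronglyMeasurable.mul h.mem.1)
      (Eventually.of_forall fun x => ?_)
    simp only [Pi.add_apply]
    rw [Real.norm_of_nonneg (by positivity), norm_mul, Complex.norm_real, norm_smul, norm_smul,
      Real.norm_of_nonneg (Real.sqrt_nonneg _), Real.norm_of_nonneg (Real.sqrt_nonneg _),
      Real.norm_of_nonneg (zero_le_one.trans (one_le_funWeight x)), ← one_add_mul, ← add_mul]
    refine mul_le_mul_of_nonneg_right ?_ (norm_nonneg _)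
    refine Real.sqrt_le_iff.2 ⟨by positivity, ?_⟩
    have e1 := Real.sq_sqrt (by positivity : 0 ≤ ‖x‖ ^ (α - 2))
    have e2 := Real.sq_sqrt (by positivity : 0 ≤ ‖x‖ ^ β)
    have e3 := Real.sqrt_nonneg (‖x‖ ^ (α - 2))
    have e4 := Real.sqrt_nonneg (‖x‖ ^ β)
    nlinarith [mul_nonneg e3 e4]
  have hVm : MemLp V 2 volume := by
    refine (h.mem_wgrad.norm.add h2.norm).of_le
      ((WithLp.prod_continuous_toLp 2 _ _).comp_aestronglyMeasurable
        (h.mem_wgrad.1.prodMk h2.1)) (Eventually.of_forall fun x => ?_)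
    have e1 := WithLp.prod_norm_sq_eq_of_L2 (V x)
    have e2 : (V x).fst = Real.sqrt (1 + ‖x‖ ^ α) • G x := rfl
    have e3 : (V x).snd = ((funWeight α β x : ℝ) : ℂ) * u x := rfl
    rw [e2, e3] at e1
    simp only [Pi.add_apply]
    rw [Real.norm_of_nonneg (by positivity)]
    refine (abs_le_of_sq_le_sq' ?_ (by positivity)).2
    rw [e1]
    nlinarith [norm_nonneg (Real.sqrt (1 + ‖x‖ ^ α) • G x),
      norm_nonneg (((funWeight α β x : ℝ) : ℂ) * u x)]
  have hfun : ∀ x, pairFun α β V x = u x := fun x => by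
    have : ((funWeight α β x : ℝ) : ℂ) ≠ 0 :=
      Complex.ofReal_ne_zero.2 (zero_lt_one.trans_le (one_le_funWeight x)).ne'
    change (((funWeight α β x)⁻¹ : ℝ) : ℂ) * (((funWeight α β x : ℝ) : ℂ) * u x) = u x
    rw [Complex.ofReal_inv, inv_mul_cancel_left₀ this]
  have hgrad : ∀ x, pairGrad α V x = G x := fun x => by
    have : gradWeight α x ≠ 0 := (zero_lt_one.trans_le (one_le_gradWeight x)).ne'
    change (((gradWeight α x)⁻¹ : ℝ) : ℂ) • (gradWeight α x • G x) = G x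
    rw [Complex.coe_smul, inv_smul_smul₀ this]
  refine ⟨hVm.toLp V, mem_formSpace_iff.2 fun φ hφ hc i => ?_, ?_⟩
  · have hφ2 : MemLp (fun x => ((φ x : ℝ) : ℂ)) 2 volume :=
      (Complex.continuous_ofReal.comp hφ.continuous).memLp_of_hasCompactSupport
        (hc.comp_left Complex.ofReal_zero)
    have hd2 : MemLp (fun x => ((fderiv ℝ φ x (EuclideanSpace.single i 1) : ℝ) : ℂ)) 2 volume :=
      (continuous_fderiv_ofReal_apply hφ _).memLp_of_hasCompactSupport
        (hasCompactSupport_fderiv_ofReal_apply hc _)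
    have hi1 : Integrable (fun x => G x i * ((φ x : ℝ) : ℂ)) volume :=
      (MemLp.coord h.mem_grad i).integrable_mul hφ2
    have hi2 : Integrable (fun x => u x *
        ((fderiv ℝ φ x (EuclideanSpace.single i 1) : ℝ) : ℂ)) volume := h.mem.integrable_mul hd2
    have h3 : ∫ x, inner ℂ (testPair α β φ i x) (hVm.toLp V x) =
        ∫ x, (G x i * ((φ x : ℝ) : ℂ) + u x *
          ((fderiv ℝ φ x (EuclideanSpace.single i 1) : ℝ) : ℂ)) := by
      refine integral_congr_ae ?_
      filter_upwards [hVm.coeFn_toLp] with x hx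
      rw [hx, inner_testPair, ← hfun x, ← hgrad x]
      rfl
    rw [h3, integral_add hi1 hi2, h.weak.integral_eq φ hφ hc i]
    ring
  · filter_upwards [coeFn_pairEmb (α := α) (β := β) (hVm.toLp V), hVm.coeFn_toLp] with x e1 e2
    rw [e1, ← hfun x]
    simp only [pairFun, e2]

/-- `formFiber` is the matrix of the form density in the coordinates where the form norm becomes the
plain `L²` norm. -/
theorem inner_formFiber (x : RN N) (h v : PairVal N) :
    inner ℂ h (formFiber α β b c lam x v) =
      formDensity α β b c lam x ((((funWeight α β x)⁻¹ : ℝ) : ℂ) * v.snd)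
        ((((gradWeight α x)⁻¹ : ℝ) : ℂ) • v.fst)
        ((((funWeight α β x)⁻¹ : ℝ) : ℂ) * h.snd)
        ((((gradWeight α x)⁻¹ : ℝ) : ℂ) • h.fst) := by
  have h1 : (gradWeight α x : ℂ) ≠ 0 :=
    Complex.ofReal_ne_zero.2 (zero_lt_one.trans_le (one_le_gradWeight x)).ne'
  have h0 : (funWeight α β x : ℂ) ≠ 0 :=
    Complex.ofReal_ne_zero.2 (zero_lt_one.trans_le (one_le_funWeight x)).ne'
  have e1 : inner ℂ h.fst v.fst = ∑ i, v.fst i * conj (h.fst i) := by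
    rw [PiLp.inner_apply]
    exact Finset.sum_congr rfl fun i _ => by simp
  have e2 : ∑ i, ((((gradWeight α x)⁻¹ : ℝ) : ℂ) • v.fst) i *
      conj (((((gradWeight α x)⁻¹ : ℝ) : ℂ) • h.fst) i) =
      ((gradWeight α x : ℂ) ^ 2)⁻¹ * ∑ i, v.fst i * conj (h.fst i) := by
    rw [Finset.mul_sum]
    refine Finset.sum_congr rfl fun i _ => ?_
    simp
    ring
  have e3 : ∑ i, ((x i : ℝ) : ℂ) * ((((gradWeight α x)⁻¹ : ℝ) : ℂ) • v.fst) i =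
      (gradWeight α x : ℂ)⁻¹ * ∑ i, ((x i : ℝ) : ℂ) * v.fst i := by
    rw [Finset.mul_sum]
    refine Finset.sum_congr rfl fun i _ => ?_
    simp
    ring
  have e4 : ((1 + ‖x‖ ^ α : ℝ) : ℂ) = (gradWeight α x : ℂ) ^ 2 := by
    rw [← sq_gradWeight]; push_cast; rfl
  have e5 : inner ℂ h (formFiber α β b c lam x v) = inner ℂ h.fst v.fst + inner ℂ h.snd
      ((((α - b) * ‖x‖ ^ (α - 2) * (gradWeight α x)⁻¹ * (funWeight α β x)⁻¹ : ℝ) : ℂ) *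
        ∑ i, ((x i : ℝ) : ℂ) * v.fst i +
      (((c * ‖x‖ ^ (α - 2) + ‖x‖ ^ β + lam) * (funWeight α β x ^ 2)⁻¹ : ℝ) : ℂ) * v.snd) :=
    WithLp.prod_inner_apply _ _
  rw [e5, formDensity, e2, e3, e4, e1, mul_inv_cancel_left₀ (pow_ne_zero 2 h1)]
  simp only [RCLike.inner_apply, map_mul, Complex.conj_ofReal]
  push_cast
  ring

theorem inner_pairForm (hc : 0 ≤ c) (hlam : 0 ≤ lam)
    (h v : Lp (α := RN N) (PairVal N) 2 volume) :
    inner ℂ h (pairForm α β b c lam hc hlam v) =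
      ∫ x, formDensity α β b c lam x (pairFun α β v x) (pairGrad α v x) (pairFun α β h x)
        (pairGrad α h x) := by
  rw [L2.inner_def]
  refine integral_congr_ae ?_
  filter_upwards [coeFn_pointwiseOp (formFiber α β b c lam) _ aestronglyMeasurable_formFiber
    (norm_formFiber_le hc hlam) v] with x hx
  rw [pairForm, hx, inner_formFiber]
  rfl

theorem form_pairEmb (hc : 0 ≤ c) (hlam : 0 ≤ lam)
    {h v : Lp (α := RN N) (PairVal N) 2 volume} (hh : h ∈ formSpace N α β)
    (hv : v ∈ formSpace N α β) :
    form α β b c lam (pairEmb α β v) (pairEmb α β h) =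
      inner ℂ h (pairForm α β b c lam hc hlam v) := by
  rw [inner_pairForm]
  exact IsFormPair.form_eq (isFormPair_of_mem_formSpace hv).weak
    (isFormPair_of_mem_formSpace hh).weak (coeFn_pairEmb v) (coeFn_pairEmb h)

theorem exists_of_mem_formDomain {u : LpRN N 2} (hu : u ∈ formDomain N α β) :
    ∃ v ∈ formSpace N α β, pairEmb α β v = u := by
  obtain ⟨v, hv, hvu⟩ := (mem_formDomain_iff.1 hu).exists_mem_formSpace
  exact ⟨v, hv, Lp.ext hvu⟩

/-- An orthogonal complement is closed. This replaces a separate proof that the form is closed. -/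
instance : CompleteSpace (formSpace N α β) := by
  unfold formSpace; infer_instance

/-- The embedding of the form space. -/
def formEmb (N : ℕ) (α β : ℝ) : formSpace N α β →L[ℂ] LpRN N 2 :=
  pairEmb α β ∘L (formSpace N α β).subtypeL

/-- The operator on the form space representing the form. -/
def formOp (N : ℕ) (α β b c lam : ℝ) (hc : 0 ≤ c) (hlam : 0 ≤ lam) :
    formSpace N α β →L[ℂ] formSpace N α β :=
  (formSpace N α β).subtypeL.adjoint ∘L pairForm α β b c lam hc hlam ∘L
    (formSpace N α β).subtypeL

theorem inner_formOp (hc : 0 ≤ c) (hlam : 0 ≤ lam) (h v : formSpace N α β) :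
    inner ℂ h (formOp N α β b c lam hc hlam v) =
      inner ℂ (h : Lp (α := RN N) (PairVal N) 2 volume)
        (pairForm α β b c lam hc hlam v) := by
  simp only [formOp, ContinuousLinearMap.comp_apply, ContinuousLinearMap.adjoint_inner_right]
  rfl

/-- `formEmb` maps the form space onto the form domain and intertwines the two forms, so abstract
results on `formOp` apply to the operator of the theorem. -/
theorem abstractGraph_eq (hc : 0 ≤ c) (hlam : 0 ≤ lam) :
    abstractGraph (formEmb N α β) (formOp N α β b c lam hc hlam) =
      formOperatorGraph N α β b c lam := by
  ext w
  constructor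
  · rintro ⟨v, hv, h⟩
    have hv' : pairEmb α β (v : Lp (α := RN N) (PairVal N) 2 volume) = w.1 := hv
    refine ⟨hv' ▸ pairEmb_mem_formDomain v.2, fun g hg => ?_⟩
    obtain ⟨g', hg', rfl⟩ := exists_of_mem_formDomain hg
    rw [← hv', form_pairEmb hc hlam hg' v.2]
    exact (inner_formOp hc hlam ⟨g', hg'⟩ v).symm.trans (h ⟨g', hg'⟩)
  · rintro ⟨h1, h2⟩
    obtain ⟨v, hv, hvw⟩ := exists_of_mem_formDomain h1
    refine ⟨⟨v, hv⟩, hvw, fun h => ?_⟩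
    rw [inner_formOp, ← form_pairEmb hc hlam h.2 hv]
    have h3 := h2 _ (pairEmb_mem_formDomain h.2)
    rw [← hvw] at h3
    exact h3

end FormSpace

/-! ### Coercivity and sectoriality of the form -/

section Coercive

variable {N : ℕ} {α β b c lam : ℝ} {u v : RN N → ℂ} {G H : RN N → EuclideanSpace ℂ (Fin N)}

theorem IsFormPair.exists_pair (h : IsFormPair α β u G) :
    ∃ w ∈ formSpace N α β, pairFun α β w =ᵐ[volume] u ∧ pairGrad α w =ᵐ[volume] G := by
  obtain ⟨w, hw, hwu⟩ := h.exists_mem_formSpace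
  have h1 := (coeFn_pairEmb w).symm.trans hwu
  have h2 := (isFormPair_of_mem_formSpace hw).weak.congr_ae h1 (ae_eq_refl _)
  exact ⟨w, hw, h1, h2.ae_eq h.weak⟩

theorem IsFormPair.integrable_formDensity (hc : 0 ≤ c) (hlam : 0 ≤ lam)
    (hu : IsFormPair α β u G) (hv : IsFormPair α β v H) :
    Integrable (fun x => formDensity α β b c lam x (u x) (G x) (v x) (H x)) volume := by
  obtain ⟨w, -, h1, h2⟩ := hu.exists_pair
  obtain ⟨z, -, h3, h4⟩ := hv.exists_pair
  refine (L2.integrable_inner (𝕜 := ℂ) z (pairForm α β b c lam hc hlam w)).congr ?_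
  filter_upwards [coeFn_pointwiseOp (formFiber α β b c lam) _ aestronglyMeasurable_formFiber
    (norm_formFiber_le hc hlam) w, h1, h2, h3, h4] with x hx e1 e2 e3 e4
  rw [pairForm, hx, inner_formFiber, ← e1, ← e2, ← e3, ← e4]
  rfl

theorem integrable_weight_mul_normSq {F : Type*} [NormedAddCommGroup F] [NormedSpace ℝ F]
    {g : RN N → F} {w : RN N → ℝ} (hw : ∀ x, 0 ≤ w x)
    (hg : MemLp (fun x => Real.sqrt (w x) • g x) 2 volume) :
    Integrable (fun x => w x * ‖g x‖ ^ 2) volume := by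
  refine ((memLp_two_iff_integrable_sq_norm hg.1).1 hg).congr (Eventually.of_forall fun x => ?_)
  simp only [norm_smul, mul_pow, Real.norm_eq_abs, sq_abs, Real.sq_sqrt (hw x)]

theorem IsFormPair.integrable_normSq (h : IsFormPair α β u G) :
    Integrable (fun x => ‖u x‖ ^ 2) volume := (memLp_two_iff_integrable_sq_norm h.mem.1).1 h.mem

theorem IsFormPair.integrable_grad (h : IsFormPair α β u G) :
    Integrable (fun x => ‖G x‖ ^ 2) volume :=
  (memLp_two_iff_integrable_sq_norm h.mem_grad.1).1 h.mem_grad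

theorem IsFormPair.integrable_wgrad (h : IsFormPair α β u G) :
    Integrable (fun x => ‖x‖ ^ α * ‖G x‖ ^ 2) volume := by
  refine ((integrable_weight_mul_normSq (fun x => by positivity) h.mem_wgrad).sub
    h.integrable_grad).congr (Eventually.of_forall fun x => ?_)
  simp only [Pi.sub_apply]
  ring

theorem IsFormPair.integrable_sing (h : IsFormPair α β u G) :
    Integrable (fun x => ‖x‖ ^ (α - 2) * ‖u x‖ ^ 2) volume :=
  integrable_weight_mul_normSq (fun x => by positivity) h.mem_sing

theorem IsFormPair.integrable_pot (h : IsFormPair α β u G) :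
    Integrable (fun x => ‖x‖ ^ β * ‖u x‖ ^ 2) volume :=
  integrable_weight_mul_normSq (fun x => by positivity) h.mem_pot

theorem drift_density_le (α : ℝ) (x : RN N) (u : RN N → ℂ) (G : RN N → EuclideanSpace ℂ (Fin N)) :
    ‖u x‖ * ‖radial G x‖ * ‖x‖ ^ (α - 2) ≤
      (‖x‖ ^ α * ‖G x‖ ^ 2 + ‖x‖ ^ (α - 2) * ‖u x‖ ^ 2) / 2 := by
  by_cases hx : x = 0
  · subst hx
    have : radial G 0 = 0 := by simp [radial]
    rw [this]
    simp only [norm_zero, mul_zero, zero_mul]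
    positivity
  have hp : 0 < ‖x‖ := norm_pos_iff.2 hx
  have h0 : ‖x‖ ^ α = ‖x‖ ^ (α - 2) * ‖x‖ ^ 2 := by
    rw [← Real.rpow_natCast, ← Real.rpow_add hp]; norm_num
  have h1 : 0 ≤ ‖x‖ ^ (α - 2) := by positivity
  calc ‖u x‖ * ‖radial G x‖ * ‖x‖ ^ (α - 2) ≤ ‖u x‖ * (‖x‖ * ‖G x‖) * ‖x‖ ^ (α - 2) := by
        gcongr; exact norm_radial_le G x
    _ ≤ _ := by
        rw [h0]
        nlinarith [mul_nonneg h1 (sq_nonneg (‖x‖ * ‖G x‖ - ‖u x‖))]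

theorem IsFormPair.integrable_drift (h : IsFormPair α β u G) :
    Integrable (fun x => ‖u x‖ * ‖radial G x‖ * ‖x‖ ^ (α - 2)) volume := by
  refine ((h.integrable_wgrad.add h.integrable_sing).div_const 2).mono' ?_
    (Eventually.of_forall fun x => ?_)
  · exact (h.mem.1.norm.mul (aestronglyMeasurable_radial h.mem_grad.1).norm).mul
      (Measurable.aestronglyMeasurable (by fun_prop))
  · rw [Real.norm_of_nonneg (by positivity)]
    exact drift_density_le α x u G

theorem IsFormPair.integrable_drift_re (h : IsFormPair α β u G) :
    Integrable (fun x => (conj (u x) * radial G x).re * ‖x‖ ^ (α - 2)) volume := by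
  refine h.integrable_drift.mono' ?_ (Eventually.of_forall fun x => ?_)
  · exact (Complex.continuous_re.comp_aestronglyMeasurable
      ((Complex.continuous_conj.comp_aestronglyMeasurable h.mem.1).mul
      (aestronglyMeasurable_radial h.mem_grad.1))).mul
      (Measurable.aestronglyMeasurable (by fun_prop))
  · rw [norm_mul, Real.norm_of_nonneg (by positivity : 0 ≤ ‖x‖ ^ (α - 2))]
    gcongr
    refine (Complex.abs_re_le_norm _).trans (le_of_eq ?_)
    rw [norm_mul, Complex.norm_conj]

theorem formDensity_self (x : RN N) (u : RN N → ℂ) (G : RN N → EuclideanSpace ℂ (Fin N)) :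
    formDensity α β b c lam x (u x) (G x) (u x) (G x) =
      ((‖G x‖ ^ 2 + ‖x‖ ^ α * ‖G x‖ ^ 2 + c * (‖x‖ ^ (α - 2) * ‖u x‖ ^ 2) + ‖x‖ ^ β * ‖u x‖ ^ 2
        + lam * ‖u x‖ ^ 2 : ℝ) : ℂ) +
      (((α - b) * ‖x‖ ^ (α - 2) : ℝ) : ℂ) * (conj (u x) * radial G x) := by
  have h1 : ∑ i, G x i * conj (G x i) = ((‖G x‖ ^ 2 : ℝ) : ℂ) := by
    rw [EuclideanSpace.norm_sq_eq]
    push_cast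
    exact Finset.sum_congr rfl fun i _ => Complex.mul_conj' _
  have h2 : u x * conj (u x) = ((‖u x‖ ^ 2 : ℝ) : ℂ) := by
    rw [Complex.mul_conj']; push_cast; rfl
  have h3 : formDensity α β b c lam x (u x) (G x) (u x) (G x) =
      ((1 + ‖x‖ ^ α : ℝ) : ℂ) * ∑ i, G x i * conj (G x i) +
      (((c * ‖x‖ ^ (α - 2)) + ‖x‖ ^ β + lam : ℝ) : ℂ) * (u x * conj (u x)) +
      (((α - b) * ‖x‖ ^ (α - 2) : ℝ) : ℂ) * (conj (u x) * radial G x) := by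
    simp only [formDensity, radial]
    push_cast
    ring
  rw [h3, h1, h2, ← Complex.ofReal_mul, ← Complex.ofReal_mul, ← Complex.ofReal_add]
  congr 2
  ring

/-- After the drift identity, half of `∫|∇u|²` is spent on Hardy's inequality. The summand `-1` in
the admissibility condition is what leaves one full copy of `∫|x|^{α-2}|u|²` on the left. -/
theorem IsFormPair.re_form_ge (hN : 3 ≤ N) (hα2 : α < 2) (hc : 0 ≤ c)
    (hlam : AdmissibleShift N α b c lam) (h : IsFormPair α β u G) :
    (∫ x, ‖G x‖ ^ 2) / 2 + (∫ x, ‖x‖ ^ α * ‖G x‖ ^ 2) + (∫ x, ‖x‖ ^ (α - 2) * ‖u x‖ ^ 2) +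
      (∫ x, ‖x‖ ^ β * ‖u x‖ ^ 2) ≤
      (∫ x, formDensity α β b c lam x (u x) (G x) (u x) (G x)).re := by
  have hint := h.integrable_formDensity (b := b) (c := c) (lam := lam) hc hlam.1.le h
  have h0 : (∫ x, formDensity α β b c lam x (u x) (G x) (u x) (G x)).re =
      ∫ x, (formDensity α β b c lam x (u x) (G x) (u x) (G x)).re := (integral_re hint).symm
  have h1 : ∫ x, (formDensity α β b c lam x (u x) (G x) (u x) (G x)).re =
      (∫ x, ‖G x‖ ^ 2) + (∫ x, ‖x‖ ^ α * ‖G x‖ ^ 2) + c * (∫ x, ‖x‖ ^ (α - 2) * ‖u x‖ ^ 2) +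
      (∫ x, ‖x‖ ^ β * ‖u x‖ ^ 2) + lam * (∫ x, ‖u x‖ ^ 2) +
      (α - b) * ∫ x, (conj (u x) * radial G x).re * ‖x‖ ^ (α - 2) := by
    rw [← integral_const_mul, ← integral_const_mul, ← integral_const_mul,
      ← integral_add h.integrable_grad h.integrable_wgrad,
      ← integral_add (h.integrable_grad.fun_add h.integrable_wgrad) (h.integrable_sing.const_mul c),
      ← integral_add ((h.integrable_grad.fun_add h.integrable_wgrad).fun_add
        (h.integrable_sing.const_mul c)) h.integrable_pot,
      ← integral_add (((h.integrable_grad.fun_add h.integrable_wgrad).fun_add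
        (h.integrable_sing.const_mul c)).fun_add h.integrable_pot) (h.integrable_normSq.const_mul lam),
      ← integral_add ((((h.integrable_grad.fun_add h.integrable_wgrad).fun_add
        (h.integrable_sing.const_mul c)).fun_add h.integrable_pot).fun_add
          (h.integrable_normSq.const_mul lam)) (h.integrable_drift_re.const_mul (α - b))]
    refine integral_congr_ae (Eventually.of_forall fun x => ?_)
    simp only [formDensity_self, Complex.add_re, Complex.ofReal_re, Complex.re_ofReal_mul]
    ring
  -- The exponent `s = (α-2)/2` is nonpositive since `α < 2`, and the field is `|x|^{α-2} x`.
  have h2 := h.weak.drift h.mem h.mem_grad (s := (α - 2) / 2) (by omega) (by linarith)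
    (by
      refine h.integrable_sing.congr (Eventually.of_forall fun x => ?_)
      simp only [mul_div_cancel₀ (α - 2) (two_ne_zero' ℝ)]; ring)
    (by
      refine h.integrable_drift.congr (Eventually.of_forall fun x => ?_)
      simp only [mul_div_cancel₀ (α - 2) (two_ne_zero' ℝ)])
  simp only [mul_div_cancel₀ (α - 2) (two_ne_zero' ℝ)] at h2
  obtain ⟨h3, h4⟩ := h.weak.hardy h.mem h.mem_grad hN
  -- The admissibility condition multiplied by `|u|²` and integrated. It is available only off the
  -- origin, a null set.
  have h5 : 0 ≤ (((N : ℝ) - 2) / 2) ^ 2 / 2 * (∫ x, ‖u x‖ ^ 2 / ‖x‖ ^ 2) +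
      (c - 1 - (α - b) / 2 * (α - 2 + N)) * (∫ x, ‖x‖ ^ (α - 2) * ‖u x‖ ^ 2) +
      lam * ∫ x, ‖u x‖ ^ 2 := by
    rw [← integral_const_mul, ← integral_const_mul, ← integral_const_mul,
      ← integral_add (h3.const_mul _) (h.integrable_sing.const_mul _),
      ← integral_add ((h3.const_mul _).fun_add (h.integrable_sing.const_mul _))
        (h.integrable_normSq.const_mul lam)]
    have : Nonempty (Fin N) := ⟨⟨0, by omega⟩⟩
    refine integral_nonneg_of_ae ?_
    filter_upwards [Measure.ae_ne volume (0 : RN N)] with x hx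
    have h6 := mul_nonneg (hlam.2 x hx).le (sq_nonneg ‖u x‖)
    simp only [Pi.zero_apply]
    refine h6.trans (le_of_eq ?_)
    ring
  have h7 : (∫ x, ‖u x‖ ^ 2 * ‖x‖ ^ (α - 2)) = ∫ x, ‖x‖ ^ (α - 2) * ‖u x‖ ^ 2 := by
    simp only [mul_comm]
  rw [h7] at h2
  rw [h0, h1]
  have h8 : (α - b) * ∫ x, (conj (u x) * radial G x).re * ‖x‖ ^ (α - 2) =
      -((α - b) / 2 * (α - 2 + N)) * ∫ x, ‖x‖ ^ (α - 2) * ‖u x‖ ^ 2 := by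
    linear_combination ((α - b) / 2) * h2
  rw [h8]
  linarith

/-- All other terms of `𝔞(u,u)` are real. Young's inequality puts the drift under the two weighted
integrals that `re_form_ge` keeps with coefficient `1`. -/
theorem IsFormPair.abs_im_form_le (hc : 0 ≤ c) (hlam : 0 ≤ lam) (h : IsFormPair α β u G) :
    |(∫ x, formDensity α β b c lam x (u x) (G x) (u x) (G x)).im| ≤
      |α - b| / 2 * ((∫ x, ‖x‖ ^ α * ‖G x‖ ^ 2) + ∫ x, ‖x‖ ^ (α - 2) * ‖u x‖ ^ 2) := by
  have hint := h.integrable_formDensity (b := b) (c := c) (lam := lam) hc hlam h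
  have h0 : (∫ x, formDensity α β b c lam x (u x) (G x) (u x) (G x)).im =
      ∫ x, (formDensity α β b c lam x (u x) (G x) (u x) (G x)).im := (integral_im hint).symm
  rw [h0, ← integral_add h.integrable_wgrad h.integrable_sing, ← integral_const_mul]
  refine (abs_integral_le_integral_abs).trans (integral_mono hint.im.abs
    ((h.integrable_wgrad.add h.integrable_sing).const_mul _) fun x => ?_)
  have h1 := drift_density_le α x u G
  simp only [formDensity_self, Complex.add_im, Complex.ofReal_im, zero_add, Complex.im_ofReal_mul,
    abs_mul]
  rw [abs_of_nonneg (by positivity : 0 ≤ ‖x‖ ^ (α - 2))]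
  have h2 : |(conj (u x) * radial G x).im| ≤ ‖u x‖ * ‖radial G x‖ := by
    refine (Complex.abs_im_le_norm _).trans (le_of_eq ?_)
    rw [norm_mul, Complex.norm_conj]
  calc |α - b| * ‖x‖ ^ (α - 2) * |(conj (u x) * radial G x).im|
      ≤ |α - b| * ‖x‖ ^ (α - 2) * (‖u x‖ * ‖radial G x‖) := by gcongr
    _ = |α - b| * (‖u x‖ * ‖radial G x‖ * ‖x‖ ^ (α - 2)) := by ring
    _ ≤ |α - b| * ((‖x‖ ^ α * ‖G x‖ ^ 2 + ‖x‖ ^ (α - 2) * ‖u x‖ ^ 2) / 2) := by gcongr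
    _ = _ := by ring

theorem norm_sq_eq_integral {F : Type*} [NormedAddCommGroup F] [InnerProductSpace ℂ F]
    (f : Lp (α := RN N) F 2 volume) : ‖f‖ ^ 2 = ∫ x, ‖f x‖ ^ 2 := by
  have h1 := inner_self_eq_norm_sq_to_K (𝕜 := ℂ) f
  rw [L2.inner_def] at h1
  have h2 : ∫ x, inner ℂ (f x) (f x) = ((∫ x, ‖f x‖ ^ 2 : ℝ) : ℂ) := by
    rw [← integral_complex_ofReal]
    refine integral_congr_ae (Eventually.of_forall fun x => ?_)
    simp [inner_self_eq_norm_sq_to_K]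
  rw [h2] at h1
  exact (Complex.ofReal_injective (h1.trans (by simp))).symm

theorem norm_sq_of_mem_formSpace {w : Lp (α := RN N) (PairVal N) 2 volume}
    (hw : w ∈ formSpace N α β) : ‖w‖ ^ 2 = (∫ x, ‖pairGrad α w x‖ ^ 2) +
      (∫ x, ‖x‖ ^ α * ‖pairGrad α w x‖ ^ 2) + (∫ x, ‖pairFun α β w x‖ ^ 2) +
      (∫ x, ‖x‖ ^ (α - 2) * ‖pairFun α β w x‖ ^ 2) + ∫ x, ‖x‖ ^ β * ‖pairFun α β w x‖ ^ 2 := by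
  have h := isFormPair_of_mem_formSpace hw
  rw [norm_sq_eq_integral, ← integral_add h.integrable_grad h.integrable_wgrad,
    ← integral_add (h.integrable_grad.fun_add h.integrable_wgrad) h.integrable_normSq,
    ← integral_add ((h.integrable_grad.fun_add h.integrable_wgrad).fun_add h.integrable_normSq)
      h.integrable_sing,
    ← integral_add (((h.integrable_grad.fun_add h.integrable_wgrad).fun_add h.integrable_normSq).fun_add
      h.integrable_sing) h.integrable_pot]
  refine integral_congr_ae (Eventually.of_forall fun x => ?_)
  have h1 : gradWeight α x ≠ 0 := (zero_lt_one.trans_le (one_le_gradWeight x)).ne'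
  have h0 : funWeight α β x ≠ 0 := (zero_lt_one.trans_le (one_le_funWeight x)).ne'
  have e1 : ‖(w x).fst‖ ^ 2 = (1 + ‖x‖ ^ α) * ‖pairGrad α w x‖ ^ 2 := by
    rw [← sq_gradWeight, pairGrad, norm_smul, mul_pow, Complex.norm_real, Real.norm_eq_abs, sq_abs,
      inv_pow, mul_inv_cancel_left₀ (pow_ne_zero 2 h1)]
  have e2 : ‖(w x).snd‖ ^ 2 = (1 + ‖x‖ ^ (α - 2) + ‖x‖ ^ β) * ‖pairFun α β w x‖ ^ 2 := by
    rw [← sq_funWeight, pairFun, norm_mul, mul_pow, Complex.norm_real, Real.norm_eq_abs, sq_abs,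
      inv_pow, mul_inv_cancel_left₀ (pow_ne_zero 2 h0)]
  beta_reduce
  rw [WithLp.prod_norm_sq_eq_of_L2, e1, e2]
  ring

/-- The summand `+ 1` in the sector constant only ensures that it is positive when `α = b`. -/
theorem isSectorialResolvent_form (hN : 3 ≤ N) (hα2 : α < 2) (hc : 0 ≤ c)
    (hlam : AdmissibleShift N α b c lam) (hj : DenseRange (formEmb N α β)) :
    IsSectorialResolvent (|α - b| / 2 + 1) (formOperatorGraph N α β b c lam)
      (formResolvent (formEmb N α β) (formOp N α β b c lam hc hlam.1.le)) := by
  rw [← abstractGraph_eq hc hlam.1.le]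
  have key : ∀ v : formSpace N α β, inner ℂ v (formOp N α β b c lam hc hlam.1.le v) =
      ∫ x, formDensity α β b c lam x (pairFun α β v.1 x) (pairGrad α v.1 x)
        (pairFun α β v.1 x) (pairGrad α v.1 x) := fun v => by rw [inner_formOp, inner_pairForm]
  refine isSectorialResolvent_of_form (by positivity) (fun μ hμ => ?_) (fun v => ?_) hj
  · refine ⟨min (1 / 2) μ, lt_min (by norm_num) hμ, fun v => ?_⟩
    have h := isFormPair_of_mem_formSpace v.2
    have h1 := h.re_form_ge hN hα2 hc hlam
    have h2 := norm_sq_of_mem_formSpace v.2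
    have h3 : ‖formEmb N α β v‖ ^ 2 = ∫ x, ‖pairFun α β v.1 x‖ ^ 2 := by
      rw [norm_sq_eq_integral]
      refine integral_congr_ae ?_
      filter_upwards [coeFn_pairEmb (α := α) (β := β)
        (v : Lp (α := RN N) (PairVal N) 2 volume)] with x hx
      rw [← hx]; rfl
    rw [key, h3]
    have h4 : ‖v‖ ^ 2 = _ := h2
    rw [h4]
    have i1 : 0 ≤ ∫ x, ‖pairGrad α v.1 x‖ ^ 2 := integral_nonneg fun x => by positivity
    have i2 : 0 ≤ ∫ x, ‖x‖ ^ α * ‖pairGrad α v.1 x‖ ^ 2 := integral_nonneg fun x => by positivity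
    have i3 : 0 ≤ ∫ x, ‖pairFun α β v.1 x‖ ^ 2 := integral_nonneg fun x => by positivity
    have i4 : 0 ≤ ∫ x, ‖x‖ ^ (α - 2) * ‖pairFun α β v.1 x‖ ^ 2 :=
      integral_nonneg fun x => by positivity
    have i5 : 0 ≤ ∫ x, ‖x‖ ^ β * ‖pairFun α β v.1 x‖ ^ 2 := integral_nonneg fun x => by positivity
    have m1 := min_le_left (1 / 2 : ℝ) μ
    have m2 := min_le_right (1 / 2 : ℝ) μ
    set m := min (1 / 2 : ℝ) μ
    nlinarith [mul_le_mul_of_nonneg_right m1 i1, mul_le_mul_of_nonneg_right m1 i2,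
      mul_le_mul_of_nonneg_right m2 i3, mul_le_mul_of_nonneg_right m1 i4,
      mul_le_mul_of_nonneg_right m1 i5]
  · have h := isFormPair_of_mem_formSpace v.2
    have h1 := h.re_form_ge hN hα2 hc hlam
    have h2 := h.abs_im_form_le (b := b) hc hlam.1.le
    rw [key]
    have i1 : 0 ≤ ∫ x, ‖pairGrad α v.1 x‖ ^ 2 := integral_nonneg fun x => by positivity
    have i2 : 0 ≤ ∫ x, ‖x‖ ^ α * ‖pairGrad α v.1 x‖ ^ 2 := integral_nonneg fun x => by positivity
    have i4 : 0 ≤ ∫ x, ‖x‖ ^ (α - 2) * ‖pairFun α β v.1 x‖ ^ 2 :=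
      integral_nonneg fun x => by positivity
    have i5 : 0 ≤ ∫ x, ‖x‖ ^ β * ‖pairFun α β v.1 x‖ ^ 2 := integral_nonneg fun x => by positivity
    refine h2.trans ?_
    refine mul_le_mul (by linarith) (by linarith) (by positivity) (by positivity)

end Coercive

/-! ### Test functions away from the origin -/

section Test

variable {N : ℕ} {u v : RN N → ℂ}

theorem IsTestAwayFromZero.mono (h : ContDiff ℝ ∞ v) (hu : IsTestAwayFromZero u)
    (hs : tsupport v ⊆ tsupport u) : IsTestAwayFromZero v where
  smooth := h
  compact := hu.compact.of_isClosed_subset (isClosed_tsupport _) hs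
  away h0 := hu.away (hs h0)

theorem IsTestAwayFromZero.add (hu : IsTestAwayFromZero u) (hv : IsTestAwayFromZero v) :
    IsTestAwayFromZero fun x => u x + v x where
  smooth := hu.smooth.add hv.smooth
  compact := hu.compact.add hv.compact
  away h0 := (tsupport_add u v h0).elim hu.away hv.away

theorem isTestAwayFromZero_zero : IsTestAwayFromZero fun _ : RN N => (0 : ℂ) where
  smooth := contDiff_const
  compact := HasCompactSupport.zero
  away := by simp [tsupport, Function.support]

theorem IsTestAwayFromZero.sum {ι : Type*} (s : Finset ι) {f : ι → RN N → ℂ}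
    (h : ∀ i, IsTestAwayFromZero (f i)) : IsTestAwayFromZero fun x => ∑ i ∈ s, f i x := by
  classical
  induction s using Finset.induction_on with
  | empty => simpa using isTestAwayFromZero_zero
  | insert i s hi ih =>
    simp only [Finset.sum_insert hi]
    exact (h i).add ih

/-- Near the origin the product vanishes identically, so a weight singular there does no harm. -/
theorem IsTestAwayFromZero.weight_mul (hu : IsTestAwayFromZero u) {w : RN N → ℝ}
    (hw : ∀ x, x ≠ 0 → ContDiffAt ℝ ∞ w x) :
    IsTestAwayFromZero fun x => ((w x : ℝ) : ℂ) * u x := by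
  refine IsTestAwayFromZero.mono (contDiff_iff_contDiffAt.2 fun x => ?_) hu
    (closure_mono (Function.support_mul_subset_right _ _))
  by_cases hx : x = 0
  · subst hx
    have h0 : u =ᶠ[𝓝 0] 0 := notMem_tsupport_iff_eventuallyEq.1 hu.away
    have h1 : (fun x => ((w x : ℝ) : ℂ) * u x) =ᶠ[𝓝 0] fun _ => 0 :=
      h0.mono fun x hx => by simp [hx]
    exact contDiffAt_const.congr_of_eventuallyEq h1
  · exact (Complex.ofRealCLM.contDiff.contDiffAt.comp x (hw x hx)).mul hu.smooth.contDiffAt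

theorem IsTestAwayFromZero.deriv (hu : IsTestAwayFromZero u) (e : RN N) :
    IsTestAwayFromZero fun x => fderiv ℝ u x e :=
  IsTestAwayFromZero.mono ((hu.smooth.fderiv_right (by simp)).clm_apply contDiff_const) hu
    (tsupport_fderiv_apply_subset ℝ e)

theorem IsTestAwayFromZero.memLp (hu : IsTestAwayFromZero u) (p : ℝ≥0∞) : MemLp u p volume :=
  memLp_of_continuous_compact hu.smooth.continuous hu.compact p

theorem contDiffAt_norm_rpow (s : ℝ) {x : RN N} (hx : x ≠ 0) :
    ContDiffAt ℝ ∞ (fun x : RN N => ‖x‖ ^ s) x :=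
  (contDiffAt_norm ℝ hx).rpow_const_of_ne (norm_ne_zero_iff.2 hx)

theorem contDiffAt_sqrt_norm_rpow (s : ℝ) {x : RN N} (hx : x ≠ 0) :
    ContDiffAt ℝ ∞ (fun x : RN N => Real.sqrt (‖x‖ ^ s)) x :=
  (contDiffAt_norm_rpow s hx).sqrt (Real.rpow_pos_of_pos (norm_pos_iff.2 hx) s).ne'

theorem laplacian_eq_sum (hu : ContDiff ℝ ∞ u) (x : RN N) :
    Laplacian.laplacian u x = ∑ i, fderiv ℝ (fun y => fderiv ℝ u y (EuclideanSpace.single i 1)) x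
      (EuclideanSpace.single i 1) := by
  rw [InnerProductSpace.laplacian_eq_iteratedFDeriv_orthonormalBasis u
    (EuclideanSpace.basisFun (Fin N) ℝ)]
  refine Finset.sum_congr rfl fun i _ => ?_
  have hd : DifferentiableAt ℝ (fderiv ℝ u) x :=
    ((hu.fderiv_right (m := ∞) (by simp)).differentiable (by simp)).differentiableAt
  rw [iteratedFDeriv_two_apply, fderiv_clm_apply hd (differentiableAt_const _)]
  simp

theorem fderiv_apply_self (x : RN N) :
    fderiv ℝ u x x = ∑ i, ((x i : ℝ) : ℂ) * fderiv ℝ u x (EuclideanSpace.single i 1) := by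
  have := congrArg (fderiv ℝ u x) (sum_smul_single x)
  rw [map_sum] at this
  simpa using this.symm

theorem IsTestAwayFromZero.laplacian (hu : IsTestAwayFromZero u) :
    IsTestAwayFromZero (Laplacian.laplacian u) := by
  rw [show Laplacian.laplacian u = _ from funext fun x => laplacian_eq_sum hu.smooth x]
  exact IsTestAwayFromZero.sum _ fun i => (hu.deriv _).deriv _

theorem IsTestAwayFromZero.euler (hu : IsTestAwayFromZero u) :
    IsTestAwayFromZero fun x => fderiv ℝ u x x := by
  simp only [fderiv_apply_self]
  exact IsTestAwayFromZero.sum _ fun i => (hu.deriv _).weight_mul fun x _ =>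
    (EuclideanSpace.proj i : RN N →L[ℝ] ℝ).contDiff.contDiffAt

theorem IsTestAwayFromZero.diffOp_sub (hu : IsTestAwayFromZero u) (α β b c lam : ℝ) :
    IsTestAwayFromZero fun x => diffOp α β b c u x - (lam : ℂ) * u x := by
  have h1 : IsTestAwayFromZero fun x =>
      ((1 + ‖x‖ ^ α : ℝ) : ℂ) * Laplacian.laplacian u x :=
    hu.laplacian.weight_mul (w := fun x => 1 + ‖x‖ ^ α) fun x hx =>
      contDiffAt_const.add (contDiffAt_norm_rpow α hx)
  have h2 : IsTestAwayFromZero fun x =>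
      ((b * ‖x‖ ^ (α - 2) : ℝ) : ℂ) * fderiv ℝ u x x :=
    hu.euler.weight_mul (w := fun x => b * ‖x‖ ^ (α - 2)) fun x hx =>
      contDiffAt_const.mul (contDiffAt_norm_rpow (α - 2) hx)
  have h3 : IsTestAwayFromZero fun x =>
      ((-(c * ‖x‖ ^ (α - 2)) - ‖x‖ ^ β - lam : ℝ) : ℂ) * u x :=
    hu.weight_mul (w := fun x => -(c * ‖x‖ ^ (α - 2)) - ‖x‖ ^ β - lam) fun x hx =>
      ((contDiffAt_const.mul (contDiffAt_norm_rpow (α - 2) hx)).neg.sub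
        (contDiffAt_norm_rpow β hx)).sub contDiffAt_const
  have h4 := (h1.add h2).add h3
  have h5 : (fun x => diffOp α β b c u x - (lam : ℂ) * u x) = fun x =>
      ((1 + ‖x‖ ^ α : ℝ) : ℂ) * Laplacian.laplacian u x +
      ((b * ‖x‖ ^ (α - 2) : ℝ) : ℂ) * fderiv ℝ u x x +
      ((-(c * ‖x‖ ^ (α - 2)) - ‖x‖ ^ β - lam : ℝ) : ℂ) * u x := by
    funext x
    simp only [diffOp]
    push_cast
    ring
  rw [h5]
  exact h4

theorem IsTestAwayFromZero.isFormPair (hu : IsTestAwayFromZero u) {α β : ℝ} (hα : 0 < α) :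
    IsFormPair α β u (classGrad u) := by
  have hgc : Continuous (classGrad u) := continuous_classGrad (hu.smooth.of_le (by simp))
  have hgs : HasCompactSupport (classGrad u) := by
    refine hu.compact.mono' fun x hx => ?_
    by_contra h
    refine hx ?_
    have h1 : fderiv ℝ u x = 0 := by
      by_contra h2
      exact h (support_fderiv_subset ℝ h2)
    ext i
    simp [classGrad, h1]
  refine ⟨⟨hu.smooth.continuous.locallyIntegrable, hgc.locallyIntegrable, fun φ hφ hc i =>
    integral_mul_fderiv_of_contDiff (hu.smooth.of_le (by simp)) hφ hc _⟩, hu.memLp 2,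
    memLp_of_continuous_compact hgc hgs 2, ?_, ?_, ?_⟩
  · refine memLp_of_continuous_compact (Continuous.smul ?_ hgc) 
      (hgs.smul_left (f := fun x : RN N => Real.sqrt (1 + ‖x‖ ^ α))) 2
    exact (continuous_const.add (continuous_norm.rpow_const fun x => Or.inr hα.le)).sqrt
  · exact (hu.weight_mul fun x hx => contDiffAt_sqrt_norm_rpow (α - 2) hx).memLp 2
  · exact (hu.weight_mul fun x hx => contDiffAt_sqrt_norm_rpow β hx).memLp 2

/-- Weak gradients are tested only against real functions. The real and imaginary parts of `ψ` are
treated separately and recombined. -/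
theorem HasWeakGradient.integral_mul_conj {h : RN N → ℂ} {H : RN N → EuclideanSpace ℂ (Fin N)}
    (hw : HasWeakGradient h H) (hh : MemLp h 2 volume) (hH : MemLp H 2 volume) {ψ : RN N → ℂ}
    (hψ : ContDiff ℝ ∞ ψ) (hc : HasCompactSupport ψ) (i : Fin N) :
    ∫ x, ψ x * conj (H x i) = -∫ x, fderiv ℝ ψ x (EuclideanSpace.single i 1) * conj (h x) := by
  have main : ∀ L : ℂ →L[ℝ] ℝ, Integrable (fun x => ((L (ψ x) : ℝ) : ℂ) * conj (H x i)) volume ∧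
      Integrable (fun x => ((L (fderiv ℝ ψ x (EuclideanSpace.single i 1)) : ℝ) : ℂ) * conj (h x))
        volume ∧ ∫ x, ((L (ψ x) : ℝ) : ℂ) * conj (H x i) =
      -∫ x, ((L (fderiv ℝ ψ x (EuclideanSpace.single i 1)) : ℝ) : ℂ) * conj (h x) := by
    intro L
    have hφ : ContDiff ℝ ∞ fun x => L (ψ x) := L.contDiff.comp hψ
    have hφc : HasCompactSupport fun x => L (ψ x) := hc.comp_left (g := L) (map_zero L)
    have hd : ∀ x e, fderiv ℝ (fun x => L (ψ x)) x e = L (fderiv ℝ ψ x e) := fun x e => by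
      have := L.hasFDerivAt.comp x ((hψ.differentiable (by simp)).differentiableAt (x := x)).hasFDerivAt
      have h2 : HasFDerivAt (fun x => L (ψ x)) _ x := this
      rw [h2.fderiv]
      rfl
    have h1 := hw.integral_eq _ hφ hφc i
    simp only [hd] at h1
    have hφ2 : MemLp (fun x => ((L (ψ x) : ℝ) : ℂ)) 2 volume :=
      memLp_of_continuous_compact (Complex.continuous_ofReal.comp hφ.continuous)
        (hφc.comp_left (g := ((↑) : ℝ → ℂ)) Complex.ofReal_zero) 2
    have hd2 : MemLp (fun x => ((L (fderiv ℝ ψ x (EuclideanSpace.single i 1)) : ℝ) : ℂ)) 2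
        volume := by
      have h3 := memLp_of_continuous_compact (continuous_fderiv_ofReal_apply hφ
        (EuclideanSpace.single i 1)) (hasCompactSupport_fderiv_ofReal_apply hφc _) 2
      simpa only [hd] using h3
    have hcj : ∀ {g : RN N → ℂ}, MemLp g 2 volume → MemLp (fun x => conj (g x)) 2 volume :=
      fun hg => hg.of_le (Complex.continuous_conj.comp_aestronglyMeasurable hg.1)
        (Eventually.of_forall fun x => by simp)
    refine ⟨hφ2.integrable_mul (hcj (MemLp.coord hH i)), hd2.integrable_mul (hcj hh), ?_⟩
    have h4 := congrArg conj h1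
    rw [map_neg, ← integral_conj, ← integral_conj] at h4
    simp only [map_mul, Complex.conj_ofReal] at h4
    simp only [mul_comm ((L _ : ℝ) : ℂ)]
    rw [h4, neg_neg]
  obtain ⟨r1, r2, r3⟩ := main Complex.reCLM
  obtain ⟨i1, i2, i3⟩ := main Complex.imCLM
  have hs : ∀ z w : ℂ, z * w = ((Complex.reCLM z : ℝ) : ℂ) * w +
      ((Complex.imCLM z : ℝ) : ℂ) * w * Complex.I := fun z w => by
    conv_lhs => rw [← Complex.re_add_im z]
    simp only [Complex.reCLM_apply, Complex.imCLM_apply]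
    ring
  simp only [hs (ψ _), hs (fderiv ℝ ψ _ _)]
  rw [integral_add r1 (i1.mul_const _), integral_add r2 (i2.mul_const _), integral_mul_const,
    integral_mul_const, r3, i3]
  ring

theorem hasFDerivAt_one_add_norm_rpow {α : ℝ} {x : RN N} (hx : x ≠ 0) :
    HasFDerivAt (fun y : RN N => 1 + ‖y‖ ^ α)
      ((α * ‖x‖ ^ (α - 2)) • innerSL ℝ x) x := by
  have hp : 0 < ‖x‖ := norm_pos_iff.2 hx
  have h1 : HasFDerivAt (fun x : RN N => ‖x‖ ^ 2) (2 • innerSL ℝ x) x := by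
    simpa using (hasFDerivAt_id x).norm_sq
  have h2 := (h1.rpow_const (Or.inl (by positivity : ‖x‖ ^ 2 ≠ 0)) (p := α / 2)).const_add 1
  have h3 : (fun y : RN N => 1 + (‖y‖ ^ 2) ^ (α / 2)) = fun y => 1 + ‖y‖ ^ α := by
    funext y
    rw [← Real.rpow_natCast, ← Real.rpow_mul (norm_nonneg _)]
    congr 2
    push_cast
    ring
  rw [h3] at h2
  refine h2.congr_fderiv ?_
  rw [← Real.rpow_natCast, ← Real.rpow_mul (norm_nonneg _), ← Nat.cast_smul_eq_nsmul ℝ, smul_smul]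
  congr 1
  push_cast
  rw [show (2 : ℝ) * (α / 2 - 1) = α - 2 by ring]
  ring

theorem IsTestAwayFromZero.mem_formOperatorGraph (hN : 3 ≤ N) (hu : IsTestAwayFromZero u)
    {α β b c lam : ℝ} (hα : 0 < α) :
    ((hu.memLp 2).toLp u, ((hu.diffOp_sub α β b c lam).memLp 2).toLp _) ∈
      formOperatorGraph N α β b c lam := by
  have hpair := hu.isFormPair (β := β) hα
  have hcoe := (hu.memLp 2).coeFn_toLp
  refine ⟨(hpair.congr_ae hcoe.symm (ae_eq_refl _)).mem_formDomain, fun h hh => ?_⟩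
  have hh' := mem_formDomain_iff.1 hh
  rw [IsFormPair.form_eq hpair.weak hh'.weak hcoe (ae_eq_refl _), ← MemLp.toLp_neg, L2.inner_def]
  set H := weakGrad (h : RN N → ℂ) with hH
  have hw : ∀ x : RN N, x ≠ 0 → ContDiffAt ℝ ∞ (fun x : RN N => 1 + ‖x‖ ^ α) x := fun x hx =>
    contDiffAt_const.add (contDiffAt_norm_rpow α hx)
  set ψ : Fin N → RN N → ℂ := fun i x => ((1 + ‖x‖ ^ α : ℝ) : ℂ) *
    fderiv ℝ u x (EuclideanSpace.single i 1) with hψ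
  have hψt : ∀ i, IsTestAwayFromZero (ψ i) := fun i => (hu.deriv _).weight_mul hw
  have hR : IsTestAwayFromZero fun x =>
      (((α - b) * ‖x‖ ^ (α - 2) : ℝ) : ℂ) * fderiv ℝ u x x +
      ((c * ‖x‖ ^ (α - 2) + ‖x‖ ^ β + lam : ℝ) : ℂ) * u x :=
    (hu.euler.weight_mul (w := fun x => (α - b) * ‖x‖ ^ (α - 2)) fun x hx =>
      contDiffAt_const.mul (contDiffAt_norm_rpow (α - 2) hx)).add
    (hu.weight_mul (w := fun x => c * ‖x‖ ^ (α - 2) + ‖x‖ ^ β + lam) fun x hx =>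
      ((contDiffAt_const.mul (contDiffAt_norm_rpow (α - 2) hx)).add
        (contDiffAt_norm_rpow β hx)).add contDiffAt_const)
  have hcj : ∀ {g : RN N → ℂ}, MemLp g 2 volume → MemLp (fun x => conj (g x)) 2 volume :=
    fun hg => hg.of_le (Complex.continuous_conj.comp_aestronglyMeasurable hg.1)
      (Eventually.of_forall fun x => by simp)
  have hi1 : ∀ i, Integrable (fun x => ψ i x * conj (H x i)) volume := fun i =>
    ((hψt i).memLp 2).integrable_mul (hcj (MemLp.coord hh'.mem_grad i))
  have hi2 : ∀ i, Integrable (fun x => fderiv ℝ (ψ i) x (EuclideanSpace.single i 1) *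
      conj (h x)) volume := fun i => (((hψt i).deriv _).memLp 2).integrable_mul (hcj hh'.mem)
  have hi3 : Integrable (fun x => ((((α - b) * ‖x‖ ^ (α - 2) : ℝ) : ℂ) * fderiv ℝ u x x +
      ((c * ‖x‖ ^ (α - 2) + ‖x‖ ^ β + lam : ℝ) : ℂ) * u x) * conj (h x)) volume :=
    (hR.memLp 2).integrable_mul (hcj hh'.mem)
  have e1 : ∀ x, formDensity α β b c lam x (u x) (classGrad u x) (h x) (H x) =
      (∑ i, ψ i x * conj (H x i)) + ((((α - b) * ‖x‖ ^ (α - 2) : ℝ) : ℂ) * fderiv ℝ u x x +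
      ((c * ‖x‖ ^ (α - 2) + ‖x‖ ^ β + lam : ℝ) : ℂ) * u x) * conj (h x) := fun x => by
    rw [fderiv_apply_self]
    simp only [formDensity, hψ, classGrad, mul_assoc, ← Finset.mul_sum]
    push_cast
    ring
  have e2 : ∫ x, ∑ i, ψ i x * conj (H x i) =
      ∫ x, ∑ i, -(fderiv ℝ (ψ i) x (EuclideanSpace.single i 1) * conj (h x)) := by
    rw [integral_finsetSum _ fun i _ => hi1 i, integral_finsetSum _ fun i _ => (hi2 i).fun_neg]
    refine Finset.sum_congr rfl fun i _ => ?_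
    rw [hh'.weak.integral_mul_conj hh'.mem hh'.mem_grad (hψt i).smooth (hψt i).compact,
      integral_neg]
  have hne : ∀ᵐ x : RN N, x ≠ 0 := by
    have : Nonempty (Fin N) := ⟨⟨0, by omega⟩⟩
    exact Measure.ae_ne volume 0
  simp only [e1]
  refine (integral_add (integrable_finsetSum _ fun i _ => hi1 i) hi3).trans ?_
  rw [e2]
  refine (integral_add (integrable_finsetSum _ fun i _ => (hi2 i).fun_neg) hi3).symm.trans ?_
  refine integral_congr_ae ?_
  filter_upwards [hne, ((hu.diffOp_sub α β b c lam).memLp 2).neg.coeFn_toLp] with x hx e3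
  -- The divergence of `(1+|x|^α)∇u` contains `α|x|^{α-2} x·∇u`. Against the `α - b` of the form
  -- only the drift coefficient `b` of the operator survives.
  have e4 : ∀ i, fderiv ℝ (ψ i) x (EuclideanSpace.single i 1) =
      ((1 + ‖x‖ ^ α : ℝ) : ℂ) * fderiv ℝ (fun y => fderiv ℝ u y (EuclideanSpace.single i 1)) x
        (EuclideanSpace.single i 1) + ((α * ‖x‖ ^ (α - 2) : ℝ) : ℂ) *
        (((x i : ℝ) : ℂ) * fderiv ℝ u x (EuclideanSpace.single i 1)) := fun i => by
    have d1 := Complex.ofRealCLM.hasFDerivAt.comp x (hasFDerivAt_one_add_norm_rpow (α := α) hx)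
    have d2 := (((hu.deriv (EuclideanSpace.single i 1)).smooth.differentiable
      (by simp)).differentiableAt (x := x)).hasFDerivAt
    have d3 : HasFDerivAt (ψ i) _ x := d1.mul d2
    rw [d3.fderiv]
    simp [EuclideanSpace.inner_single_right]
    ring
  rw [e3]
  simp only [Pi.neg_apply, RCLike.inner_apply, e4, diffOp, laplacian_eq_sum hu.smooth,
    Finset.sum_neg_distrib, ← Finset.sum_mul, Finset.sum_add_distrib, ← Finset.mul_sum,
    ← fderiv_apply_self]
  push_cast
  ring

/-- Test functions supported off the origin lie in the form domain. An `L²` function orthogonal to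
all of them vanishes off the null set `{0}`. -/
theorem denseRange_formEmb (hN : 3 ≤ N) {α β : ℝ} (hα : 0 < α) :
    DenseRange (formEmb N α β) := by
  let K : Submodule ℂ (LpRN N 2) := LinearMap.range (formEmb N α β).toLinearMap
  change Dense (K : Set (LpRN N 2))
  rw [Submodule.dense_iff_topologicalClosure_eq_top, Submodule.topologicalClosure_eq_top_iff,
    Submodule.eq_bot_iff]
  intro f hf
  have hf' : ∀ᵐ x, x ∈ ({0}ᶜ : Set (RN N)) → f x = 0 := by
    refine IsOpen.ae_eq_zero_of_integral_contDiff_smul_eq_zero isOpen_compl_singleton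
      (((Lp.memLp f).locallyIntegrable one_le_two).locallyIntegrableOn _) fun g hg hgc hgs => ?_
    have ht : IsTestAwayFromZero fun x => ((g x : ℝ) : ℂ) :=
      ⟨Complex.ofRealCLM.contDiff.comp hg, hgc.comp_left (g := ((↑) : ℝ → ℂ)) Complex.ofReal_zero,
        fun h0 => hgs ((tsupport_comp_subset (g := ((↑) : ℝ → ℂ)) Complex.ofReal_zero g) h0) rfl⟩
    obtain ⟨v, hv, hvu⟩ := (ht.isFormPair (β := β) hα).exists_mem_formSpace
    have h1 : inner ℂ (pairEmb α β v) f = 0 :=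
      (Submodule.mem_orthogonal _ _).1 hf _ ⟨⟨v, hv⟩, rfl⟩
    rw [L2.inner_def] at h1
    rw [← h1]
    refine integral_congr_ae ?_
    filter_upwards [hvu] with x hx
    rw [hx]
    simp [mul_comm]
  have hne : ∀ᵐ x : RN N, x ≠ 0 := by
    have : Nonempty (Fin N) := ⟨⟨0, by omega⟩⟩
    exact Measure.ae_ne volume 0
  refine Lp.ext ?_
  filter_upwards [hf', hne, Lp.coeFn_zero ℂ 2 (volume : Measure (RN N))] with x h1 h2 h3
  rw [h3, h1 h2]
  rfl

end Test

/-! ### Invariance of closed convex sets -/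

section Invariance

variable {H : Type*} [NormedAddCommGroup H] [NormedSpace ℂ H] [CompleteSpace H] [NormedSpace ℝ H]
  [IsScalarTower ℝ ℂ H]

/-- Up to the factor `exp(-a)`, the exponential is `∑ aⁿ Qⁿ/n!`: a Poisson average of the powers `Qⁿ
f`, all of which lie in `C`. -/
theorem exp_mem_of_mapsTo {C : Set H} (hC : Convex ℝ C) (hcl : IsClosed C) {Q : H →L[ℂ] H}
    (hQ : Set.MapsTo Q C C) {a : ℝ} (ha : 0 ≤ a) {f : H} (hf : f ∈ C) :
    NormedSpace.exp ((a : ℂ) • (Q - 1)) f ∈ C := by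
  let +nondep : NormedAlgebra ℚ (H →L[ℂ] H) := .restrictScalars ℚ ℂ _
  have h1 : NormedSpace.exp ((a : ℂ) • (Q - 1)) =
      (Complex.exp (-(a : ℂ))) • NormedSpace.exp ((a : ℂ) • Q) := by
    rw [show (a : ℂ) • (Q - 1) = algebraMap ℂ (H →L[ℂ] H) (-(a : ℂ)) + (a : ℂ) • Q by
      rw [Algebra.algebraMap_eq_smul_one, smul_sub, neg_smul]; abel]
    rw [NormedSpace.exp_add_of_commute (Algebra.commutes _ _), ← NormedSpace.algebraMap_exp_comm,
      ← Complex.exp_eq_exp_ℂ, ← Algebra.smul_def]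
  have hQn : ∀ n : ℕ, (Q ^ n) f ∈ C := fun n => by
    induction n with
    | zero => simpa using hf
    | succ n ih =>
      rw [pow_succ']
      exact hQ ih
  have h2 := (NormedSpace.exp_series_hasSum_exp' (𝕂 := ℂ) ((a : ℂ) • Q)).tendsto_sum_nat
  have h3 := tendsto_clm_apply h2 (tendsto_const_nhds (x := f))
  have h4 := (NormedSpace.exp_series_hasSum_exp' (𝕂 := ℝ) a).tendsto_sum_nat
  rw [← Real.exp_eq_exp_ℝ] at h4
  have h5 := (h4.inv₀ (Real.exp_pos a).ne').smul h3
  have h6 : NormedSpace.exp ((a : ℂ) • (Q - 1)) f =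
      (Real.exp a)⁻¹ • NormedSpace.exp ((a : ℂ) • Q) f := by
    rw [h1, ← Real.exp_neg, smul_apply, ← algebraMap_smul ℂ (Real.exp (-a))]
    simp
  rw [h6]
  -- Each nonempty partial sum, divided by the matching partial sum of `exp a`, is a genuine convex
  -- combination.
  refine hcl.mem_of_tendsto h5 ((eventually_gt_atTop 0).mono fun n hn => ?_)
  set w : ℕ → ℝ := fun i => ((i.factorial : ℝ)⁻¹) • a ^ i with hw
  have hw0 : ∀ i, 0 ≤ w i := fun i => by simp only [hw, smul_eq_mul]; positivity
  have hW : 0 < ∑ i ∈ Finset.range n, w i :=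
    Finset.sum_pos' (fun i _ => hw0 i) ⟨0, Finset.mem_range.2 hn, by simp [hw]⟩
  have h7 : (∑ i ∈ Finset.range n, w i)⁻¹ • (∑ i ∈ Finset.range n,
      ((i.factorial : ℂ)⁻¹) • ((a : ℂ) • Q) ^ i) f =
      ∑ i ∈ Finset.range n, ((∑ i ∈ Finset.range n, w i)⁻¹ * w i) • (Q ^ i) f := by
    rw [_root_.sum_apply, Finset.smul_sum]
    refine Finset.sum_congr rfl fun i _ => ?_
    rw [mul_smul, smul_pow, smul_apply, smul_apply, smul_smul, ← algebraMap_smul ℂ (w i)]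
    congr 2
    simp [hw]
  rw [h7]
  refine hC.sum_mem (fun i _ => mul_nonneg (inv_nonneg.2 hW.le) (hw0 i)) ?_ fun i _ => hQn i
  rw [← Finset.mul_sum, inv_mul_cancel₀ hW.ne']

end Invariance

/-! ### The sub-Markov property -/

section SubMarkov

variable {N : ℕ} {α β b c lam : ℝ}

/-- Square integrable functions whose real part is at most `k`. -/
def reLe (N : ℕ) (k : ℝ) : Set (LpRN N 2) := {f | ∀ᵐ x, (f x).re ≤ k}

theorem convex_reLe (k : ℝ) : Convex ℝ (reLe N k) := by
  intro f hf g hg s t hs ht hst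
  filter_upwards [hf, hg, Lp.coeFn_add (s • f) (t • g), Lp.coeFn_smul s f, Lp.coeFn_smul t g]
    with x h1 h2 h3 h4 h5
  rw [h3, Pi.add_apply, h4, h5]
  simp only [Pi.smul_apply, Complex.add_re, Complex.smul_re, smul_eq_mul]
  calc s * (f x).re + t * (g x).re ≤ s * k + t * k := by gcongr
    _ = k := by rw [← add_mul, hst, one_mul]

theorem isClosed_reLe (k : ℝ) : IsClosed (reLe N k) := by
  refine IsSeqClosed.isClosed fun f g hf hg => ?_
  obtain ⟨ns, -, hns⟩ := (tendstoInMeasure_of_tendsto_Lp hg).exists_seq_tendsto_ae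
  have hf' : ∀ᵐ x, ∀ n, (f n x).re ≤ k := ae_all_iff.2 hf
  filter_upwards [hns, hf'] with x h1 h2
  exact le_of_tendsto' ((Complex.continuous_re.tendsto _).comp h1) fun n => h2 _

theorem IsFormPair.trunc {u : RN N → ℂ} {G : RN N → EuclideanSpace ℂ (Fin N)}
    (h : IsFormPair α β u G) {k : ℝ} (hk : 0 ≤ k) :
    IsFormPair α β (fun x => truncFun k (u x)) (truncGrad k u G) := by
  have hm : AEStronglyMeasurable (fun x => truncFun k (u x)) volume :=
    (continuous_truncFun k).comp_aestronglyMeasurable h.mem.1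
  have hmg := aestronglyMeasurable_truncGrad h.mem.1 h.mem_grad.1 k
  have hw : ∀ {w : RN N → ℝ}, Measurable w → MemLp (fun x => w x • u x) 2 volume →
      MemLp (fun x => w x • truncFun k (u x)) 2 volume := fun hw hwu =>
    hwu.of_le (hw.aestronglyMeasurable.smul hm) (Eventually.of_forall fun x => by
      rw [norm_smul, norm_smul]
      exact mul_le_mul_of_nonneg_left (norm_truncFun_le hk _) (norm_nonneg _))
  refine ⟨h.weak.trunc h.mem h.mem_grad hk,
    h.mem.of_le hm (Eventually.of_forall fun x => norm_truncFun_le hk _),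
    h.mem_grad.of_le hmg (Eventually.of_forall fun x => norm_truncGrad_le k u G x),
    h.mem_wgrad.of_le (measurable_gradWeight.aestronglyMeasurable.smul hmg)
      (Eventually.of_forall fun x => ?_), hw (by fun_prop) h.mem_sing, hw (by fun_prop) h.mem_pot⟩
  rw [norm_smul, norm_smul]
  exact mul_le_mul_of_nonneg_left (norm_truncGrad_le k u G x) (norm_nonneg _)

/-- Where `Re u > k`, the truncation `h` is real with `∇h = Re ∇u`, so only the zeroth order terms
differ. There `Re u = h + k`, and the additional terms in `k h` are nonnegative. -/
theorem re_formDensity_trunc_le (hc : 0 ≤ c) (hlam : 0 ≤ lam) {k : ℝ} (hk : 0 ≤ k)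
    (u : RN N → ℂ) (G : RN N → EuclideanSpace ℂ (Fin N)) (x : RN N) :
    (formDensity α β b c lam x (truncFun k (u x)) (truncGrad k u G x) (truncFun k (u x))
      (truncGrad k u G x)).re ≤
    (formDensity α β b c lam x (u x) (G x) (truncFun k (u x)) (truncGrad k u G x)).re := by
  by_cases hx : k < (u x).re
  · have e1 : truncFun k (u x) = (((u x).re - k : ℝ) : ℂ) := by
      rw [truncFun, max_eq_left (sub_pos.2 hx).le]
    have e2 : ∀ i, truncGrad k u G x i = (((G x i).re : ℝ) : ℂ) := fun i => by
      simp [truncGrad, hx]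
    have hp := sub_pos.2 hx
    set a := (u x).re - k with ha
    have e3 : (u x).re = a + k := by rw [ha]; ring
    simp only [formDensity, e1, e2, Complex.conj_ofReal, Complex.add_re, Complex.re_mul_ofReal,
      Complex.re_ofReal_mul, Complex.re_sum, Complex.ofReal_re, e3]
    have w1 : 0 ≤ c * ‖x‖ ^ (α - 2) * k * a := by positivity
    have w2 : 0 ≤ ‖x‖ ^ β * k * a := by positivity
    have w3 : 0 ≤ lam * k * a := by positivity
    linarith
  · have e1 : truncFun k (u x) = 0 := by
      rw [truncFun, max_eq_right (sub_nonpos.2 (not_lt.1 hx)), Complex.ofReal_zero]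
    have e2 : ∀ i, truncGrad k u G x i = 0 := fun i => by simp [truncGrad, hx]
    simp [formDensity, e1, e2]

/-- The hypothesis says `u = μ R(μ) f`. Stampacchia's truncation: test with `h = (Re u - k)⁺`; then
`Re 𝔞(u,h) ≥ Re 𝔞(h,h) ≥ 0`, so `Re ⟪h, f - u⟫ ≥ 0`, whereas `Re f ≤ k` makes this at most `-‖h‖²`.
-/
theorem re_le_of_resolvent (hN : 3 ≤ N) (hα2 : α < 2) (hc : 0 ≤ c)
    (hlam : AdmissibleShift N α b c lam) {k : ℝ} (hk : 0 ≤ k) {μ : ℝ} (hμ : 0 < μ)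
    {f u : LpRN N 2} (hf : f ∈ reLe N k)
    (hu : (u, (μ : ℂ) • (u - f)) ∈ formOperatorGraph N α β b c lam) : u ∈ reLe N k := by
  obtain ⟨h1, h2⟩ := hu
  have hp := mem_formDomain_iff.1 h1
  set G := weakGrad (u : RN N → ℂ)
  have ht := hp.trunc hk
  set h := ht.mem.toLp _ with hh
  have hcoe : h =ᵐ[volume] fun x => truncFun k (u x) := ht.mem.coeFn_toLp
  have h3 := h2 h (ht.congr_ae hcoe.symm (ae_eq_refl _)).mem_formDomain
  rw [IsFormPair.form_eq hp.weak ht.weak (ae_eq_refl _) hcoe] at h3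
  have h4 := hp.integrable_formDensity (b := b) hc hlam.1.le ht
  have h5 := ht.integrable_formDensity (b := b) hc hlam.1.le ht
  have h6 : 0 ≤ (∫ x, formDensity α β b c lam x (u x) (G x) (truncFun k (u x))
      (truncGrad k u G x)).re := by
    have h7 := ht.re_form_ge (b := b) hN hα2 hc hlam
    have h8 : (∫ x, formDensity α β b c lam x (truncFun k (u x)) (truncGrad k u G x)
        (truncFun k (u x)) (truncGrad k u G x)).re ≤ (∫ x, formDensity α β b c lam x (u x) (G x)
        (truncFun k (u x)) (truncGrad k u G x)).re := by
      refine (integral_re h5).symm.le.trans (le_trans ?_ (integral_re h4).le)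
      exact integral_mono h5.re h4.re fun x => re_formDensity_trunc_le hc hlam.1.le hk u G x
    refine le_trans ?_ (h7.trans h8)
    have i1 : 0 ≤ ∫ x, ‖truncGrad k u G x‖ ^ 2 := integral_nonneg fun x => by positivity
    have i2 : 0 ≤ ∫ x, ‖x‖ ^ α * ‖truncGrad k u G x‖ ^ 2 := integral_nonneg fun x => by positivity
    have i4 : 0 ≤ ∫ x, ‖x‖ ^ (α - 2) * ‖truncFun k (u x)‖ ^ 2 :=
      integral_nonneg fun x => by positivity
    have i5 : 0 ≤ ∫ x, ‖x‖ ^ β * ‖truncFun k (u x)‖ ^ 2 := integral_nonneg fun x => by positivity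
    positivity
  rw [h3] at h6
  have h9 : inner ℂ h (-((μ : ℂ) • (u - f))) = (μ : ℂ) * inner ℂ h (f - u) := by
    rw [← smul_neg, neg_sub, inner_smul_right]
  rw [h9, Complex.re_ofReal_mul] at h6
  have h10 : 0 ≤ (inner ℂ h (f - u)).re := nonneg_of_mul_nonneg_right h6 hμ
  rw [L2.inner_def] at h10
  have h11 : Integrable (fun x => inner ℂ (h x) ((f - u) x)) volume := L2.integrable_inner _ _
  have h12 : (∫ x, inner ℂ (h x) ((f - u) x)).re = ∫ x, (inner ℂ (h x) ((f - u) x)).re :=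
    (integral_re h11).symm
  rw [h12] at h10
  -- Where `h > 0`, `Re (f - u) ≤ k - Re u = -h`.
  have h13 : ∀ᵐ x, (inner ℂ (h x) ((f - u) x)).re ≤ -‖truncFun k (u x)‖ ^ 2 := by
    filter_upwards [hcoe, Lp.coeFn_sub f u, hf] with x e1 e2 e3
    rw [e1, e2]
    simp only [Pi.sub_apply, RCLike.inner_apply, truncFun, Complex.conj_ofReal,
      Complex.re_mul_ofReal, Complex.sub_re, Complex.norm_real, Real.norm_eq_abs, sq_abs]
    rcases le_total ((u x).re - k) 0 with h | h
    · rw [max_eq_right h]; simp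
    · rw [max_eq_left h]
      nlinarith
  have h14 : 0 ≤ ∫ x, -‖truncFun k (u x)‖ ^ 2 :=
    h10.trans (integral_mono_ae h11.re ht.integrable_normSq.neg h13)
  rw [integral_neg] at h14
  have h15 : ∫ x, ‖truncFun k (u x)‖ ^ 2 = 0 :=
    le_antisymm (by linarith) (integral_nonneg fun x => by positivity)
  have h16 := (integral_eq_zero_iff_of_nonneg (fun x => by positivity)
    ht.integrable_normSq).1 h15
  filter_upwards [h16] with x hx
  have h17 : truncFun k (u x) = 0 := by simpa using hx
  rw [truncFun, Complex.ofReal_eq_zero] at h17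
  have := le_max_left ((u x).re - k) 0
  linarith

variable {M : ℝ} {R : ℝ → LpRN N 2 →L[ℂ] LpRN N 2} {S : ℂ → LpRN N 2 →L[ℂ] LpRN N 2}

/-- The Yosida operator is `μ(Q - 1)` with `Q = μ R(μ)`, so its exponentials are Poisson averages of
powers of an operator that preserves the set. -/
theorem IsYosidaLimit.mem_reLe (hN : 3 ≤ N) (hα2 : α < 2) (hc : 0 ≤ c)
    (hlam : AdmissibleShift N α b c lam)
    (h : IsSectorialResolvent M (formOperatorGraph N α β b c lam) R) (hS : IsYosidaLimit M R S)
    {k : ℝ} (hk : 0 ≤ k) {t : ℝ} (ht : 0 ≤ t) {f : LpRN N 2} (hf : f ∈ reLe N k) :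
    S t f ∈ reLe N k := by
  refine (isClosed_reLe k).mem_of_tendsto (hS t (ofReal_mem_cone ht) f)
    (Eventually.of_forall fun n => ?_)
  have hn : (0 : ℝ) < n + 1 := by positivity
  have hQ : Set.MapsTo ((((n : ℝ) + 1 : ℝ) : ℂ) • R (n + 1)) (reLe N k) (reLe N k) := fun g hg => by
    refine re_le_of_resolvent hN hα2 hc hlam hk hn hg ((h.mem_iff _ hn _ _).2 ?_)
    rw [smul_sub, sub_sub_cancel, map_smul]
    rfl
  have := exp_mem_of_mapsTo (convex_reLe k) (isClosed_reLe k) hQ (mul_nonneg ht hn.le) hf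
  rw [yosida, smul_smul, ← Complex.ofReal_mul]
  exact this

/-- Positivity is the case `k = 0` applied to `-f` and `±i f`. For the `L^∞` bound, apply `k =
‖f‖_∞` to `e^{iq} f`. Rational `q` keep the exceptional sets countable, and continuity then allows
`q = -arg (T f)(x)` at each point. -/
theorem isSubMarkovian_of_reLe {T : ℝ≥0 → LpRN N 2 →L[ℂ] LpRN N 2}
    (hT : ∀ t k, 0 ≤ k → ∀ f ∈ reLe N k, T t f ∈ reLe N k) : IsSubMarkovian T where
  positive t f hf := by
    have h1 := hT t 0 le_rfl (-f) (by
      filter_upwards [hf, Lp.coeFn_neg f] with x h1 h2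
      rw [h2]
      simpa using h1.1)
    have h2 := hT t 0 le_rfl (Complex.I • f) (by
      filter_upwards [hf, Lp.coeFn_smul Complex.I f] with x h1 h2
      rw [h2]
      simp [h1.2])
    have h3 := hT t 0 le_rfl (-(Complex.I • f)) (by
      filter_upwards [hf, Lp.coeFn_smul Complex.I f, Lp.coeFn_neg (Complex.I • f)] with x h1 h2 h3
      rw [h3, Pi.neg_apply, h2]
      simp [h1.2])
    rw [map_neg] at h1
    rw [map_smul] at h2
    rw [map_neg, map_smul] at h3
    filter_upwards [h1, h2, h3, Lp.coeFn_neg (T t f), Lp.coeFn_smul Complex.I (T t f),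
      Lp.coeFn_neg (Complex.I • T t f)] with x e1 e2 e3 e4 e5 e6
    rw [e4] at e1
    rw [e5] at e2
    rw [e6, Pi.neg_apply, e5] at e3
    simp at e1 e2 e3
    exact ⟨e1, le_antisymm e3 e2⟩
  linfty_contractive t f := by
    by_cases htop : eLpNorm f ⊤ volume = ⊤
    · rw [htop]; exact le_top
    set k : ℝ := (eLpNorm f ⊤ volume).toReal with hk
    have hk0 : 0 ≤ k := ENNReal.toReal_nonneg
    have hfk : ∀ᵐ x, ‖f x‖ ≤ k := by
      filter_upwards [ae_le_eLpNormEssSup (f := f) (μ := volume)] with x hx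
      rw [← eLpNorm_exponent_top] at hx
      have := ENNReal.toReal_mono htop hx
      rwa [toReal_enorm] at this
    have h1 : ∀ q : ℚ, ∀ᵐ x, (Complex.exp ((q : ℝ) * Complex.I) * T t f x).re ≤ k := fun q => by
      have h2 := hT t k hk0 (Complex.exp ((q : ℝ) * Complex.I) • f) (by
        filter_upwards [hfk, Lp.coeFn_smul (Complex.exp ((q : ℝ) * Complex.I)) f] with x h1 h2
        rw [h2]
        refine (Complex.re_le_norm _).trans ?_
        rw [Pi.smul_apply, norm_smul, Complex.norm_exp_ofReal_mul_I, one_mul]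
        exact h1)
      rw [map_smul] at h2
      filter_upwards [h2, Lp.coeFn_smul (Complex.exp ((q : ℝ) * Complex.I)) (T t f)] with x h3 h4
      rw [h4] at h3
      exact h3
    have h2 : ∀ᵐ x, ‖T t f x‖ ≤ k := by
      filter_upwards [ae_all_iff.2 h1] with x hx
      have h3 : ∀ s : ℝ, (Complex.exp (s * Complex.I) * T t f x).re ≤ k := by
        have hcl : IsClosed {s : ℝ | (Complex.exp (s * Complex.I) * T t f x).re ≤ k} :=
          isClosed_le (by fun_prop) continuous_const
        have hd : Dense (Set.range ((↑) : ℚ → ℝ)) := Rat.isDenseEmbedding_coe_real.dense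
        intro s
        exact hcl.closure_subset_iff.2 (by rintro _ ⟨q, rfl⟩; exact hx q) (hd s)
      have h4 := h3 (-(T t f x).arg)
      have h5 : Complex.exp (((-(T t f x).arg : ℝ) : ℂ) * Complex.I) * T t f x =
          ((‖T t f x‖ : ℝ) : ℂ) := by
        conv_lhs => rw [← Complex.norm_mul_exp_arg_mul_I (T t f x)]
        rw [mul_left_comm, ← Complex.exp_add]
        simp
      rw [h5, Complex.ofReal_re] at h4
      exact h4
    have h3 := eLpNormEssSup_le_of_ae_bound h2
    rw [eLpNorm_exponent_top]
    refine h3.trans ?_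
    rw [hk, ENNReal.ofReal_toReal htop]

end SubMarkov

/-! ### Simple approximation and the converse of Hölder's inequality -/

section Holder

variable {X : Type*} [MeasurableSpace X] {μ : Measure X}

/-- A single sequence serves every finite exponent at once. This is what makes extensions to
different `L^p` spaces comparable. -/
theorem exists_simple_approx {f : X → ℂ} (hf : AEStronglyMeasurable f μ) :
    ∃ s : ℕ → SimpleFunc X ℂ, (∀ᵐ x ∂μ, Tendsto (fun n => s n x) atTop (𝓝 (f x))) ∧
      (∀ᵐ x ∂μ, ∀ n, ‖s n x‖ ≤ ‖f x‖ + ‖f x‖) ∧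
      ∀ q : ℝ≥0∞, q ≠ ⊤ → MemLp f q μ → (∀ n, MemLp (s n) q μ) ∧
        Tendsto (fun n => eLpNorm (fun x => s n x - f x) q μ) atTop (𝓝 0) := by
  set f' := hf.mk f with hf'
  have hm : Measurable f' := hf.stronglyMeasurable_mk.measurable
  have hae : f =ᵐ[μ] f' := hf.ae_eq_mk
  have h0 : (0 : ℂ) ∈ Set.range f' ∪ {0} := by simp
  refine ⟨fun n => SimpleFunc.approxOn f' hm (Set.range f' ∪ {0}) 0 h0 n, ?_, ?_, ?_⟩
  · filter_upwards [hae] with x hx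
    rw [hx]
    exact SimpleFunc.tendsto_approxOn hm h0 (subset_closure (by simp))
  · filter_upwards [hae] with x hx n
    rw [hx]
    exact SimpleFunc.norm_approxOn_zero_le hm h0 x n
  · intro q hq hfq
    have hfq' : MemLp f' q μ := hfq.ae_eq hae
    refine ⟨fun n => SimpleFunc.memLp_approxOn_range hm hfq' n, ?_⟩
    refine (SimpleFunc.tendsto_approxOn_range_Lp_eLpNorm hq hm hfq'.2).congr fun n => ?_
    refine eLpNorm_congr_ae ?_
    filter_upwards [hae] with x hx
    simp [hx]

theorem enorm_integral_conj_mul_le {g h : X → ℂ} (hg : AEStronglyMeasurable g μ)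
    (hh : AEStronglyMeasurable h μ) (p q : ℝ≥0∞) [ENNReal.HolderConjugate q p] :
    ‖∫ x, conj (g x) * h x ∂μ‖ₑ ≤ eLpNorm g q μ * eLpNorm h p μ := by
  refine (enorm_integral_le_lintegral_enorm _).trans ?_
  rw [← eLpNorm_one_eq_lintegral_enorm]
  have := eLpNorm_le_eLpNorm_mul_eLpNorm_of_nnnorm (p := q) (q := p) (r := 1) hg hh
    (fun a b => conj a * b) 1 (Eventually.of_forall fun x => by simp)
  simpa using this

theorem holderConjugate_ofReal {r q : ℝ} (h : r.HolderConjugate q) :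
    ENNReal.HolderConjugate (ENNReal.ofReal q) (ENNReal.ofReal r) := by
  rw [ENNReal.holderConjugate_iff, ← ENNReal.ofReal_inv_of_pos h.symm.pos,
    ← ENNReal.ofReal_inv_of_pos h.pos, ← ENNReal.ofReal_add (inv_nonneg.2 h.symm.nonneg)
    (inv_nonneg.2 h.nonneg), h.symm.inv_add_inv_eq_one, ENNReal.ofReal_one]

theorem enorm_pairing_le_of_simple {h : X → ℂ} (hh : AEStronglyMeasurable h μ) {q : ℝ≥0∞}
    (hq0 : q ≠ 0) (hq : q ≠ ⊤) (hq1 : 1 ≤ q) {C : ℝ≥0∞} (hC : C ≠ ⊤)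
    (H : ∀ g : SimpleFunc X ℂ, g.FinMeasSupp μ →
      ‖∫ x, conj (g x) * h x ∂μ‖ₑ ≤ C * eLpNorm g q μ)
    {G : X → ℂ} (hG : MemLp G q μ) (hint : Integrable (fun x => ‖G x‖ * ‖h x‖) μ) :
    ‖∫ x, conj (G x) * h x ∂μ‖ₑ ≤ C * eLpNorm G q μ := by
  obtain ⟨s, h1, h2, h3⟩ := exists_simple_approx hG.1
  obtain ⟨h4, h5⟩ := h3 q hq hG
  have hlim : Tendsto (fun n => ∫ x, conj (s n x) * h x ∂μ) atTop
      (𝓝 (∫ x, conj (G x) * h x ∂μ)) := by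
    refine tendsto_integral_of_dominated_convergence (fun x => 2 * (‖G x‖ * ‖h x‖)) (fun n => ?_)
      (hint.const_mul 2) (fun n => ?_) ?_
    · exact (Complex.continuous_conj.comp_aestronglyMeasurable (s n).aestronglyMeasurable).mul hh
    · filter_upwards [h2] with x hx
      rw [norm_mul, Complex.norm_conj]
      calc ‖s n x‖ * ‖h x‖ ≤ (‖G x‖ + ‖G x‖) * ‖h x‖ := by gcongr; exact hx n
        _ = _ := by ring
    · filter_upwards [h1] with x hx
      exact ((Complex.continuous_conj.tendsto _).comp hx).mul_const _
  have hlim2 : Tendsto (fun n => C * (eLpNorm G q μ + eLpNorm (fun x => s n x - G x) q μ)) atTop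
      (𝓝 (C * (eLpNorm G q μ + 0))) :=
    ENNReal.Tendsto.const_mul (tendsto_const_nhds.add h5) (Or.inr hC)
  rw [add_zero] at hlim2
  refine le_of_tendsto_of_tendsto' hlim.enorm hlim2 fun n => ?_
  refine (H (s n) ((SimpleFunc.memLp_iff_finMeasSupp hq0 hq).1 (h4 n))).trans ?_
  gcongr
  have h6 := eLpNorm_add_le hG.1 ((h4 n).1.sub hG.1) hq1
  refine le_trans (le_of_eq ?_) h6
  congr 1
  funext x
  simp

/-- That `h` lies in `L^r` is part of the conclusion. So `h` is first cut to `1/(n+1) ≤ |h| ≤ n+1`,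
where Chebyshev in `L^s` gives finite measure, and Fatou removes the cut. -/
theorem eLpNorm_le_of_simple_pairing {h : X → ℂ} {s : ℝ≥0∞} (hs : MemLp h s μ) (hs0 : s ≠ 0)
    (hs1 : s ≠ ⊤) {r q : ℝ} (hrq : r.HolderConjugate q) {C : ℝ≥0∞} (hC : C ≠ ⊤)
    (H : ∀ g : SimpleFunc X ℂ, g.FinMeasSupp μ →
      ‖∫ x, conj (g x) * h x ∂μ‖ₑ ≤ C * eLpNorm g (ENNReal.ofReal q) μ) :
    eLpNorm h (ENNReal.ofReal r) μ ≤ C := by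
  wlog hm : Measurable h generalizing h
  · have hae := hs.1.ae_eq_mk
    rw [eLpNorm_congr_ae hae]
    refine this (hs.ae_eq hae) (fun g hg => ?_) hs.1.stronglyMeasurable_mk.measurable
    refine le_of_eq_of_le ?_ (H g hg)
    congr 1
    refine integral_congr_ae ?_
    filter_upwards [hae] with x hx
    rw [← hx]
  have hr0 := hrq.pos
  have hq0 := hrq.symm.pos
  have hr1 := hrq.lt
  set E : ℕ → Set X := fun n => {x | 1 / ((n : ℝ) + 1) ≤ ‖h x‖ ∧ ‖h x‖ ≤ n + 1} with hE
  have hEm : ∀ n, MeasurableSet (E n) := fun n =>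
    (measurableSet_le measurable_const hm.norm).inter (measurableSet_le hm.norm measurable_const)
  have hEf : ∀ n, μ (E n) < ⊤ := fun n => by
    have h1 : (0 : ℝ) < 1 / ((n : ℝ) + 1) := by positivity
    have h2 := hs.meas_ge_lt_top hs0 hs1 (ε := ⟨1 / ((n : ℝ) + 1), h1.le⟩)
      (fun h => h1.ne' (congrArg NNReal.toReal h))
    refine lt_of_le_of_lt (measure_mono fun x hx => ?_) h2
    exact hx.1
  set k : ℕ → X → ℂ := fun n => (E n).indicator h with hk
  have hkm : ∀ n, Measurable (k n) := fun n => hm.indicator (hEm n)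
  have hkL : ∀ n t, MemLp (k n) t μ := fun n t => by
    rw [hk, memLp_indicator_iff_restrict (hEm n)]
    have : IsFiniteMeasure (μ.restrict (E n)) := ⟨by simpa using hEf n⟩
    refine MemLp.of_bound hm.aestronglyMeasurable (n + 1) ?_
    filter_upwards [ae_restrict_mem (hEm n)] with x hx
    exact hx.2
  have key : ∀ n, eLpNorm (k n) (ENNReal.ofReal r) μ ≤ C := by
    intro n
    -- The extremal function in Hölder's inequality: `conj G · h = |k_n|^r` and `‖G‖_q =
    -- ‖k_n‖_r^{r-1}`. Dividing by this finite norm gives the bound.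
    set G : X → ℂ := fun x => ((‖k n x‖ ^ (r - 2) : ℝ) : ℂ) * k n x with hG
    have hGn : ∀ x, ‖G x‖ = ‖k n x‖ ^ (r - 1) := fun x => by
      by_cases h0 : k n x = 0
      · simp [hG, h0, Real.zero_rpow (by linarith : r - 1 ≠ 0)]
      · rw [hG, norm_mul, Complex.norm_real, Real.norm_of_nonneg (by positivity),
          show r - 1 = (r - 2) + 1 by ring, Real.rpow_add_one (norm_ne_zero_iff.2 h0)]
    have hGm : Measurable G := by
      have := hkm n
      fun_prop
    have hGe : eLpNorm G (ENNReal.ofReal q) μ =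
        eLpNorm (k n) (ENNReal.ofReal r) μ ^ (r - 1) := by
      have h1 := eLpNorm_norm_rpow (μ := μ) (p := ENNReal.ofReal q) (k n)
        (by linarith : 0 < r - 1)
      rw [← ENNReal.ofReal_mul hq0.le, show q * (r - 1) = r by
        have := hrq.sub_one_mul_conj; linarith] at h1
      rw [← h1]
      refine eLpNorm_congr_norm_ae (Eventually.of_forall fun x => ?_)
      rw [hGn, Real.norm_of_nonneg (by positivity)]
    have hfin : eLpNorm (k n) (ENNReal.ofReal r) μ ≠ ⊤ := (hkL n _).2.ne
    have hGL : MemLp G (ENNReal.ofReal q) μ :=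
      ⟨hGm.aestronglyMeasurable, by
        rw [hGe]; exact ENNReal.rpow_lt_top_of_nonneg (by linarith) hfin⟩
    have hGh : ∀ x, conj (G x) * h x = ((‖k n x‖ ^ r : ℝ) : ℂ) := fun x => by
      by_cases hx : x ∈ E n
      · have h1 : k n x = h x := Set.indicator_of_mem hx h
        have h2 : h x ≠ 0 := by
          have h3 := hx.1
          have h4 : (0 : ℝ) < 1 / ((n : ℝ) + 1) := by positivity
          exact norm_pos_iff.1 (h4.trans_le h3)
        rw [hG]
        simp only [h1, map_mul, Complex.conj_ofReal]
        rw [mul_assoc, Complex.conj_mul', ← Complex.ofReal_pow, ← Complex.ofReal_mul,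
          ← Real.rpow_natCast, ← Real.rpow_add (norm_pos_iff.2 h2)]
        norm_num
      · have h1 : k n x = 0 := Set.indicator_of_notMem hx h
        simp [hG, h1, Real.zero_rpow hr0.ne']
    have hkr : Integrable (fun x => ‖k n x‖ ^ r) μ := by
      have := (hkL n (ENNReal.ofReal r)).integrable_norm_rpow (by simpa using hr0)
        ENNReal.ofReal_ne_top
      simpa [ENNReal.toReal_ofReal hr0.le] using this
    have hint : Integrable (fun x => ‖G x‖ * ‖h x‖) μ := by
      refine hkr.congr (Eventually.of_forall fun x => ?_)
      beta_reduce
      have h1 := congrArg norm (hGh x)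
      rw [norm_mul, Complex.norm_conj, Complex.norm_real,
        Real.norm_of_nonneg (by positivity)] at h1
      exact h1.symm
    have hmain := enorm_pairing_le_of_simple hs.1 (by simpa using hq0) ENNReal.ofReal_ne_top
      (by simpa using hrq.symm.lt.le) hC H hGL hint
    simp only [hGh] at hmain
    rw [integral_complex_ofReal, hGe] at hmain
    have hI : ‖((∫ x, ‖k n x‖ ^ r ∂μ : ℝ) : ℂ)‖ₑ = eLpNorm (k n) (ENNReal.ofReal r) μ ^ r := by
      have h1 : ‖((∫ x, ‖k n x‖ ^ r ∂μ : ℝ) : ℂ)‖ₑ = ENNReal.ofReal (∫ x, ‖k n x‖ ^ r ∂μ) := by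
        rw [← ofReal_norm, Complex.norm_real,
          Real.norm_of_nonneg (integral_nonneg fun x => by positivity)]
      rw [h1, ofReal_integral_eq_lintegral_ofReal hkr
        (Eventually.of_forall fun x => by positivity),
        eLpNorm_eq_lintegral_rpow_enorm_toReal (by simpa using hr0) ENNReal.ofReal_ne_top,
        ENNReal.toReal_ofReal hr0.le, ← ENNReal.rpow_mul, one_div, inv_mul_cancel₀ hr0.ne',
        ENNReal.rpow_one]
      refine lintegral_congr fun x => ?_
      rw [← ofReal_norm, ENNReal.ofReal_rpow_of_nonneg (norm_nonneg _) hr0.le]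
    rw [hI] at hmain
    set K := eLpNorm (k n) (ENNReal.ofReal r) μ with hK
    by_cases hK0 : K = 0
    · rw [hK0]; exact zero_le
    have h5 : K ^ r = K * K ^ (r - 1) := by
      conv_rhs => rw [← ENNReal.rpow_one K, ← ENNReal.rpow_mul, one_mul,
        ← ENNReal.rpow_add _ _ hK0 hfin]
      congr 1
      ring
    rw [h5] at hmain
    have h6 : K ^ (r - 1) ≠ 0 := by
      simp [ENNReal.rpow_eq_zero_iff, hK0, hfin]
    have h7 : K ^ (r - 1) ≠ ⊤ := (ENNReal.rpow_lt_top_of_nonneg (by linarith) hfin).ne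
    exact (ENNReal.mul_le_mul_iff_left h6 h7).1 hmain
  refine (Lp.eLpNorm_lim_le_liminf_eLpNorm (fun n => (hkm n).aestronglyMeasurable) h
    (Eventually.of_forall fun x => ?_)).trans ?_
  · refine tendsto_const_nhds.congr' ?_
    by_cases h0 : h x = 0
    · refine Eventually.of_forall fun n => ?_
      by_cases hx : x ∈ E n
      · exact (Set.indicator_of_mem hx h).symm
      · rw [h0]; exact (Set.indicator_of_notMem hx h).symm
    · have h1 : 0 < ‖h x‖ := norm_pos_iff.2 h0
      obtain ⟨n₁, hn₁⟩ := exists_nat_one_div_lt h1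
      obtain ⟨n₂, hn₂⟩ := exists_nat_ge ‖h x‖
      filter_upwards [eventually_ge_atTop n₁, eventually_ge_atTop n₂] with n e1 e2
      refine (Set.indicator_of_mem (s := E n) ⟨?_, ?_⟩ h).symm
      · refine le_trans ?_ hn₁.le
        gcongr
      · have : (n₂ : ℝ) ≤ n := by exact_mod_cast e2
        linarith
  · exact liminf_le_of_le (by isBoundedDefault) fun b hb => by
      obtain ⟨n, hn⟩ := hb.exists
      exact hn.trans (key n)

/-- The square integrable functions with `L^p` norm at most `C` form a closed set. -/
theorem isClosed_eLpNorm_le (p C : ℝ≥0∞) :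
    IsClosed {f : Lp ℂ 2 μ | eLpNorm f p μ ≤ C} := by
  refine IsSeqClosed.isClosed fun f g hf hg => ?_
  obtain ⟨ns, -, hns⟩ := (tendstoInMeasure_of_tendsto_Lp hg).exists_seq_tendsto_ae
  refine (Lp.eLpNorm_lim_le_liminf_eLpNorm (fun n => Lp.aestronglyMeasurable (f (ns n))) g
    hns).trans ?_
  exact liminf_le_of_le (by isBoundedDefault) fun b hb => by
      obtain ⟨n, hn⟩ := hb.exists
      exact hn.trans (hf (ns n))

end Holder

/-! ### Complex interpolation -/

section Stein

/-- `|a|^s a/|a|`, an analytic function of `s`. -/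
def interpFn (s a : ℂ) : ℂ :=
  if a = 0 then 0 else Complex.exp (s * (Real.log ‖a‖ : ℝ)) * (a / (‖a‖ : ℝ))

theorem interpFn_zero (s : ℂ) : interpFn s 0 = 0 := by simp [interpFn]

theorem interpFn_one (a : ℂ) : interpFn 1 a = a := by
  rw [interpFn]
  split_ifs with h
  · exact h.symm
  · have h1 : 0 < ‖a‖ := norm_pos_iff.2 h
    rw [one_mul, ← Complex.ofReal_exp, Real.exp_log h1, mul_div_cancel₀]
    exact Complex.ofReal_ne_zero.2 h1.ne'

theorem norm_interpFn {a : ℂ} (ha : a ≠ 0) (s : ℂ) : ‖interpFn s a‖ = ‖a‖ ^ s.re := by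
  have h1 : 0 < ‖a‖ := norm_pos_iff.2 ha
  rw [interpFn, if_neg ha, norm_mul, Complex.norm_exp, Complex.re_mul_ofReal, norm_div,
    Complex.norm_real, norm_norm, div_self h1.ne', mul_one, Real.rpow_def_of_pos h1, mul_comm]

theorem norm_interpFn_of_pos (a : ℂ) {s : ℂ} (hs : 0 < s.re) : ‖interpFn s a‖ = ‖a‖ ^ s.re := by
  by_cases ha : a = 0
  · rw [ha, interpFn_zero, norm_zero, Real.zero_rpow hs.ne']
  · exact norm_interpFn ha s

theorem norm_interpFn_le_one (a : ℂ) {s : ℂ} (hs : s.re = 0) : ‖interpFn s a‖ ≤ 1 := by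
  by_cases ha : a = 0
  · rw [ha, interpFn_zero, norm_zero]; exact zero_le_one
  · rw [norm_interpFn ha, hs, Real.rpow_zero]

theorem norm_interpFn_le (a s : ℂ) {c : ℝ} (hs : |s.re| ≤ c) :
    ‖interpFn s a‖ ≤ Real.exp (c * |Real.log ‖a‖|) := by
  by_cases ha : a = 0
  · rw [ha, interpFn_zero, norm_zero]; positivity
  · rw [norm_interpFn ha, Real.rpow_def_of_pos (norm_pos_iff.2 ha)]
    refine Real.exp_le_exp.2 ((le_abs_self _).trans ?_)
    rw [abs_mul, mul_comm]
    gcongr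

theorem differentiable_interpFn (a : ℂ) : Differentiable ℂ fun s => interpFn s a := by
  unfold interpFn
  by_cases ha : a = 0
  · simp [ha]
  · simp only [ha, if_false]
    fun_prop

theorem conj_interpFn (s a : ℂ) : conj (interpFn s a) = interpFn (conj s) (conj a) := by
  unfold interpFn
  by_cases ha : a = 0
  · simp [ha]
  · have : conj a ≠ 0 := by simpa using ha
    simp only [ha, this, if_false, map_mul, map_div₀, ← Complex.exp_conj, Complex.conj_ofReal,
      Complex.norm_conj]

variable {X : Type*} [MeasurableSpace X] {μ : Measure X}

/-- The element of `L²` defined by a function of a simple function. -/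
def simpleLp (f : SimpleFunc X ℂ) (hf : f.FinMeasSupp μ) (ψ : ℂ → ℂ) (hψ : ψ 0 = 0) : Lp ℂ 2 μ :=
  ((SimpleFunc.memLp_iff_finMeasSupp two_ne_zero ENNReal.ofNat_ne_top).2 (hf.map hψ) :
    MemLp (f.map ψ) 2 μ).toLp _

theorem coeFn_simpleLp (f : SimpleFunc X ℂ) (hf : f.FinMeasSupp μ) (ψ : ℂ → ℂ) (hψ : ψ 0 = 0) :
    simpleLp f hf ψ hψ =ᵐ[μ] fun x => ψ (f x) :=
  MemLp.coeFn_toLp _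

-- The finite expansion isolates the dependence on `ψ` in scalar coefficients, from which holomorphy
-- and boundedness in the interpolation parameter can be read off. The condition `y ≠ 0` keeps the
-- level functions of finite support.
open Classical in
theorem simpleLp_eq_sum (f : SimpleFunc X ℂ) (hf : f.FinMeasSupp μ) (ψ : ℂ → ℂ) (hψ : ψ 0 = 0) :
    simpleLp f hf ψ hψ = ∑ a ∈ f.range, ψ a •
      simpleLp f hf (fun y => if y = a ∧ y ≠ 0 then 1 else 0) (by simp) := by
  refine Lp.ext ?_
  have h1 : ∀ᵐ x ∂μ, ∀ a ∈ f.range, (ψ a •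
      simpleLp f hf (fun y => if y = a ∧ y ≠ 0 then 1 else 0) (by simp)) x =
      ψ a * if f x = a ∧ f x ≠ 0 then 1 else 0 := by
    refine (Finset.eventually_all f.range).2 fun a _ => ?_
    filter_upwards [Lp.coeFn_smul (ψ a) (simpleLp f hf (fun y => if y = a ∧ y ≠ 0 then 1 else 0)
      (by simp)), coeFn_simpleLp f hf (fun y => if y = a ∧ y ≠ 0 then 1 else 0) (by simp)]
      with x e1 e2
    rw [e1, Pi.smul_apply, e2, smul_eq_mul]
  filter_upwards [h1, coeFn_simpleLp f hf ψ hψ, Lp.coeFn_finsetSum f.range (fun a => ψ a •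
      simpleLp f hf (fun y => if y = a ∧ y ≠ 0 then 1 else 0) (by simp))] with x h1 h2 h3
  rw [h2, h3, Finset.sum_apply, Finset.sum_congr rfl h1]
  by_cases h0 : f x = 0
  · simp [h0, hψ]
  · simp [h0, Finset.sum_ite_eq]

variable {S : ℂ → Lp ℂ 2 μ →L[ℂ] Lp ℂ 2 μ} {θ : ℝ}

theorem exp_mem_sector (hθ : θ ≤ Real.pi / 2) {w : ℂ} (hw : |w.im| < θ) :
    Complex.exp w ∈ sector θ := by
  refine ⟨Complex.exp_ne_zero _, ?_⟩
  have hpi := Real.pi_pos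
  have h1 := abs_lt.1 hw
  have h2 := Complex.log_exp (x := w) (by linarith) (by linarith)
  rw [← Complex.log_im, h2]
  exact hw

/-- A three lines argument with the time variable also moving holomorphically: time is positive on
`Re ζ = 0`, where only `L^∞` contractivity is known, and ranges over the sector on `Re ζ = 1`, where
`L²` contractivity holds. -/
theorem stein_interpolation (hθ : θ ≤ Real.pi / 2)
    (hd : DifferentiableOn ℂ S (sector θ)) (hb : ∀ z ∈ sector θ, ‖S z‖ ≤ 1)
    (hinf : ∀ t : ℝ, 0 < t → ∀ f, eLpNorm (S t f) ⊤ μ ≤ eLpNorm f ⊤ μ)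
    {r q : ℝ} (hrq : r.HolderConjugate q) (hr : 2 ≤ r) {z : ℂ} (hz : z ∈ sector (2 / r * θ))
    (f g : SimpleFunc X ℂ) (hf : f.FinMeasSupp μ) (hg : g.FinMeasSupp μ) :
    ‖inner ℂ (simpleLp g hg id rfl) (S z (simpleLp f hf id rfl))‖ ≤
      (eLpNorm f (ENNReal.ofReal r) μ).toReal * (eLpNorm g (ENNReal.ofReal q) μ).toReal := by
  have hr0 := hrq.pos
  have hq0 := hrq.symm.pos
  -- The factor `r/2` makes the path `ζ ↦ exp(W ζ)` pass through `z` at `ζ = 2/r`. The hypothesis on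
  -- `z` is `|κ| < θ`, so the closed strip stays in the sector.
  set κ : ℝ := r / 2 * z.arg with hκ
  have hκθ : |κ| < θ := by
    rw [hκ, abs_mul, abs_of_pos (by positivity)]
    calc r / 2 * |z.arg| < r / 2 * (2 / r * θ) := by gcongr; exact hz.2
      _ = θ := by field_simp
  set W : ℂ → ℂ := fun ζ => (Real.log ‖z‖ : ℝ) + (κ : ℂ) * Complex.I * ζ with hW
  have hWim : ∀ ζ, (W ζ).im = κ * ζ.re := fun ζ => by
    simp [hW, mul_assoc, Complex.mul_im]
  set U : Set ℂ := {ζ | |κ * ζ.re| < θ} with hU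
  have hUo : IsOpen U := isOpen_lt (by fun_prop) continuous_const
  have hstrip : Complex.HadamardThreeLines.verticalClosedStrip 0 1 ⊆ U := fun ζ hζ => by
    have h1 : 0 ≤ ζ.re := hζ.1
    have h2 : ζ.re ≤ 1 := hζ.2
    change |κ * ζ.re| < θ
    rw [abs_mul, abs_of_nonneg h1]
    exact (mul_le_of_le_one_right (abs_nonneg _) h2).trans_lt hκθ
  have hWU : ∀ ζ ∈ U, Complex.exp (W ζ) ∈ sector θ := fun ζ hζ =>
    exp_mem_sector hθ (by rw [hWim]; exact hζ)
  -- Both exponents equal `1` at `ζ = 2/r`. At `Re ζ = 0` they have real parts `0` and `q`, at `Re ζ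
  -- = 1` real parts `r/2` and `q/2`.
  set s : ℂ → ℂ := fun ζ => (r / 2 : ℝ) * ζ with hs
  set s' : ℂ → ℂ := fun ζ => (q : ℝ) * (1 - ζ / 2) with hs'
  set fζ : ℂ → Lp ℂ 2 μ := fun ζ => simpleLp f hf (interpFn (s ζ)) (interpFn_zero _) with hfζ
  -- The exponent is conjugated because the inner product conjugates its first argument, so that `F`
  -- is holomorphic.
  set gζ : ℂ → Lp ℂ 2 μ := fun ζ => simpleLp g hg (interpFn (conj (s' ζ))) (interpFn_zero _)
    with hgζ
  set F : ℂ → ℂ := fun ζ => inner ℂ (gζ ζ) (S (Complex.exp (W ζ)) (fζ ζ)) with hF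
  classical
  set df : ℂ → Lp ℂ 2 μ := fun a =>
    simpleLp f hf (fun y => if y = a ∧ y ≠ 0 then 1 else 0) (by simp) with hdf
  set dg : ℂ → Lp ℂ 2 μ := fun a =>
    simpleLp g hg (fun y => if y = a ∧ y ≠ 0 then 1 else 0) (by simp) with hdg
  have hFsum : ∀ ζ, F ζ = ∑ b ∈ g.range, ∑ a ∈ f.range,
      interpFn (s' ζ) (conj b) * (interpFn (s ζ) a *
        inner ℂ (dg b) (S (Complex.exp (W ζ)) (df a))) := fun ζ => by
    simp only [hF, hfζ, hgζ]
    rw [simpleLp_eq_sum f, simpleLp_eq_sum g, sum_inner]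
    refine Finset.sum_congr rfl fun b _ => ?_
    rw [map_sum, inner_sum]
    refine Finset.sum_congr rfl fun a _ => ?_
    rw [map_smul, inner_smul_left, inner_smul_right, conj_interpFn, Complex.conj_conj]
  have hFd : DifferentiableOn ℂ F U := by
    rw [show F = _ from funext hFsum]
    refine DifferentiableOn.fun_sum fun b _ => DifferentiableOn.fun_sum fun a _ => ?_
    have h1 : Differentiable ℂ fun ζ => interpFn (s' ζ) (conj b) :=
      (differentiable_interpFn _).comp (by simp only [hs']; fun_prop)
    have h2 : Differentiable ℂ fun ζ => interpFn (s ζ) a :=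
      (differentiable_interpFn _).comp (by simp only [hs]; fun_prop)
    have h3 : DifferentiableOn ℂ (fun ζ => S (Complex.exp (W ζ))) U :=
      hd.comp (Differentiable.differentiableOn (by simp only [hW]; fun_prop)) hWU
    have h4 : DifferentiableOn ℂ (fun ζ => inner ℂ (dg b) (S (Complex.exp (W ζ)) (df a))) U :=
      (innerSL ℂ (dg b)).differentiable.comp_differentiableOn
        (h3.clm_apply (differentiableOn_const _))
    exact h1.differentiableOn.mul (h2.differentiableOn.mul h4)
  have hFb : BddAbove ((norm ∘ F) '' Complex.HadamardThreeLines.verticalClosedStrip 0 1) := by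
    refine ⟨∑ b ∈ g.range, ∑ a ∈ f.range, Real.exp (q * |Real.log ‖conj b‖|) *
      (Real.exp (r / 2 * |Real.log ‖a‖|) * (‖dg b‖ * ‖df a‖)), ?_⟩
    rintro _ ⟨ζ, hζ, rfl⟩
    have h1 : 0 ≤ ζ.re := hζ.1
    have h2 : ζ.re ≤ 1 := hζ.2
    simp only [Function.comp_apply]
    rw [hFsum]
    refine (norm_sum_le _ _).trans (Finset.sum_le_sum fun b _ => ?_)
    refine (norm_sum_le _ _).trans (Finset.sum_le_sum fun a _ => ?_)
    rw [norm_mul, norm_mul]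
    have e1 : |(s' ζ).re| ≤ q := by
      have : (s' ζ).re = q * (1 - ζ.re / 2) := by simp [hs']
      rw [this, abs_of_nonneg (mul_nonneg hq0.le (by linarith))]
      exact mul_le_of_le_one_right hq0.le (by linarith)
    have e2 : |(s ζ).re| ≤ r / 2 := by
      have : (s ζ).re = r / 2 * ζ.re := by simp only [hs, Complex.re_ofReal_mul]
      rw [this, abs_of_nonneg (by positivity)]
      exact mul_le_of_le_one_right (by positivity) h2
    have e3 : ‖S (Complex.exp (W ζ)) (df a)‖ ≤ ‖df a‖ := by
      simpa using ContinuousLinearMap.le_of_opNorm_le _ (hb _ (hWU ζ (hstrip hζ))) (df a)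
    gcongr
    · exact norm_interpFn_le _ _ e1
    · exact norm_interpFn_le _ _ e2
    · exact (norm_inner_le_norm _ _).trans (by gcongr)
  set Fp := eLpNorm f (ENNReal.ofReal r) μ with hFp
  set Gq := eLpNorm g (ENNReal.ofReal q) μ with hGq
  have hFpt : Fp ≠ ⊤ := ((SimpleFunc.memLp_iff_finMeasSupp (by simpa using hr0)
    ENNReal.ofReal_ne_top).2 hf).2.ne
  have hGqt : Gq ≠ ⊤ := ((SimpleFunc.memLp_iff_finMeasSupp (by simpa using hq0)
    ENNReal.ofReal_ne_top).2 hg).2.ne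
  have hpow : ∀ (k : SimpleFunc X ℂ) (hk : k.FinMeasSupp μ) (w : ℂ) (hw : 0 < w.re) (p : ℝ≥0∞),
      eLpNorm (simpleLp k hk (interpFn w) (interpFn_zero _)) p μ =
        eLpNorm k (p * ENNReal.ofReal w.re) μ ^ w.re := by
    intro k hk w hw p
    rw [← eLpNorm_norm_rpow k hw, eLpNorm_congr_ae (coeFn_simpleLp k hk _ _)]
    refine eLpNorm_congr_norm_ae (Eventually.of_forall fun x => ?_)
    rw [norm_interpFn_of_pos _ hw, Real.norm_of_nonneg (by positivity)]
  -- Here `|fζ| ≤ 1`, time is real, and `‖gζ‖₁ = ‖g‖_q^q`.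
  have hleft : ∀ ζ ∈ Complex.re ⁻¹' {0}, ‖F ζ‖ ≤ Gq.toReal ^ q := by
    intro ζ hζ
    have hζ0 : ζ.re = 0 := hζ
    have hreal : Complex.exp (W ζ) = ((Real.exp (W ζ).re : ℝ) : ℂ) := by
      rw [Complex.ofReal_exp]
      congr 1
      refine Complex.ext (by simp) ?_
      rw [hWim, hζ0, mul_zero, Complex.ofReal_im]
    have h1 : eLpNorm (S (Complex.exp (W ζ)) (fζ ζ)) ⊤ μ ≤ 1 := by
      rw [hreal]
      refine (hinf _ (Real.exp_pos _) _).trans ?_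
      rw [eLpNorm_congr_ae (coeFn_simpleLp f hf _ _), eLpNorm_exponent_top]
      refine (eLpNormEssSup_le_of_ae_bound (C := 1) (Eventually.of_forall fun x => ?_)).trans
        (by simp)
      refine norm_interpFn_le_one _ ?_
      simp only [hs, Complex.re_ofReal_mul, hζ0, mul_zero]
    have h2 : eLpNorm (gζ ζ) 1 μ = Gq ^ q := by
      have e : (conj (s' ζ)).re = q := by
        simp only [hs', Complex.conj_re, Complex.re_ofReal_mul, Complex.sub_re, Complex.one_re,
          Complex.div_ofNat_re, hζ0]
        ring
      have := hpow g hg (conj (s' ζ)) (by rw [e]; exact hq0) 1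
      rw [e, one_mul] at this
      exact this
    have h3 := enorm_integral_conj_mul_le (Lp.aestronglyMeasurable (gζ ζ))
      (Lp.aestronglyMeasurable (S (Complex.exp (W ζ)) (fζ ζ))) ⊤ 1
    have h4 : ‖F ζ‖ₑ ≤ Gq ^ q := by
      rw [h2] at h3
      calc ‖F ζ‖ₑ = ‖∫ x, conj (gζ ζ x) * (S (Complex.exp (W ζ)) (fζ ζ)) x ∂μ‖ₑ := by
            simp only [hF]
            rw [L2.inner_def]
            simp only [RCLike.inner_apply, mul_comm]
        _ ≤ Gq ^ q * 1 := h3.trans (by gcongr)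
        _ = Gq ^ q := mul_one _
    rw [ENNReal.toReal_rpow, ← toReal_enorm]
    exact ENNReal.toReal_mono (ENNReal.rpow_lt_top_of_nonneg hq0.le hGqt).ne h4
  have hright : ∀ ζ ∈ Complex.re ⁻¹' {1}, ‖F ζ‖ ≤ Gq.toReal ^ (q / 2) * Fp.toReal ^ (r / 2) := by
    intro ζ hζ
    have hζ1 : ζ.re = 1 := hζ
    have hζs : ζ ∈ Complex.HadamardThreeLines.verticalClosedStrip 0 1 := by
      change ζ.re ∈ Set.Icc (0 : ℝ) 1
      rw [hζ1]
      simp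
    have h1 : ‖fζ ζ‖ = Fp.toReal ^ (r / 2) := by
      have e : (s ζ).re = r / 2 := by simp only [hs, Complex.re_ofReal_mul, hζ1, mul_one]
      have := hpow f hf (s ζ) (by rw [e]; positivity) 2
      rw [e, show (2 : ℝ≥0∞) * ENNReal.ofReal (r / 2) = ENNReal.ofReal r by
        rw [← ENNReal.ofReal_ofNat, ← ENNReal.ofReal_mul (by norm_num)]; congr 1; ring] at this
      rw [Lp.norm_def, this, ENNReal.toReal_rpow]
    have h2 : ‖gζ ζ‖ = Gq.toReal ^ (q / 2) := by
      have e : (conj (s' ζ)).re = q / 2 := by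
        simp only [hs', Complex.conj_re, Complex.re_ofReal_mul, Complex.sub_re, Complex.one_re,
          Complex.div_ofNat_re, hζ1]
        ring
      have := hpow g hg (conj (s' ζ)) (by rw [e]; positivity) 2
      rw [e, show (2 : ℝ≥0∞) * ENNReal.ofReal (q / 2) = ENNReal.ofReal q by
        rw [← ENNReal.ofReal_ofNat, ← ENNReal.ofReal_mul (by norm_num)]; congr 1; ring] at this
      rw [Lp.norm_def, this, ENNReal.toReal_rpow]
    have e3 : ‖S (Complex.exp (W ζ)) (fζ ζ)‖ ≤ ‖fζ ζ‖ := by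
      simpa using ContinuousLinearMap.le_of_opNorm_le _ (hb _ (hWU ζ (hstrip hζs))) (fζ ζ)
    rw [← h1, ← h2]
    exact (norm_inner_le_norm _ _).trans (by gcongr)
  set τ : ℂ := ((2 / r : ℝ) : ℂ) with hτ
  have hτre : τ.re = 2 / r := Complex.ofReal_re _
  have hτs : τ ∈ Complex.HadamardThreeLines.verticalClosedStrip 0 1 := by
    change τ.re ∈ Set.Icc (0 : ℝ) 1
    rw [hτre]
    exact ⟨by positivity, (div_le_one hr0).2 hr⟩
  -- At `2/r` the powers of `‖g‖_q` add up to `q(1 - 2/r) + q/r = 1`, and that of `‖f‖_r` is `1`.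
  have hmain := Complex.HadamardThreeLines.norm_le_interp_of_mem_verticalClosedStrip₀₁' F hτs
    ((hFd.mono (fun ζ hζ => hstrip ?_)).diffContOnCl) hFb hleft hright
  · have hz0 : 0 < ‖z‖ := norm_pos_iff.2 hz.1
    have e1 : Complex.exp (W τ) = z := by
      have : W τ = Complex.log z := by
        simp only [hW, hτ, hκ, Complex.log]
        push_cast
        have : (r : ℂ) ≠ 0 := Complex.ofReal_ne_zero.2 hr0.ne'
        field_simp
      rw [this, Complex.exp_log hz.1]
    have e2 : s τ = 1 := by
      simp only [hs, hτ]
      rw [← Complex.ofReal_mul, ← Complex.ofReal_one]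
      congr 1
      field_simp
    have e3 : s' τ = 1 := by
      simp only [hs', hτ]
      have h1 : q * (1 - 2 / r / 2) = 1 := by
        have := hrq.sub_one_mul_conj
        field_simp
        linarith
      exact_mod_cast congrArg ((↑) : ℝ → ℂ) h1
    have e4 : F τ = inner ℂ (simpleLp g hg id rfl) (S z (simpleLp f hf id rfl)) := by
      have i1 : interpFn 1 = id := funext interpFn_one
      simp only [hF, hfζ, hgζ, e1, e2, e3, map_one, i1]
    rw [e4, hτre] at hmain
    refine hmain.trans (le_of_eq ?_)
    have hG0 : 0 ≤ Gq.toReal := ENNReal.toReal_nonneg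
    have hF0 : 0 ≤ Fp.toReal := ENNReal.toReal_nonneg
    rw [Real.mul_rpow (by positivity) (by positivity), ← Real.rpow_mul hG0, ← Real.rpow_mul hG0,
      ← Real.rpow_mul hF0, ← mul_assoc, ← Real.rpow_add_of_nonneg hG0
      (mul_nonneg hq0.le (sub_nonneg.2 ((div_le_one hr0).2 hr))) (by positivity)]
    have i1 : q * (1 - 2 / r) + q / 2 * (2 / r) = 1 := by
      have := hrq.sub_one_mul_conj
      field_simp
      linarith
    have i2 : r / 2 * (2 / r) = 1 := by field_simp
    rw [i1, i2, Real.rpow_one, Real.rpow_one, mul_comm]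
  · have hcl : IsClosed (Complex.HadamardThreeLines.verticalClosedStrip 0 1) :=
      isClosed_Icc.preimage Complex.continuous_re
    have hsub : Complex.HadamardThreeLines.verticalStrip 0 1 ⊆
        Complex.HadamardThreeLines.verticalClosedStrip 0 1 := fun w hw =>
      ⟨(hw.1 : 0 < w.re).le, (hw.2 : w.re < 1).le⟩
    exact closure_minimal hsub hcl hζ

end Stein

/-! ### Operators on `L²` that are contractive in `L^p` -/

section LpContractive

variable {X : Type*} [MeasurableSpace X] {μ : Measure X}

/-- `P` contracts the `L^p` norm. -/
def LpContractive (p : ℝ≥0∞) (P : Lp ℂ 2 μ →L[ℂ] Lp ℂ 2 μ) : Prop :=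
  ∀ f, eLpNorm (P f) p μ ≤ eLpNorm f p μ

theorem LpContractive.comp {p : ℝ≥0∞} {P Q : Lp ℂ 2 μ →L[ℂ] Lp ℂ 2 μ} (hP : LpContractive p P)
    (hQ : LpContractive p Q) : LpContractive p (P ∘L Q) := fun f => (hP _).trans (hQ f)

theorem lpContractive_id {p : ℝ≥0∞} : LpContractive p (ContinuousLinearMap.id ℂ (Lp ℂ 2 μ)) :=
  fun _ => le_rfl

theorem tendsto_toLp_simple {p : ℝ≥0∞} [Fact (1 ≤ p)] {f : Lp ℂ p μ} {s : ℕ → SimpleFunc X ℂ}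
    (hs : ∀ n, MemLp (s n) p μ)
    (h : Tendsto (fun n => eLpNorm (fun x => s n x - f x) p μ) atTop (𝓝 0)) :
    Tendsto (fun n => (hs n).toLp (s n)) atTop (𝓝 f) := by
  rw [Lp.tendsto_Lp_iff_tendsto_eLpNorm']
  refine h.congr fun n => eLpNorm_congr_ae ?_
  filter_upwards [(hs n).coeFn_toLp] with x hx
  simp [hx]

/-- Duality turns the bilinear interpolation estimate into a norm bound on simple functions. Since
norm balls of `L^r` are closed in `L²`, it passes to all `f` by approximating in `L²` and `L^r`
simultaneously. -/
theorem lpContractive_of_sector {S : ℂ → Lp ℂ 2 μ →L[ℂ] Lp ℂ 2 μ} {θ : ℝ}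
    (hθ : θ ≤ Real.pi / 2)
    (hd : DifferentiableOn ℂ S (sector θ)) (hb : ∀ z ∈ sector θ, ‖S z‖ ≤ 1)
    (hinf : ∀ t : ℝ, 0 < t → ∀ f, eLpNorm (S t f) ⊤ μ ≤ eLpNorm f ⊤ μ)
    {r : ℝ} (hr : 2 ≤ r) {z : ℂ} (hz : z ∈ sector (2 / r * θ)) :
    LpContractive (ENNReal.ofReal r) (S z) := by
  have hrq : r.HolderConjugate (r.conjExponent) := Real.HolderConjugate.conjExponent (by linarith)
  have hr0 : ENNReal.ofReal r ≠ 0 := by simpa using hrq.pos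
  have hr1 : 1 ≤ ENNReal.ofReal r := by
    rw [← ENNReal.ofReal_one]; exact ENNReal.ofReal_le_ofReal (by linarith)
  have hsimple : ∀ (f : SimpleFunc X ℂ) (hf : f.FinMeasSupp μ),
      eLpNorm (S z (simpleLp f hf id rfl)) (ENNReal.ofReal r) μ ≤
        eLpNorm f (ENNReal.ofReal r) μ := by
    intro f hf
    have hft : eLpNorm f (ENNReal.ofReal r) μ ≠ ⊤ :=
      ((SimpleFunc.memLp_iff_finMeasSupp hr0 ENNReal.ofReal_ne_top).2 hf).2.ne
    refine eLpNorm_le_of_simple_pairing (Lp.memLp _) two_ne_zero ENNReal.ofNat_ne_top hrq hft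
      fun g hg => ?_
    have hgt : eLpNorm g (ENNReal.ofReal r.conjExponent) μ ≠ ⊤ :=
      ((SimpleFunc.memLp_iff_finMeasSupp (by simpa using hrq.symm.pos)
        ENNReal.ofReal_ne_top).2 hg).2.ne
    have h1 := stein_interpolation hθ hd hb hinf hrq hr hz f g hf hg
    have h2 : inner ℂ (simpleLp g hg id rfl) (S z (simpleLp f hf id rfl)) =
        ∫ x, conj (g x) * (S z (simpleLp f hf id rfl)) x ∂μ := by
      rw [L2.inner_def]
      refine integral_congr_ae ?_
      filter_upwards [coeFn_simpleLp g hg id rfl] with x hx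
      rw [hx]
      simp [mul_comm]
    rw [h2, ← ENNReal.toReal_mul, ← toReal_enorm] at h1
    exact (ENNReal.toReal_le_toReal enorm_ne_top (ENNReal.mul_ne_top hft hgt)).1 h1
  intro f
  by_cases hft : eLpNorm f (ENNReal.ofReal r) μ = ⊤
  · rw [hft]; exact le_top
  have hfr : MemLp f (ENNReal.ofReal r) μ := ⟨Lp.aestronglyMeasurable f, lt_top_iff_ne_top.2 hft⟩
  obtain ⟨s, -, -, hs⟩ := exists_simple_approx (Lp.aestronglyMeasurable f)
  obtain ⟨h1, h2⟩ := hs 2 ENNReal.ofNat_ne_top (Lp.memLp f)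
  obtain ⟨h3, h4⟩ := hs _ ENNReal.ofReal_ne_top hfr
  have h5 := ((S z).continuous.tendsto f).comp (tendsto_toLp_simple h1 h2)
  refine ENNReal.le_of_forall_pos_le_add fun ε hε _ => ?_
  refine (isClosed_eLpNorm_le (μ := μ) (ENNReal.ofReal r)
    (eLpNorm f (ENNReal.ofReal r) μ + ε)).mem_of_tendsto h5 ?_
  filter_upwards [h4.eventually_le_const (by exact_mod_cast hε : (0 : ℝ≥0∞) < ε)] with n hn
  have h6 := hsimple (s n) ((SimpleFunc.memLp_iff_finMeasSupp hr0 ENNReal.ofReal_ne_top).1 (h3 n))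
  refine h6.trans ?_
  have h7 := eLpNorm_add_le hfr.1 ((h3 n).1.sub hfr.1) hr1
  refine le_trans (le_of_eq ?_) (h7.trans (by gcongr; exact hn))
  congr 1
  funext x
  simp

/-- Classes of simple functions. -/
def simpleClass (p : ℝ≥0∞) : Set (Lp ℂ p μ) :=
  {g | ∃ s : SimpleFunc X ℂ, s.FinMeasSupp μ ∧ g =ᵐ[μ] s}

theorem dense_simpleClass (p : ℝ≥0∞) [Fact (1 ≤ p)] (hp : p ≠ ⊤) :
    Dense (simpleClass p : Set (Lp ℂ p μ)) := by
  have hp0 : p ≠ 0 := (zero_lt_one.trans_le (Fact.out : 1 ≤ p)).ne'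
  intro f
  obtain ⟨s, -, -, hs⟩ := exists_simple_approx (Lp.aestronglyMeasurable f)
  obtain ⟨h1, h2⟩ := hs p hp (Lp.memLp f)
  exact mem_closure_of_tendsto (tendsto_toLp_simple h1 h2) (Eventually.of_forall fun n =>
    ⟨s n, (SimpleFunc.memLp_iff_finMeasSupp hp0 hp).1 (h1 n), (h1 n).coeFn_toLp⟩)

theorem exists_two_of_mem_simpleClass {p : ℝ≥0∞} {g : Lp ℂ p μ} (hg : g ∈ simpleClass p) :
    ∃ f : Lp ℂ 2 μ, g =ᵐ[μ] f ∧ ∀ q : ℝ≥0∞, q ≠ 0 → q ≠ ⊤ → MemLp f q μ := by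
  obtain ⟨s, hs, hgs⟩ := hg
  have h := (SimpleFunc.memLp_iff_finMeasSupp two_ne_zero ENNReal.ofNat_ne_top).2 hs
  refine ⟨h.toLp s, hgs.trans h.coeFn_toLp.symm, fun q hq0 hq => ?_⟩
  exact ((SimpleFunc.memLp_iff_finMeasSupp hq0 hq).2 hs).ae_eq h.coeFn_toLp.symm

/-- The operator is defined on the subspace `L^p ∩ L²`, dense in `L^p` because it contains the
simple functions, and extended by continuity. -/
theorem exists_extension {p : ℝ≥0∞} [Fact (1 ≤ p)] (hp : p ≠ ⊤) {P : Lp ℂ 2 μ →L[ℂ] Lp ℂ 2 μ}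
    (hP : LpContractive p P) : ∃ L : Lp ℂ p μ →L[ℂ] Lp ℂ p μ, ‖L‖ ≤ 1 ∧
      ∀ (f : Lp ℂ 2 μ) (g : Lp ℂ p μ), g =ᵐ[μ] f → L g =ᵐ[μ] P f := by
  let D : Submodule ℂ (Lp ℂ p μ) :=
    { carrier := {g | MemLp g 2 μ}
      add_mem' := fun {a b} ha hb => (MemLp.add ha hb).ae_eq (Lp.coeFn_add a b).symm
      zero_mem' := MemLp.zero.ae_eq (Lp.coeFn_zero ℂ p μ).symm
      smul_mem' := fun c a ha => (MemLp.const_smul ha c).ae_eq (Lp.coeFn_smul c a).symm }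
  have hD : ∀ g : D, MemLp (g : Lp ℂ p μ) 2 μ := fun g => g.2
  have hPD : ∀ g : D, MemLp (P ((hD g).toLp _)) p μ := fun g =>
    ⟨Lp.aestronglyMeasurable _, by
      refine (hP _).trans_lt ?_
      rw [eLpNorm_congr_ae (hD g).coeFn_toLp]
      exact (Lp.memLp (g : Lp ℂ p μ)).2⟩
  let Λ : D →ₗ[ℂ] Lp ℂ p μ :=
    { toFun := fun g => (hPD g).toLp _
      map_add' := fun a b => by
        rw [← MemLp.toLp_add]
        refine MemLp.toLp_congr _ _ ?_
        have h1 : (hD (a + b)).toLp _ = (hD a).toLp _ + (hD b).toLp _ := by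
          rw [← MemLp.toLp_add]
          exact MemLp.toLp_congr _ _ (Lp.coeFn_add (a : Lp ℂ p μ) b)
        rw [h1, map_add]
        exact Lp.coeFn_add _ _
      map_smul' := fun c a => by
        rw [RingHom.id_apply, ← MemLp.toLp_const_smul]
        refine MemLp.toLp_congr _ _ ?_
        have h1 : (hD (c • a)).toLp _ = c • (hD a).toLp _ := by
          rw [← MemLp.toLp_const_smul]
          exact MemLp.toLp_congr _ _ (Lp.coeFn_smul c (a : Lp ℂ p μ))
        rw [h1, map_smul]
        exact Lp.coeFn_smul _ _ }
  have hΛ : ∀ g : D, ‖Λ g‖ ≤ 1 * ‖D.subtype g‖ := fun g => by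
    rw [one_mul]
    change ‖(hPD g).toLp _‖ ≤ ‖(g : Lp ℂ p μ)‖
    rw [Lp.norm_toLp, Lp.norm_def]
    refine ENNReal.toReal_mono (Lp.eLpNorm_ne_top _) ((hP _).trans (le_of_eq ?_))
    exact eLpNorm_congr_ae (hD g).coeFn_toLp
  have hdense : DenseRange D.subtype := by
    refine (dense_simpleClass p hp).mono fun g hg => ?_
    obtain ⟨f, hf, -⟩ := exists_two_of_mem_simpleClass hg
    exact ⟨⟨g, (Lp.memLp f).ae_eq hf.symm⟩, rfl⟩
  refine ⟨Λ.extendOfNorm D.subtype, ?_, fun f g hfg => ?_⟩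
  · exact ContinuousLinearMap.opNorm_le_bound _ zero_le_one
      (LinearMap.norm_extendOfNorm_apply_le hdense 1 hΛ)
  · have hg : MemLp g 2 μ := (Lp.memLp f).ae_eq hfg.symm
    have h1 := LinearMap.extendOfNorm_eq hdense ⟨1, hΛ⟩ ⟨g, hg⟩
    have h2 : D.subtype ⟨g, hg⟩ = g := rfl
    rw [h2] at h1
    rw [h1]
    refine (hPD ⟨g, hg⟩).coeFn_toLp.trans ?_
    have h3 : (hD ⟨g, hg⟩).toLp _ = f := Lp.ext ((hD ⟨g, hg⟩).coeFn_toLp.trans hfg)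
    rw [h3]

open Classical in
/-- The extension to `L^p` of an operator on `L²` that contracts the `L^p` norm. -/
def lpExt (p : ℝ≥0∞) [Fact (1 ≤ p)] (P : Lp ℂ 2 μ →L[ℂ] Lp ℂ 2 μ) : Lp ℂ p μ →L[ℂ] Lp ℂ p μ :=
  if h : ∃ L : Lp ℂ p μ →L[ℂ] Lp ℂ p μ, ‖L‖ ≤ 1 ∧
      ∀ (f : Lp ℂ 2 μ) (g : Lp ℂ p μ), g =ᵐ[μ] f → L g =ᵐ[μ] P f then h.choose else 0

variable {p q : ℝ≥0∞} [Fact (1 ≤ p)] [Fact (1 ≤ q)] {P Q : Lp ℂ 2 μ →L[ℂ] Lp ℂ 2 μ}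

theorem norm_lpExt_le (hp : p ≠ ⊤) (hP : LpContractive p P) : ‖lpExt p P‖ ≤ 1 := by
  have h := exists_extension hp hP
  rw [lpExt, dif_pos h]
  exact h.choose_spec.1

theorem lpExt_apply (hp : p ≠ ⊤) (hP : LpContractive p P) {f : Lp ℂ 2 μ} {g : Lp ℂ p μ}
    (hfg : g =ᵐ[μ] f) : lpExt p P g =ᵐ[μ] P f := by
  have h := exists_extension hp hP
  rw [lpExt, dif_pos h]
  exact h.choose_spec.2 f g hfg

theorem clm_ext_simpleClass (hp : p ≠ ⊤) {L L' : Lp ℂ p μ →L[ℂ] Lp ℂ p μ}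
    (h : ∀ (g : Lp ℂ p μ) (f : Lp ℂ 2 μ), g =ᵐ[μ] f → L g =ᵐ[μ] L' g) : L = L' := by
  refine ContinuousLinearMap.coeFn_injective
    (L.continuous.ext_on (dense_simpleClass p hp) L'.continuous fun g hg => ?_)
  obtain ⟨f, hf, -⟩ := exists_two_of_mem_simpleClass hg
  exact Lp.ext (h g f hf)

theorem lpContractive_two (hP : ‖P‖ ≤ 1) : LpContractive 2 P := fun f => by
  have h : ‖P f‖ ≤ ‖f‖ := by simpa using ContinuousLinearMap.le_of_opNorm_le _ hP f
  rw [Lp.norm_def, Lp.norm_def] at h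
  exact (ENNReal.toReal_le_toReal (Lp.eLpNorm_ne_top _) (Lp.eLpNorm_ne_top _)).1 h

theorem lpExt_comp (hp : p ≠ ⊤) (hP : LpContractive p P) (hQ : LpContractive p Q) :
    lpExt p (P ∘L Q) = (lpExt p P).comp (lpExt p Q) :=
  clm_ext_simpleClass hp fun _ _ hgf => (lpExt_apply hp (hP.comp hQ) hgf).trans
    (lpExt_apply hp hP (lpExt_apply hp hQ hgf)).symm

theorem lpExt_id (hp : p ≠ ⊤) :
    lpExt p (ContinuousLinearMap.id ℂ (Lp ℂ 2 μ)) = ContinuousLinearMap.id ℂ (Lp ℂ p μ) :=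
  clm_ext_simpleClass hp fun _ _ hgf => (lpExt_apply hp lpContractive_id hgf).trans hgf.symm

theorem lpExt_two (hP : ‖P‖ ≤ 1) : lpExt 2 P = P :=
  clm_ext_simpleClass ENNReal.ofNat_ne_top fun g _ _ =>
    lpExt_apply ENNReal.ofNat_ne_top (lpContractive_two hP) (ae_eq_refl g)

/-- A common function of `L^p` and `L^q` need not lie in `L²`. It has a common simple approximation,
on which both extensions agree with `P`, and subsequences of the images converge almost everywhere.
-/
theorem lpExt_consistent (hp : p ≠ ⊤) (hq : q ≠ ⊤) (hP : LpContractive p P)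
    (hP' : LpContractive q P) {f : Lp ℂ p μ} {g : Lp ℂ q μ} (hfg : f =ᵐ[μ] g) :
    lpExt p P f =ᵐ[μ] lpExt q P g := by
  have hp0 : p ≠ 0 := (zero_lt_one.trans_le (Fact.out : 1 ≤ p)).ne'
  obtain ⟨s, -, -, hs⟩ := exists_simple_approx (Lp.aestronglyMeasurable f)
  obtain ⟨h1, h2⟩ := hs p hp (Lp.memLp f)
  obtain ⟨h3, h4⟩ := hs q hq ((Lp.memLp g).ae_eq hfg.symm)
  have h5 := tendsto_toLp_simple h1 h2
  have h6 : Tendsto (fun n => (h3 n).toLp (s n)) atTop (𝓝 g) :=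
    tendsto_toLp_simple h3 (h4.congr fun n => eLpNorm_congr_ae (by
      filter_upwards [hfg] with x hx
      rw [hx]))
  obtain ⟨ns, hns, h7⟩ := (tendstoInMeasure_of_tendsto_Lp
    (((lpExt p P).continuous.tendsto f).comp h5)).exists_seq_tendsto_ae
  obtain ⟨ms, hms, h8⟩ := (tendstoInMeasure_of_tendsto_Lp
    ((((lpExt q P).continuous.tendsto g).comp h6).comp hns.tendsto_atTop)).exists_seq_tendsto_ae
  have h9 : ∀ n, lpExt p P ((h1 n).toLp (s n)) =ᵐ[μ] lpExt q P ((h3 n).toLp (s n)) := fun n => by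
    have h10 := (SimpleFunc.memLp_iff_finMeasSupp two_ne_zero ENNReal.ofNat_ne_top).2
      ((SimpleFunc.memLp_iff_finMeasSupp hp0 hp).1 (h1 n))
    exact (lpExt_apply hp hP ((h1 n).coeFn_toLp.trans h10.coeFn_toLp.symm)).trans
      (lpExt_apply hq hP' ((h3 n).coeFn_toLp.trans h10.coeFn_toLp.symm)).symm
  filter_upwards [h7, h8, ae_all_iff.2 h9] with x e1 e2 e3
  refine tendsto_nhds_unique (e1.comp hms.tendsto_atTop) (e2.congr fun n => ?_)
  exact (e3 _).symm

end LpContractive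

/-! ### Convergence in `L^p` from convergence in `L²` -/

section Interpolation

variable {X : Type*} [MeasurableSpace X] {μ : Measure X}

/-- Cauchy–Schwarz for `|h|^r = |h| · |h|^{r-1}`. The exponent `2r - 2 ≥ 2` is again in the range
where the semigroup contracts. -/
theorem eLpNorm_rpow_le_two_mul {h : X → ℂ} (hh : AEStronglyMeasurable h μ) {r : ℝ} (hr : 2 ≤ r) :
    eLpNorm h (ENNReal.ofReal r) μ ^ r ≤
      eLpNorm h 2 μ * eLpNorm h (ENNReal.ofReal (2 * r - 2)) μ ^ (r - 1) := by
  have h1 := eLpNorm_norm_rpow (p := 1) (μ := μ) h (by linarith : 0 < r)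
  have h2 := eLpNorm_norm_rpow (p := 2) (μ := μ) h (by linarith : 0 < r - 1)
  rw [one_mul] at h1
  rw [← ENNReal.ofReal_ofNat, ← ENNReal.ofReal_mul (by norm_num),
    show 2 * (r - 1) = 2 * r - 2 by ring, ENNReal.ofReal_ofNat] at h2
  rw [← h1, ← h2]
  have hm : AEStronglyMeasurable (fun x => ‖h x‖ ^ (r - 1)) μ :=
    (hh.norm.aemeasurable.pow_const _).aestronglyMeasurable
  have h3 := eLpNorm_le_eLpNorm_mul_eLpNorm_of_nnnorm (p := 2) (q := 2) (r := 1) hh hm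
    (fun a b => ‖a‖ * b) 1 (Eventually.of_forall fun x => by simp)
  rw [ENNReal.coe_one, one_mul] at h3
  refine le_trans (le_of_eq ?_) h3
  congr 1
  funext x
  by_cases h0 : ‖h x‖ = 0
  · rw [h0, Real.zero_rpow (by linarith), zero_mul]
  · rw [show r = 1 + (r - 1) by ring, Real.rpow_add (lt_of_le_of_ne (norm_nonneg _) (Ne.symm h0)),
      Real.rpow_one]
    simp

theorem tendsto_eLpNorm_of_two {ι : Type*} {l : Filter ι} {h : ι → X → ℂ}
    (hh : ∀ i, AEStronglyMeasurable (h i) μ) {r : ℝ} (hr : 2 ≤ r) {C : ℝ≥0∞} (hC : C ≠ ⊤)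
    (h2 : Tendsto (fun i => eLpNorm (h i) 2 μ) l (𝓝 0))
    (hb : ∀ᶠ i in l, eLpNorm (h i) (ENNReal.ofReal (2 * r - 2)) μ ≤ C) :
    Tendsto (fun i => eLpNorm (h i) (ENNReal.ofReal r) μ) l (𝓝 0) := by
  have hr0 : 0 < r := by linarith
  have hC' : C ^ (r - 1) ≠ ⊤ := (ENNReal.rpow_lt_top_of_nonneg (by linarith) hC).ne
  have h3 : Tendsto (fun i => (eLpNorm (h i) 2 μ * C ^ (r - 1)) ^ (1 / r)) l (𝓝 0) := by
    have h4 := ENNReal.Tendsto.mul_const h2 (Or.inr hC') 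
    rw [zero_mul] at h4
    have h5 := (ENNReal.continuous_rpow_const (y := 1 / r)).tendsto 0
    rw [ENNReal.zero_rpow_of_pos (by positivity)] at h5
    exact h5.comp h4
  refine tendsto_of_tendsto_of_tendsto_of_le_of_le' tendsto_const_nhds h3
    (Eventually.of_forall fun i => zero_le) ?_
  filter_upwards [hb] with i hi
  have h6 := eLpNorm_rpow_le_two_mul (hh i) hr
  have h7 : eLpNorm (h i) (ENNReal.ofReal r) μ =
      (eLpNorm (h i) (ENNReal.ofReal r) μ ^ r) ^ (1 / r) := by
    rw [← ENNReal.rpow_mul, mul_one_div_cancel hr0.ne', ENNReal.rpow_one]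
  rw [h7]
  refine ENNReal.rpow_le_rpow (h6.trans ?_) (by positivity)
  gcongr
  linarith

end Interpolation

/-! ### The semigroups on `L^p` -/

theorem sector_mono {θ θ' : ℝ} (h : θ ≤ θ') : sector θ ⊆ sector θ' := fun _ hz =>
  ⟨hz.1, hz.2.trans_le h⟩

theorem tendsto_of_dense_of_norm_le {ι E : Type*} [NormedAddCommGroup E] [NormedSpace ℂ E]
    {l : Filter ι} {L : ι → E →L[ℂ] E} (hL : ∀ᶠ i in l, ‖L i‖ ≤ 1) {D : Set E} (hD : Dense D)
    (h : ∀ x ∈ D, Tendsto (fun i => L i x) l (𝓝 x)) (x : E) :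
    Tendsto (fun i => L i x) l (𝓝 x) := by
  rw [Metric.tendsto_nhds]
  intro ε hε
  obtain ⟨y, hy, hxy⟩ := hD.exists_dist_lt x (by positivity : 0 < ε / 3)
  filter_upwards [hL, Metric.tendsto_nhds.1 (h y hy) (ε / 3) (by positivity)] with i h1 h2
  have h3 : dist (L i x) (L i y) ≤ dist x y := by
    rw [dist_eq_norm, dist_eq_norm, ← map_sub]
    simpa using ContinuousLinearMap.le_of_opNorm_le _ h1 (x - y)
  calc dist (L i x) x ≤ dist (L i x) (L i y) + dist (L i y) y + dist y x := dist_triangle4 _ _ _ _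
    _ < ε / 3 + ε / 3 + ε / 3 := by
        rw [dist_comm y x]
        linarith
    _ = ε := by ring

section LpSemigroup

variable {X : Type*} [MeasurableSpace X] {μ : Measure X}

theorem convex_eLpNorm_le {q : ℝ≥0∞} (hq : 1 ≤ q) (C : ℝ≥0∞) :
    Convex ℝ {f : Lp ℂ 2 μ | eLpNorm f q μ ≤ C} := by
  intro f hf g hg s t hs ht hst
  have h1 : (s • f + t • g : Lp ℂ 2 μ) =ᵐ[μ] (s • (f : X → ℂ) + t • (g : X → ℂ)) := by
    filter_upwards [Lp.coeFn_add (s • f) (t • g), Lp.coeFn_smul s f, Lp.coeFn_smul t g]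
      with x h1 h2 h3
    rw [h1, Pi.add_apply, h2, h3]
    rfl
  have hfm := Lp.aestronglyMeasurable f
  have hgm := Lp.aestronglyMeasurable g
  change eLpNorm (s • f + t • g : Lp ℂ 2 μ) q μ ≤ C
  rw [eLpNorm_congr_ae h1]
  refine (eLpNorm_add_le (hfm.const_smul s) (hgm.const_smul t) hq).trans ?_
  rw [eLpNorm_const_smul, eLpNorm_const_smul, Real.enorm_of_nonneg hs, Real.enorm_of_nonneg ht]
  calc ENNReal.ofReal s * eLpNorm f q μ + ENNReal.ofReal t * eLpNorm g q μ
      ≤ ENNReal.ofReal s * C + ENNReal.ofReal t * C := by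
        gcongr
        · exact hf
        · exact hg
    _ = C := by rw [← add_mul, ← ENNReal.ofReal_add hs ht, hst, ENNReal.ofReal_one, one_mul]

/-- On simple functions, `L²` convergence and the `L^{2r-2}` contraction bound give `L^r`
convergence. Contractivity extends this to all of `L^p`. -/
theorem tendsto_lpExt {ι : Type*} {l : Filter ι} {P : ι → Lp ℂ 2 μ →L[ℂ] Lp ℂ 2 μ} {r : ℝ}
    (hr : 2 ≤ r) {p : ℝ≥0∞} [Fact (1 ≤ p)] (hpr : p = ENNReal.ofReal r)
    (hP : ∀ᶠ i in l, LpContractive (ENNReal.ofReal r) (P i) ∧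
      LpContractive (ENNReal.ofReal (2 * r - 2)) (P i))
    (h2 : ∀ f, Tendsto (fun i => P i f) l (𝓝 f)) (g : Lp ℂ p μ) :
    Tendsto (fun i => lpExt p (P i) g) l (𝓝 g) := by
  subst hpr
  have hp : ENNReal.ofReal r ≠ ⊤ := ENNReal.ofReal_ne_top
  refine tendsto_of_dense_of_norm_le (hP.mono fun i hi => norm_lpExt_le hp hi.1)
    (dense_simpleClass _ hp) (fun g hg => ?_) g
  obtain ⟨f, hgf, hf⟩ := exists_two_of_mem_simpleClass hg
  have hfq := hf (ENNReal.ofReal (2 * r - 2)) (by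
    rw [Ne, ENNReal.ofReal_eq_zero]; linarith) ENNReal.ofReal_ne_top
  have hq1 : 1 ≤ ENNReal.ofReal (2 * r - 2) := by
    rw [← ENNReal.ofReal_one]; exact ENNReal.ofReal_le_ofReal (by linarith)
  have h3 : Tendsto (fun i => eLpNorm (fun x => P i f x - f x) (ENNReal.ofReal r) μ) l (𝓝 0) := by
    refine tendsto_eLpNorm_of_two (fun i => (Lp.aestronglyMeasurable _).sub
      (Lp.aestronglyMeasurable _)) hr (C := eLpNorm f (ENNReal.ofReal (2 * r - 2)) μ +
        eLpNorm f (ENNReal.ofReal (2 * r - 2)) μ) (ENNReal.add_ne_top.2 ⟨hfq.2.ne, hfq.2.ne⟩)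
      ((Lp.tendsto_Lp_iff_tendsto_eLpNorm' _ _).1 (h2 f)) ?_
    filter_upwards [hP] with i hi
    refine (eLpNorm_sub_le (Lp.aestronglyMeasurable _) (Lp.aestronglyMeasurable _) hq1).trans ?_
    gcongr
    exact hi.2 f
  rw [Lp.tendsto_Lp_iff_tendsto_eLpNorm']
  refine h3.congr' ?_
  filter_upwards [hP] with i hi
  refine eLpNorm_congr_ae ?_
  filter_upwards [lpExt_apply hp hi.1 hgf, hgf] with x e1 e2
  rw [Pi.sub_apply, e1, e2]

/-- Simple functions in the unit ball of `L^q` norm `L^r`. Paired with the image of a simple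
function they give inner products in `L²`, holomorphic by assumption, so `differentiableOn_of_weak`
applies. -/
theorem differentiableOn_lpExt {S : ℂ → Lp ℂ 2 μ →L[ℂ] Lp ℂ 2 μ} {U : Set ℂ} (hU : IsOpen U)
    (hS : DifferentiableOn ℂ S U) {r : ℝ} (hr : 2 ≤ r) {p : ℝ≥0∞} [Fact (1 ≤ p)]
    (hpr : p = ENNReal.ofReal r) (hP : ∀ z ∈ U, LpContractive (ENNReal.ofReal r) (S z)) :
    DifferentiableOn ℂ (fun z => lpExt p (S z)) U := by
  subst hpr
  have hp : ENNReal.ofReal r ≠ ⊤ := ENNReal.ofReal_ne_top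
  have hp0 : ENNReal.ofReal r ≠ 0 := by rw [Ne, ENNReal.ofReal_eq_zero]; linarith
  have hrq : r.HolderConjugate (r.conjExponent) := Real.HolderConjugate.conjExponent (by linarith)
  set q := r.conjExponent with hq
  have hconj := holderConjugate_ofReal hrq
  have hq0 : ENNReal.ofReal q ≠ 0 := by simpa using hrq.symm.pos
  have hexists : ∀ g : SimpleFunc X ℂ, g.FinMeasSupp μ → eLpNorm g (ENNReal.ofReal q) μ ≤ 1 →
      ∃ ℓ : Lp ℂ (ENNReal.ofReal r) μ →L[ℂ] ℂ, ‖ℓ‖ ≤ 1 ∧ ∀ y, ℓ y = ∫ x, conj (g x) * y x ∂μ := by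
    intro g hg hg1
    have hgq : MemLp g (ENNReal.ofReal q) μ :=
      (SimpleFunc.memLp_iff_finMeasSupp hq0 ENNReal.ofReal_ne_top).2 hg
    have hgc : MemLp (fun x => conj (g x)) (ENNReal.ofReal q) μ :=
      hgq.of_le (Complex.continuous_conj.comp_aestronglyMeasurable hgq.1)
        (Eventually.of_forall fun x => by simp)
    have hint : ∀ y : Lp ℂ (ENNReal.ofReal r) μ, Integrable (fun x => conj (g x) * y x) μ :=
      fun y => hgc.integrable_mul (Lp.memLp y)
    refine ⟨LinearMap.mkContinuous
      { toFun := fun y => ∫ x, conj (g x) * y x ∂μ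
        map_add' := fun y z => ?_
        map_smul' := fun c y => ?_ } 1 (fun y => ?_), ?_, fun y => rfl⟩
    · rw [← integral_add (hint y) (hint z)]
      refine integral_congr_ae ?_
      filter_upwards [Lp.coeFn_add y z] with x hx
      rw [hx, Pi.add_apply, mul_add]
    · rw [RingHom.id_apply, smul_eq_mul, ← integral_const_mul]
      refine integral_congr_ae ?_
      filter_upwards [Lp.coeFn_smul c y] with x hx
      rw [hx, Pi.smul_apply, smul_eq_mul]
      ring
    · have h1 := enorm_integral_conj_mul_le hgq.1 (Lp.aestronglyMeasurable y) (ENNReal.ofReal r)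
        (ENNReal.ofReal q)
      have h2 := h1.trans (mul_le_mul' hg1 le_rfl)
      rw [one_mul] at h2 ⊢
      have h3 := ENNReal.toReal_mono (Lp.eLpNorm_ne_top y) h2
      rw [toReal_enorm, ← Lp.norm_def] at h3
      exact h3
    · exact LinearMap.mkContinuous_norm_le _ zero_le_one _
  refine differentiableOn_of_weak hU (fun z hz => norm_lpExt_le hp (hP z hz))
    (dense_simpleClass _ hp) {ℓ | ‖ℓ‖ ≤ 1 ∧ ∃ g : SimpleFunc X ℂ, g.FinMeasSupp μ ∧
      ∀ y, ℓ y = ∫ x, conj (g x) * y x ∂μ} (fun ℓ hℓ => hℓ.1) (fun y C hC hy => ?_) ?_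
  · have h1 : eLpNorm y (ENNReal.ofReal r) μ ≤ ENNReal.ofReal C := by
      refine eLpNorm_le_of_simple_pairing (Lp.memLp y) hp0 hp hrq ENNReal.ofReal_ne_top
        fun g hg => ?_
      have hgq : MemLp g (ENNReal.ofReal q) μ :=
        (SimpleFunc.memLp_iff_finMeasSupp hq0 ENNReal.ofReal_ne_top).2 hg
      set a := eLpNorm g (ENNReal.ofReal q) μ with ha
      by_cases ha0 : a = 0
      · have h2 := (eLpNorm_eq_zero_iff hgq.1 hq0).1 ha0
        have h3 : ∫ x, conj (g x) * y x ∂μ = 0 := by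
          rw [integral_congr_ae (g := fun _ => (0 : ℂ)) (by
            filter_upwards [h2] with x hx
            simp [hx])]
          simp
        rw [h3]
        simp
      have hat : a ≠ ⊤ := hgq.2.ne
      have hapos : 0 < a.toReal := ENNReal.toReal_pos ha0 hat
      -- The bound is known only for functionals of norm at most one, so `g` is normalised in `L^q`.
      set c : ℂ := ((a.toReal⁻¹ : ℝ) : ℂ) with hc
      set g' : SimpleFunc X ℂ := g.map (fun w => c • w) with hg'
      have hg'1 : eLpNorm g' (ENNReal.ofReal q) μ ≤ 1 := by
        have h2 : (g' : X → ℂ) = c • (g : X → ℂ) := rfl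
        have h3 : ‖c‖ₑ = a⁻¹ := by
          rw [← ofReal_norm, hc, Complex.norm_real, Real.norm_of_nonneg (by positivity),
            ENNReal.ofReal_inv_of_pos hapos, ENNReal.ofReal_toReal hat]
        rw [h2, eLpNorm_const_smul, ← ha, h3, ENNReal.inv_mul_cancel ha0 hat]
      obtain ⟨ℓ, hℓ1, hℓ⟩ := hexists g' (hg.map (by simp)) hg'1
      have h4 := hy ℓ ⟨hℓ1, g', hg.map (by simp), hℓ⟩
      have h5 : ℓ y = c * ∫ x, conj (g x) * y x ∂μ := by
        rw [hℓ, ← integral_const_mul]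
        refine integral_congr_ae (Eventually.of_forall fun x => ?_)
        simp only [hg', SimpleFunc.map_apply, smul_eq_mul, map_mul, hc, Complex.conj_ofReal]
        ring
      rw [h5, norm_mul, hc, Complex.norm_real, Real.norm_of_nonneg (by positivity),
        inv_mul_le_iff₀ hapos] at h4
      rw [← ofReal_norm, ← ENNReal.ofReal_toReal hat, ← ENNReal.ofReal_mul hC, mul_comm C]
      exact ENNReal.ofReal_le_ofReal h4
    rw [Lp.norm_def]
    exact (ENNReal.toReal_mono ENNReal.ofReal_ne_top h1).trans (ENNReal.toReal_ofReal hC).le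
  · rintro f hf ℓ ⟨-, g, hg, hℓ⟩
    obtain ⟨f₂, hff, -⟩ := exists_two_of_mem_simpleClass hf
    have hg2 := (SimpleFunc.memLp_iff_finMeasSupp two_ne_zero ENNReal.ofNat_ne_top).2 hg
    have h1 : DifferentiableOn ℂ (fun z => inner ℂ (hg2.toLp g) (S z f₂)) U :=
      (innerSL ℂ (hg2.toLp g)).differentiable.comp_differentiableOn
        (hS.clm_apply (differentiableOn_const _))
    refine h1.congr fun z hz => ?_
    rw [hℓ, L2.inner_def]
    refine integral_congr_ae ?_
    filter_upwards [lpExt_apply hp (hP z hz) hff, hg2.coeFn_toLp] with x e1 e2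
    rw [e1, e2]
    simp [mul_comm]

variable {M : ℝ} {Γ : Set (Lp ℂ 2 μ × Lp ℂ 2 μ)} {R : ℝ → Lp ℂ 2 μ →L[ℂ] Lp ℂ 2 μ}
  {S : ℂ → Lp ℂ 2 μ →L[ℂ] Lp ℂ 2 μ}

/-- The angle `θ/r` lies below both interpolation angles, `2θ/r` for `L^r` and `θ/(r-1)` for
`L^{2r-2}`. -/
theorem IsYosidaLimit.lpContractive (hS : IsYosidaLimit M R S) (h : IsSectorialResolvent M Γ R)
    (hinf : ∀ t : ℝ, 0 < t → ∀ f, eLpNorm (S t f) ⊤ μ ≤ eLpNorm f ⊤ μ) {r : ℝ} (hr : 2 ≤ r)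
    {z : ℂ} (hz : z ∈ sector (Real.arctan (1 / M) / r)) :
    LpContractive (ENNReal.ofReal r) (S z) ∧ LpContractive (ENNReal.ofReal (2 * r - 2)) (S z) := by
  have hM := h.pos
  have h0 : 0 < Real.arctan (1 / M) := Real.arctan_pos.2 (by positivity)
  have h2 := Real.arctan_lt_pi_div_two (1 / M)
  have hd := hS.differentiableOn h (isOpen_sector h0 h2) (sector_subset_cone hM)
  have hb : ∀ z ∈ sector (Real.arctan (1 / M)), ‖S z‖ ≤ 1 := fun z hz =>
    hS.norm_le_one h (sector_subset_cone hM hz)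
  constructor
  · refine lpContractive_of_sector h2.le hd hb hinf hr (sector_mono ?_ hz)
    rw [div_mul_eq_mul_div]
    gcongr
    linarith
  · refine lpContractive_of_sector h2.le hd hb hinf (by linarith) (sector_mono ?_ hz)
    rw [div_mul_eq_mul_div, show (2 : ℝ) * r - 2 = 2 * (r - 1) by ring,
      mul_div_mul_left _ _ two_ne_zero]
    have : 0 < r - 1 := by linarith
    gcongr
    linarith

theorem IsYosidaLimit.lpContractive_real (hS : IsYosidaLimit M R S)
    (h : IsSectorialResolvent M Γ R)
    (hinf : ∀ t : ℝ, 0 < t → ∀ f, eLpNorm (S t f) ⊤ μ ≤ eLpNorm f ⊤ μ) {r : ℝ} (hr : 2 ≤ r)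
    {t : ℝ} (ht : 0 ≤ t) :
    LpContractive (ENNReal.ofReal r) (S t) ∧ LpContractive (ENNReal.ofReal (2 * r - 2)) (S t) := by
  have hM := h.pos
  rcases ht.eq_or_lt with rfl | ht
  · rw [Complex.ofReal_zero, hS.map_zero]
    exact ⟨lpContractive_id, lpContractive_id⟩
  · exact hS.lpContractive h hinf hr (ofReal_mem_sector
      (div_pos (Real.arctan_pos.2 (by positivity)) (by linarith)) ht)

theorem IsYosidaLimit.isAnalyticContractionSemigroup (hS : IsYosidaLimit M R S)
    (h : IsSectorialResolvent M Γ R)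
    (hinf : ∀ t : ℝ, 0 < t → ∀ f, eLpNorm (S t f) ⊤ μ ≤ eLpNorm f ⊤ μ) {r : ℝ} (hr : 2 ≤ r)
    {p : ℝ≥0∞} [Fact (1 ≤ p)] (hpr : p = ENNReal.ofReal r) :
    IsAnalyticContractionSemigroup (fun t : ℝ≥0 => lpExt p (S (t : ℝ))) := by
  have hM := h.pos
  have hp : p ≠ ⊤ := hpr ▸ ENNReal.ofReal_ne_top
  have hθ : 0 < Real.arctan (1 / M) := Real.arctan_pos.2 (by positivity)
  have hθ2 := Real.arctan_lt_pi_div_two (1 / M)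
  have hle : Real.arctan (1 / M) / r ≤ Real.arctan (1 / M) :=
    div_le_self hθ.le (by linarith)
  have h0 : 0 < Real.arctan (1 / M) / r := div_pos hθ (by linarith)
  have hcone : sector (Real.arctan (1 / M) / r) ⊆ cone M :=
    (sector_mono hle).trans (sector_subset_cone hM)
  have hcr : ∀ t : ℝ≥0, LpContractive p (S (t : ℝ)) := fun t =>
    hpr ▸ (hS.lpContractive_real h hinf hr t.2).1
  have hcz : ∀ z ∈ sector (Real.arctan (1 / M) / r), LpContractive p (S z) := fun z hz =>
    hpr ▸ (hS.lpContractive h hinf hr hz).1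
  have hcont : ∀ f, Tendsto (fun z => S z f) (𝓝[cone M] 0) (𝓝 f) := fun f => by
    have h1 := (hS.continuousOn h f 0 (by simp [cone])).tendsto
    rwa [hS.map_zero] at h1
  refine ⟨⟨?_, fun s t => ?_, ?_⟩, fun t => norm_lpExt_le hp (hcr t),
    Real.arctan (1 / M) / r, h0, by linarith, fun z => lpExt p (S z), fun t _ => rfl, ?_, ?_, ?_, ?_⟩
  · simp only [NNReal.coe_zero, Complex.ofReal_zero, hS.map_zero]
    exact lpExt_id hp
  · simp only [NNReal.coe_add, Complex.ofReal_add]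
    rw [hS.map_add h (ofReal_mem_cone s.coe_nonneg) (ofReal_mem_cone t.coe_nonneg)]
    exact lpExt_comp hp (hcr s) (hcr t)
  · refine fun f => tendsto_lpExt hr hpr (Eventually.of_forall fun t =>
      hS.lpContractive_real h hinf hr t.2) (fun f => (hcont f).comp ?_) f
    refine tendsto_nhdsWithin_iff.2 ⟨?_, Eventually.of_forall fun t => ofReal_mem_cone t.2⟩
    have : Continuous fun t : ℝ≥0 => ((t : ℝ) : ℂ) := by fun_prop
    simpa using this.tendsto 0
  · exact differentiableOn_lpExt (isOpen_sector h0 (by linarith))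
      (hS.differentiableOn h (isOpen_sector h0 (by linarith)) hcone) hr hpr
      fun z hz => (hS.lpContractive h hinf hr hz).1
  · intro z hz w hw
    beta_reduce
    rw [hS.map_add h (hcone hz) (hcone hw)]
    exact lpExt_comp hp (hcz z hz) (hcz w hw)
  · exact fun z hz => norm_lpExt_le hp (hcz z hz)
  · refine fun f => tendsto_lpExt hr hpr ?_ (fun f =>
      (hcont f).mono_left (nhdsWithin_mono _ hcone)) f
    filter_upwards [self_mem_nhdsWithin] with z hz
    exact hS.lpContractive h hinf hr hz

/-- The difference quotients converge in `L²`. As averages of `S(s) g` they remain in the closed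
convex `L^{2r-2}` ball of radius `‖g‖_{2r-2}`, so they converge in `L^r` as well. -/
theorem IsYosidaLimit.mem_generatorGraph_lpExt (hS : IsYosidaLimit M R S)
    (h : IsSectorialResolvent M Γ R)
    (hinf : ∀ t : ℝ, 0 < t → ∀ f, eLpNorm (S t f) ⊤ μ ≤ eLpNorm f ⊤ μ) {r : ℝ} (hr : 2 ≤ r)
    {p : ℝ≥0∞} [Fact (1 ≤ p)] (hpr : p = ENNReal.ofReal r) {u g : Lp ℂ 2 μ} (hu : (u, g) ∈ Γ)
    (hg : eLpNorm g (ENNReal.ofReal (2 * r - 2)) μ ≠ ⊤) {u' g' : Lp ℂ p μ} (hu' : u' =ᵐ[μ] u)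
    (hg' : g' =ᵐ[μ] g) :
    (u', g') ∈ generatorGraph (fun t : ℝ≥0 => lpExt p (S (t : ℝ))) := by
  have hp : p ≠ ⊤ := hpr ▸ ENNReal.ofReal_ne_top
  have hq1 : 1 ≤ ENNReal.ofReal (2 * r - 2) := by
    rw [← ENNReal.ofReal_one]; exact ENNReal.ofReal_le_ofReal (by linarith)
  have hcr : ∀ t : ℝ≥0, LpContractive p (S (t : ℝ)) := fun t =>
    hpr ▸ (hS.lpContractive_real h hinf hr t.2).1
  set Y : ℝ≥0 → Lp ℂ 2 μ := fun t => (((t : ℝ) : ℂ)⁻¹) • (S (t : ℝ) u - u) with hY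
  have hY2 : Tendsto Y (𝓝[>] 0) (𝓝 g) := hS.subset_generatorGraph h hu
  have hYb : ∀ t : ℝ≥0, 0 < t → eLpNorm (Y t) (ENNReal.ofReal (2 * r - 2)) μ ≤
      eLpNorm g (ENNReal.ofReal (2 * r - 2)) μ := by
    intro t ht
    have ht' : (0 : ℝ) < t := ht
    have hc : ContinuousOn (fun s : ℝ => S s g) (Set.Icc 0 t) :=
      (hS.continuousOn h g).comp Complex.continuous_ofReal.continuousOn
        fun s hs => ofReal_mem_cone hs.1
    have h1 : Y t = ⨍ s in (0 : ℝ)..t, S s g := by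
      have hI : (∫ s in (0 : ℝ)..t, S s g) = S (t : ℝ) u - u := hS.integral_eq h hu ht'.le
      rw [interval_average_eq, hI, sub_zero, hY]
      simp only
      rw [← Complex.ofReal_inv]
      exact algebraMap_smul ℂ ((t : ℝ)⁻¹) (S (t : ℝ) u - u)
    rw [h1, Set.uIoc_of_le ht'.le]
    refine (convex_eLpNorm_le hq1 _).set_average_mem (isClosed_eLpNorm_le _ _) ?_ ?_ ?_ ?_
    · simpa using ht.ne'
    · simp
    · filter_upwards [ae_restrict_mem measurableSet_Ioc] with s hs
      exact (hS.lpContractive_real h hinf hr hs.1.le).2 g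
    · exact (hc.integrableOn_Icc).mono_set Set.Ioc_subset_Icc_self
  have hlim : Tendsto (fun t => eLpNorm (fun x => Y t x - g x) (ENNReal.ofReal r) μ) (𝓝[>] 0)
      (𝓝 0) := by
    refine tendsto_eLpNorm_of_two (fun i => (Lp.aestronglyMeasurable _).sub
      (Lp.aestronglyMeasurable _)) hr (C := eLpNorm g (ENNReal.ofReal (2 * r - 2)) μ +
        eLpNorm g (ENNReal.ofReal (2 * r - 2)) μ) (ENNReal.add_ne_top.2 ⟨hg, hg⟩)
      ((Lp.tendsto_Lp_iff_tendsto_eLpNorm' _ _).1 hY2) ?_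
    filter_upwards [self_mem_nhdsWithin] with t ht
    refine (eLpNorm_sub_le (Lp.aestronglyMeasurable _) (Lp.aestronglyMeasurable _) hq1).trans ?_
    gcongr
    exact hYb t ht
  change Tendsto (fun t : ℝ≥0 => (((t : ℝ) : ℂ)⁻¹) • (lpExt p (S (t : ℝ)) u' - u')) (𝓝[>] 0) (𝓝 g')
  rw [← hpr] at hlim
  rw [Lp.tendsto_Lp_iff_tendsto_eLpNorm']
  refine hlim.congr fun t => eLpNorm_congr_ae ?_
  filter_upwards [hg', hu', lpExt_apply hp (hcr t) hu', Lp.coeFn_smul ((((t : ℝ) : ℂ)⁻¹))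
    (S (t : ℝ) u - u), Lp.coeFn_sub (S (t : ℝ) u) u, Lp.coeFn_smul ((((t : ℝ) : ℂ)⁻¹))
    (lpExt p (S (t : ℝ)) u' - u'), Lp.coeFn_sub (lpExt p (S (t : ℝ)) u') u']
    with x e1 e2 e3 e4 e5 e6 e7
  simp only [Pi.sub_apply, Pi.smul_apply] at e4 e5 e6 e7 ⊢
  rw [hY, e4, e5, e6, e7, e1, e2, e3]

end LpSemigroup

end PolyGrowth

end

/-! ### Assembly of the theorem. -/

theorem mainTheorem6 (N : ℕ) (hN : 3 ≤ N) (α β b c lam : ℝ)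
    (hα0 : 0 < α) (hα2 : α < 2) (hβ : 0 < β) (hc : 0 ≤ c)
    (hlam : PolyGrowth.AdmissibleShift N α b c lam) :
    ∃ T : (p : ℝ≥0∞) → [Fact (1 ≤ p)] →
        ℝ≥0 → PolyGrowth.LpRN N p →L[ℂ] PolyGrowth.LpRN N p,
      -- `T 2` is the semigroup generated by the operator associated with the form
      PolyGrowth.generatorGraph (T 2) = PolyGrowth.formOperatorGraph N α β b c lam ∧
      PolyGrowth.IsSubMarkovian (T 2) ∧
      -- for `2 ≤ p < ∞`, `T p` is an analytic contraction `C₀`-semigroup on `L^p`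
      (∀ (p : ℝ≥0∞) [Fact (1 ≤ p)], 2 ≤ p → p ≠ ⊤ →
        PolyGrowth.IsAnalyticContractionSemigroup (T p)) ∧
      -- the semigroups are consistent
      (∀ (p q : ℝ≥0∞) [Fact (1 ≤ p)] [Fact (1 ≤ q)], 2 ≤ p → p ≠ ⊤ → 2 ≤ q → q ≠ ⊤ →
        ∀ (t : ℝ≥0) (f : PolyGrowth.LpRN N p) (g : PolyGrowth.LpRN N q),
          f =ᵐ[volume] g → T p t f =ᵐ[volume] T q t g) ∧
      -- the generators extend `(A_{b,c} - lam, 𝒟₀)`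
      (∀ (p : ℝ≥0∞) [Fact (1 ≤ p)], 2 ≤ p → p ≠ ⊤ →
        ∀ u : PolyGrowth.RN N → ℂ, PolyGrowth.IsTestAwayFromZero u →
          ∃ (hu : MemLp u p volume)
            (hAu : MemLp (fun x => PolyGrowth.diffOp α β b c u x - (lam : ℂ) * u x) p volume),
            (hu.toLp u, hAu.toLp _) ∈ PolyGrowth.generatorGraph (T p)) := by
  have h := PolyGrowth.isSectorialResolvent_form hN hα2 hc hlam
    (PolyGrowth.denseRange_formEmb (β := β) hN hα0)
  obtain ⟨S, hS'⟩ := h.exists_semigroup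
  have hS : PolyGrowth.IsYosidaLimit _ _ S := hS'
  have hsub : PolyGrowth.IsSubMarkovian fun t : ℝ≥0 => S (t : ℝ) :=
    PolyGrowth.isSubMarkovian_of_reLe fun t k hk f hf =>
      hS.mem_reLe hN hα2 hc hlam h hk t.coe_nonneg hf
  have hinf : ∀ t : ℝ, 0 < t → ∀ f, eLpNorm (S t f) ⊤ volume ≤ eLpNorm f ⊤ volume :=
    fun t ht f => hsub.linfty_contractive ⟨t, ht.le⟩ f
  -- The family is defined uniformly as `lpExt p`. At `p = 2` this is the original semigroup, so the
  -- statements about `T 2` concern `S` itself.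
  have h2 : (fun t : ℝ≥0 => PolyGrowth.lpExt 2 (S (t : ℝ))) = fun t : ℝ≥0 => S (t : ℝ) :=
    funext fun t =>
      PolyGrowth.lpExt_two (hS.norm_le_one h (PolyGrowth.ofReal_mem_cone t.coe_nonneg))
  have hreal : ∀ p : ℝ≥0∞, 2 ≤ p → p ≠ ⊤ → 2 ≤ p.toReal ∧ p = ENNReal.ofReal p.toReal :=
    fun p hp hp' => ⟨by simpa using ENNReal.toReal_mono hp' hp, (ENNReal.ofReal_toReal hp').symm⟩
  have hcon : ∀ p : ℝ≥0∞, 2 ≤ p → p ≠ ⊤ → ∀ t : ℝ≥0, PolyGrowth.LpContractive p (S (t : ℝ)) := by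
    intro p hp hp' t
    obtain ⟨hr, hpr⟩ := hreal p hp hp'
    rw [hpr]
    exact (hS.lpContractive_real h hinf hr t.coe_nonneg).1
  refine ⟨fun p _ t => PolyGrowth.lpExt p (S (t : ℝ)), ?_, ?_, fun p _ hp hp' => ?_,
    fun p q _ _ hp hp' hq hq' t f g hfg => ?_, fun p _ hp hp' u hu => ?_⟩
  · beta_reduce
    rw [h2]
    exact hS.generatorGraph_eq h
  · beta_reduce
    rw [h2]
    exact hsub
  · exact hS.isAnalyticContractionSemigroup h hinf (hreal p hp hp').1 (hreal p hp hp').2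
  · exact PolyGrowth.lpExt_consistent hp' hq' (hcon p hp hp' t) (hcon q hq hq' t) hfg
  · have hAu := hu.diffOp_sub α β b c lam
    refine ⟨hu.memLp p, hAu.memLp p, hS.mem_generatorGraph_lpExt h hinf (hreal p hp hp').1
      (hreal p hp hp').2 (hu.mem_formOperatorGraph hN hα0) ?_
      ((hu.memLp p).coeFn_toLp.trans (hu.memLp 2).coeFn_toLp.symm)
      ((hAu.memLp p).coeFn_toLp.trans (hAu.memLp 2).coeFn_toLp.symm)⟩
    rw [eLpNorm_congr_ae (hAu.memLp 2).coeFn_toLp]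
    exact (hAu.memLp _).2.ne
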